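/- Let $0<a<1$ and $Z_0,Z_a>0$. On $L^2_{\mathrm{per}}(0,1)$ (the $1$-periodic $L^2_{\mathrm{loc}}$ functions, with scalar product $\langle f,g\rangle=\int_0^1\overline{f}\,g$) let $$H=-\frac{\mathrm d^2}{\mathrm dx^2}-Z_0\sum_{k\in\mathbb Z}\delta_k-Z_a\sum_{k\in\mathbb Z}\delta_{k+a},$$ with form domain $H^1_{\mathrm{per}}(0,1)$, and let $\psi$ be an eigenfunction, $H\psi=E\psi$. Let $N\ge 1$ and $d\ge N$ be integers, and let $\rho:\mathbb R\to[0,\infty)$ be continuous and even with support $[-1,1]$. For $c\in\{0,a\}$ let $\phi^c_1,\dots,\phi^c_N$ be non-smooth real-valued eigenfunctions of $H_c=-\frac{\mathrm d^2}{\mathrm dx^2}-Z_c\sum_{k\in\mathbb Z}\delta_{k+c}$ for pairwise distinct eigenvalues. For $0<\eta<\min(\frac a2,\frac{1-a}2)$ define: * the pseudo wave function $\tilde\phi^c_i$, which is $1$-periodic, equals $\phi^c_i$ outside $\bigcup_{k\in\mathbb Z}[c+k-\eta,c+k+\eta]$, and is on $[c-\eta,c+\eta]$ an even polynomial in $x-c$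 of degree at most $2d-2$ whose derivatives of order $0,\dots,d-1$ at $c+\eta$ agree with those of $\phi^c_i$; * $p^c_i(t)=\rho_\eta(t-c)\,\tilde\phi^c_i(t)$, where $\rho_\eta(t)=\sum_{k\in\mathbb Z}\rho\big(\frac{t-k}{\eta}\big)$; the matrix $B^c_{ij}=\langle p^c_i,\tilde\phi^c_j\rangle$; and the projectors $\tilde p^c_k=\sum_{j=1}^N\big((B^c)^{-1}\big)_{kj}\,p^c_j$; * $T_c=\sum_{i=1}^N(\phi^c_i-\tilde\phi^c_i)\langle\tilde p^c_i,\cdot\rangle$ and $T=T_0+T_a$. Let $0<\eta_0<\min(\frac a2,\frac{1-a}2)$ be such that, for all $0<\eta\le\eta_0$ and both $c\in\{0,a\}$, the matrix $B^c$ is invertible (so that the projectors are defined) and the matrix $\big(\langle\tilde p^c_k,\phi^c_\ell\rangle\big)_{1\le k,\ell\le N}$ is invertible. For $0<\eta\le\eta_0$ let $\tilde\psi\in L^2_{\mathrm{per}}(0,1)$ be the pseudo wave function, i.e. $(\mathrm{Id}+T)\tilde\psi=\psi$, and let $\widehat{\tilde\psi}_m=\int_0^1\tilde\psi(x)e^{-2i\pi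 mx}\,\mathrm dx$. Then there exists a constant $C>0$, independent of $\eta$ and $m$, such that for all $0<\eta\le\eta_0$ and all integers $m\ge\frac1\eta$, $$\left|\widehat{\tilde\psi}_m\right|\le C\left(\frac{\eta^{2N}}{m^2}+\frac{1}{\eta^{d-1}m^{d+1}}\right).$$ -/

import Mathlib

open MeasureTheory Polynomial
open scoped ComplexConjugate

noncomputable section

namespace VPAW

/-! ### Periodic function spaces and Schrödinger operators with Dirac potentials -/

/-- `f` is (a pointwise defined representative of) an element of `L²_per(0,1)`. -/
structure MemL2Per (f : ℝ → ℂ) : Prop where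
  periodic : Function.Periodic f 1
  memLp : MemLp f 2 (volume.restrict (Set.Ioc (0 : ℝ) 1))

/-- `u` is the continuous representative of an element of `H¹_per(0,1)`, with weak derivative `g`:
`u` is a `1`-periodic primitive of the `1`-periodic function `g ∈ L²_loc`. -/
structure HasH1PerDeriv (u g : ℝ → ℂ) : Prop where
  periodic : Function.Periodic u 1
  memL2 : MemL2Per g
  integral_eq : ∀ x y : ℝ, ∫ t in x..y, g t = u y - u x

/-- `u` is an eigenfunction, for the eigenvalue `E`, of the operator
`-d²/dx² - ∑ i, Z i ∑_{k ∈ ℤ} δ_{k + pos i}` on `L²_per(0,1)` with form domain `H¹_per(0,1)`: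
`u` is a nonzero element of the form domain and
`∫₀¹ u' v̄' - ∑ i, Z i u(pos i) v̄(pos i) = E ∫₀¹ u v̄` for all `v` in the form domain. -/
def IsDiracEigenfunction {n : ℕ} (Z pos : Fin n → ℝ) (E : ℝ) (u : ℝ → ℂ) : Prop :=
  u ≠ 0 ∧ ∃ u' : ℝ → ℂ, HasH1PerDeriv u u' ∧
    ∀ v v' : ℝ → ℂ, HasH1PerDeriv v v' →
      (∫ x in (0 : ℝ)..1, u' x * conj (v' x)) - ∑ i, (Z i : ℂ) * (u (pos i) * conj (v (pos i)))
        = (E : ℂ) * ∫ x in (0 : ℝ)..1, u x * conj (v x)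

/-- `φ₁, …, φ_N` are non-smooth (real-valued) eigenfunctions of the one-atom operator
`-d²/dx² - Z ∑_{k ∈ ℤ} δ_{k + c}`, for pairwise distinct eigenvalues. -/
def IsAtomicFamily {N : ℕ} (Z c : ℝ) (φ : Fin N → ℝ → ℝ) : Prop :=
  ∃ ε : Fin N → ℝ, Function.Injective ε ∧
    ∀ i, IsDiracEigenfunction ![Z] ![c] (ε i) (fun x => (φ i x : ℂ)) ∧
      ¬ ContDiff ℝ (⊤ : ℕ∞) (φ i)

/-! ### Pseudo wave functions -/

/-- `q` is an even polynomial of degree at most `2d - 2` such that `q^{(k)}(η) = f^{(k)}(η)` for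
`0 ≤ k ≤ d - 1`. -/
structure IsPseudoPoly (d : ℕ) (η : ℝ) (f : ℝ → ℝ) (q : ℝ[X]) : Prop where
  even : ∀ x, q.eval (-x) = q.eval x
  natDegree_le : q.natDegree ≤ 2 * d - 2
  deriv_eq : ∀ k < d, (derivative^[k] q).eval η = iteratedDeriv k f η

theorem isPseudoPoly_sub_eq_zero {d : ℕ} (hd : 1 ≤ d) {η : ℝ} (hη : 0 < η) {r : ℝ[X]}
    (he : ∀ x, r.eval (-x) = r.eval x) (hdeg : r.natDegree ≤ 2 * d - 2)
    (hr : ∀ k < d, (derivative^[k] r).eval η = 0) : r = 0 := by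
  by_contra h0
  have hm : d ≤ r.rootMultiplicity η := by
    have := (lt_rootMultiplicity_iff_isRoot_iterate_derivative (p := r) (t := η) (n := d - 1) h0).2
      (fun m hm => hr m (by omega))
    omega
  have h1 : (X - C η) ^ d ∣ r := (le_rootMultiplicity_iff h0).1 hm
  have hcomp : r.comp (-X) = r := by
    apply Polynomial.funext
    intro x
    simpa using he x
  have h2 : (X + C η) ^ d ∣ r := by
    obtain ⟨s, hs⟩ := h1
    refine ⟨(-1) ^ d * s.comp (-X), ?_⟩
    have h3 := congrArg (fun p : ℝ[X] => p.comp (-X)) hs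
    simp only [hcomp, mul_comp, pow_comp, sub_comp, X_comp, C_comp] at h3
    have h4 : (-X - C η : ℝ[X]) = (X + C η) * (-1) := by ring
    rw [h4, mul_pow] at h3
    rw [← mul_assoc]
    exact h3
  have hco : IsCoprime (X - C η) (X + C η) := by
    have := isCoprime_X_sub_C_of_isUnit_sub (R := ℝ) (a := η) (b := -η)
      (by rw [sub_neg_eq_add]; exact (isUnit_iff_ne_zero.2 (by positivity)))
    simpa using this
  have h5 : (X - C η) ^ d * (X + C η) ^ d ∣ r := (hco.pow).mul_dvd h1 h2
  have h6 := natDegree_le_of_dvd h5 h0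
  rw [((monic_X_sub_C η).pow d).natDegree_mul ((monic_X_add_C η).pow d)] at h6
  simp at h6
  omega

theorem existsUnique_isPseudoPoly {d : ℕ} (hd : 1 ≤ d) {η : ℝ} (hη : 0 < η) (f : ℝ → ℝ) :
    ∃! q, IsPseudoPoly d η f q := by
  let P : (Fin d → ℝ) →ₗ[ℝ] ℝ[X] :=
    ∑ j : Fin d, (LinearMap.toSpanSingleton ℝ ℝ[X] (X ^ (2 * (j : ℕ)))).comp (LinearMap.proj j)
  have hP : ∀ c, P c = ∑ j : Fin d, c j • (X : ℝ[X]) ^ (2 * (j : ℕ)) := by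
    intro c
    simp [P]
  have hPe : ∀ c x, (P c).eval (-x) = (P c).eval x := by
    intro c x
    rw [hP]
    simp [eval_finsetSum, pow_mul]
  have hPd : ∀ c, (P c).natDegree ≤ 2 * d - 2 := by
    intro c
    rw [hP]
    refine natDegree_sum_le_of_forall_le _ _ (fun j _ => ?_)
    refine (natDegree_smul_le _ _).trans ?_
    rw [natDegree_X_pow]
    have := j.2
    omega
  have hP0 : ∀ c, P c = 0 → c = 0 := by
    intro c hc
    funext j
    have := congrArg (fun p : ℝ[X] => p.coeff (2 * (j : ℕ))) hc
    simp only [hP, finsetSum_coeff, coeff_smul, coeff_X_pow, coeff_zero] at this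
    rw [Finset.sum_eq_single j] at this
    · simpa using this
    · intro b _ hb
      have : 2 * (j : ℕ) ≠ 2 * (b : ℕ) := fun h => hb (Fin.ext (by omega))
      simp [this]
    · simp
  let L : (Fin d → ℝ) →ₗ[ℝ] (Fin d → ℝ) :=
    LinearMap.pi fun k => (leval η).comp (((derivative (R := ℝ)) ^ (k : ℕ)).comp P)
  have hL : ∀ c k, L c k = (derivative^[(k : ℕ)] (P c)).eval η := by
    intro c k
    simp [L, leval, Module.End.pow_apply]
  have hinj : Function.Injective L := by
    rw [injective_iff_map_eq_zero]
    intro c hc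
    refine hP0 c (isPseudoPoly_sub_eq_zero hd hη (hPe c) (hPd c) (fun k hk => ?_))
    have := congrFun hc ⟨k, hk⟩
    rw [hL] at this
    simpa using this
  obtain ⟨c, hc⟩ := (LinearMap.injective_iff_surjective.1 hinj) fun k => iteratedDeriv (k : ℕ) f η
  refine ⟨P c, ⟨hPe c, hPd c, fun k hk => ?_⟩, fun q hq => ?_⟩
  · have := congrFun hc ⟨k, hk⟩
    rw [hL] at this
    simpa using this
  · rw [← sub_eq_zero]
    refine isPseudoPoly_sub_eq_zero hd hη (fun x => ?_) ?_ (fun k hk => ?_)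
    · rw [eval_sub, eval_sub, hq.even, hPe]
    · exact (natDegree_sub_le _ _).trans (max_le hq.natDegree_le (hPd c))
    · have := congrFun hc ⟨k, hk⟩
      rw [hL] at this
      rw [iterate_derivative_sub, eval_sub, hq.deriv_eq k hk, sub_eq_zero]
      simpa using this.symm

/-- The polynomial of `IsPseudoPoly`; it exists and is unique as soon as `1 ≤ d` and `0 < η`
(otherwise the value is `0` by convention if there is none). -/
def pseudoPoly (d : ℕ) (η : ℝ) (f : ℝ → ℝ) : ℝ[X] :=
  open Classical in if h : ∃ q, IsPseudoPoly d η f q then h.choose else 0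

theorem isPseudoPoly_pseudoPoly {d : ℕ} (hd : 1 ≤ d) {η : ℝ} (hη : 0 < η) (f : ℝ → ℝ) :
    IsPseudoPoly d η f (pseudoPoly d η f) := by
  have h := (existsUnique_isPseudoPoly hd hη f).exists
  rw [pseudoPoly, dif_pos h]
  exact h.choose_spec

/-- The pseudo wave function `φ̃` attached to the atomic function `φ` for the atom at `c + ℤ`:
it is `1`-periodic, equal to `φ` outside `⋃ₖ [c + k - η, c + k + η]`, and, inside, an even
polynomial of degree at most `2d - 2` in the variable `x - c - k`, whose derivatives of order
`< d` at `c + η` agree with those of `φ`. Here `x - c - round (x - c)` is the signed displacement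
of `x` from the nearest point of `c + ℤ`. -/
def pseudoFun (d : ℕ) (c η : ℝ) (φ : ℝ → ℝ) (x : ℝ) : ℝ :=
  if |x - c - round (x - c)| ≤ η then
    (pseudoPoly d η (fun t => φ (c + t))).eval (x - c - round (x - c))
  else φ x

/-! ### Projectors and the VPAW operator -/

/-- `ρ_η(t) = ∑_{k ∈ ℤ} ρ((t - k) / η)`. -/
def rhoScaled (ρ : ℝ → ℝ) (η t : ℝ) : ℝ := ∑' k : ℤ, ρ ((t - k) / η)

/-- `p_i(t) = ρ_η(t - c) φ̃_i(t)`. -/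
def preProj {N : ℕ} (d : ℕ) (ρ : ℝ → ℝ) (c η : ℝ) (φ : Fin N → ℝ → ℝ) (i : Fin N) (t : ℝ) : ℝ :=
  rhoScaled ρ η (t - c) * pseudoFun d c η (φ i) t

/-- `B_ij = ⟨p_i, φ̃_j⟩`, the scalar product being that of `L²_per(0,1)`. -/
def gramB {N : ℕ} (d : ℕ) (ρ : ℝ → ℝ) (c η : ℝ) (φ : Fin N → ℝ → ℝ) : Matrix (Fin N) (Fin N) ℝ :=
  Matrix.of fun i j => ∫ t in (0 : ℝ)..1, preProj d ρ c η φ i t * pseudoFun d c η (φ j) t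

/-- The projector functions `p̃_k = ∑_j (B⁻¹)_kj p_j`. -/
def proj {N : ℕ} (d : ℕ) (ρ : ℝ → ℝ) (c η : ℝ) (φ : Fin N → ℝ → ℝ) (k : Fin N) (t : ℝ) : ℝ :=
  ∑ j, (gramB d ρ c η φ)⁻¹ k j * preProj d ρ c η φ j t

/-- The matrix `(⟨p̃_k, φ_l⟩)_{k,l}`. -/
def projMatrix {N : ℕ} (d : ℕ) (ρ : ℝ → ℝ) (c η : ℝ) (φ : Fin N → ℝ → ℝ) :
    Matrix (Fin N) (Fin N) ℝ :=
  Matrix.of fun k l => ∫ t in (0 : ℝ)..1, proj d ρ c η φ k t * φ l t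

/-- Well-posedness at one atom: `B` is invertible, so that the projectors `p̃_k` are well defined,
and the matrix `(⟨p̃_k, φ_l⟩)_{k,l}` is invertible. -/
def WellPosed {N : ℕ} (d : ℕ) (ρ : ℝ → ℝ) (c η : ℝ) (φ : Fin N → ℝ → ℝ) : Prop :=
  IsUnit (gramB d ρ c η φ).det ∧ IsUnit (projMatrix d ρ c η φ).det

/-- The one-atom operator `T_c f = ∑ i, (φ_i - φ̃_i) ⟨p̃_i, f⟩`. -/
def atomOp {N : ℕ} (d : ℕ) (ρ : ℝ → ℝ) (c η : ℝ) (φ : Fin N → ℝ → ℝ) (f : ℝ → ℂ) (x : ℝ) : ℂ :=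
  ∑ i, ((φ i x - pseudoFun d c η (φ i) x : ℝ) : ℂ) *
    ∫ t in (0 : ℝ)..1, (proj d ρ c η φ i t : ℂ) * f t

/-- `ψt ∈ L²_per(0,1)` is a pseudo wave function for `ψ`: `(Id + T_0 + T_a) ψt = ψ` in
`L²_per(0,1)`. -/
def IsPseudoWave {N : ℕ} (d : ℕ) (ρ : ℝ → ℝ) (a η : ℝ) (φ₀ φₐ : Fin N → ℝ → ℝ)
    (ψ ψt : ℝ → ℂ) : Prop :=
  MemL2Per ψt ∧
    ∀ᵐ x ∂(volume : Measure ℝ), ψt x + atomOp d ρ 0 η φ₀ ψt x + atomOp d ρ a η φₐ ψt x = ψ x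

end VPAW

end

noncomputable section

namespace VPAW

/-! ### Primitives of locally integrable functions -/

/-- `F` is a primitive of the locally integrable function `g`. -/
structure IsPrimitive {𝕜 : Type*} [RCLike 𝕜] (F g : ℝ → 𝕜) : Prop where
  integrable : ∀ x y : ℝ, IntervalIntegrable g volume x y
  integral_eq : ∀ x y : ℝ, ∫ t in x..y, g t = F y - F x

namespace IsPrimitive

theorem eq_add {𝕜 : Type*} [RCLike 𝕜] {F g : ℝ → 𝕜} (h : IsPrimitive F g) (a x : ℝ) :
    F x = F a + ∫ t in a..x, g t := by
  rw [h.integral_eq]; ring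

theorem continuous {𝕜 : Type*} [RCLike 𝕜] {F g : ℝ → 𝕜} (h : IsPrimitive F g) :
    Continuous F := by
  rw [funext (h.eq_add 0)]
  exact continuous_const.add (intervalIntegral.continuous_primitive h.integrable 0)

theorem of_hasDerivAt {F g : ℝ → ℂ} (h : ∀ x, HasDerivAt F (g x) x) (hg : Continuous g) :
    IsPrimitive F g where
  integrable x y := hg.intervalIntegrable x y
  integral_eq x y := intervalIntegral.integral_eq_sub_of_hasDerivAt (fun t _ => h t)
    (hg.intervalIntegrable x y)

theorem re {F g : ℝ → ℂ} (h : IsPrimitive F g) :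
    IsPrimitive (fun x => (F x).re) (fun x => (g x).re) where
  integrable x y := by
    have := h.integrable x y
    exact ⟨this.1.re, this.2.re⟩
  integral_eq x y := by
    rw [← Complex.sub_re, ← h.integral_eq]
    exact (Complex.reCLM.intervalIntegral_comp_comm (h.integrable x y))

theorem im {F g : ℝ → ℂ} (h : IsPrimitive F g) :
    IsPrimitive (fun x => (F x).im) (fun x => (g x).im) where
  integrable x y := by
    have := h.integrable x y
    exact ⟨this.1.im, this.2.im⟩
  integral_eq x y := by
    rw [← Complex.sub_im, ← h.integral_eq]
    exact (Complex.imCLM.intervalIntegral_comp_comm (h.integrable x y))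

theorem complexConj {F g : ℝ → ℂ} (h : IsPrimitive F g) :
    IsPrimitive (fun x => conj (F x)) (fun x => conj (g x)) where
  integrable x y := by
    have := h.integrable x y
    exact ⟨(Complex.conjLIE.toContinuousLinearEquiv.toContinuousLinearMap.integrable_comp this.1),
      (Complex.conjLIE.toContinuousLinearEquiv.toContinuousLinearMap.integrable_comp this.2)⟩
  integral_eq x y := by
    rw [← map_sub, ← h.integral_eq]
    exact Complex.conjLIE.toContinuousLinearEquiv.toContinuousLinearMap.intervalIntegral_comp_comm
      (h.integrable x y)

theorem integral_mul_real {F g G k : ℝ → ℝ} (hF : IsPrimitive F g) (hG : IsPrimitive G k)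
    (a b : ℝ) :
    ∫ x in a..b, F x * k x = F b * G b - F a * G a - ∫ x in a..b, g x * G x := by
  have key : ∀ {F g : ℝ → ℝ}, IsPrimitive F g → AbsolutelyContinuousOnInterval F a b ∧
      ∀ᵐ x, x ∈ Set.uIcc a b → deriv F x = g x := by
    intro F g h
    constructor
    · have h1 := (h.integrable a b).absolutelyContinuousOnInterval_intervalIntegral (c := a)
        (by simp)
      have h2 : AbsolutelyContinuousOnInterval (fun _ : ℝ => F a) a b :=
        (LipschitzWith.const (F a)).lipschitzOnWith.absolutelyContinuousOnInterval
      have := h2.add h1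
      rw [funext (h.eq_add a)]
      exact this
    · filter_upwards [(h.integrable a b).ae_hasDerivAt_integral] with x hx hxm
      have := (hx hxm a (by simp)).const_add (F a)
      rw [funext (h.eq_add a)]
      exact this.deriv
  have e1 : ∫ x in a..b, F x * k x = ∫ x in a..b, F x * deriv G x := by
    apply intervalIntegral.integral_congr_ae
    filter_upwards [(key hG).2] with x hx hxm
    rw [hx (Set.uIoc_subset_uIcc hxm)]
  have e2 : ∫ x in a..b, g x * G x = ∫ x in a..b, deriv F x * G x := by
    apply intervalIntegral.integral_congr_ae
    filter_upwards [(key hF).2] with x hx hxm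
    rw [hx (Set.uIoc_subset_uIcc hxm)]
  rw [e1, e2]
  exact (key hF).1.integral_mul_deriv_eq_deriv_mul (key hG).1

/-- Integration by parts for primitives of complex-valued locally integrable functions. -/
theorem integral_mul {F g G k : ℝ → ℂ} (hF : IsPrimitive F g) (hG : IsPrimitive G k)
    (a b : ℝ) :
    ∫ x in a..b, F x * k x = F b * G b - F a * G a - ∫ x in a..b, g x * G x := by
  have i1 : IntervalIntegrable (fun x => F x * k x) volume a b :=
    (hG.integrable a b).continuousOn_mul hF.continuous.continuousOn
  have i2 : IntervalIntegrable (fun x => g x * G x) volume a b :=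
    (hF.integrable a b).mul_continuousOn hG.continuous.continuousOn
  have hre : ∀ {f : ℝ → ℂ}, IntervalIntegrable f volume a b →
      (∫ x in a..b, f x).re = ∫ x in a..b, (f x).re := fun h =>
    (Complex.reCLM.intervalIntegral_comp_comm h).symm
  have him : ∀ {f : ℝ → ℂ}, IntervalIntegrable f volume a b →
      (∫ x in a..b, f x).im = ∫ x in a..b, (f x).im := fun h =>
    (Complex.imCLM.intervalIntegral_comp_comm h).symm
  have cm : ∀ {F G k g : ℝ → ℝ}, IsPrimitive F g → IsPrimitive G k →
      IntervalIntegrable (fun x => F x * k x) volume a b := fun h h' =>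
    (h'.integrable a b).continuousOn_mul h.continuous.continuousOn
  have mc : ∀ {F G k g : ℝ → ℝ}, IsPrimitive F g → IsPrimitive G k →
      IntervalIntegrable (fun x => g x * G x) volume a b := fun h h' =>
    (h.integrable a b).mul_continuousOn h'.continuous.continuousOn
  apply Complex.ext
  · simp only [Complex.sub_re, Complex.mul_re]
    rw [hre i1, hre i2]
    simp only [Complex.mul_re]
    rw [intervalIntegral.integral_sub (cm hF.re hG.re) (cm hF.im hG.im),
      intervalIntegral.integral_sub (mc hF.re hG.re) (mc hF.im hG.im),
      integral_mul_real hF.re hG.re, integral_mul_real hF.im hG.im]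
    ring
  · simp only [Complex.sub_im, Complex.mul_im]
    rw [him i1, him i2]
    simp only [Complex.mul_im]
    rw [intervalIntegral.integral_add (cm hF.re hG.im) (cm hF.im hG.re),
      intervalIntegral.integral_add (mc hF.re hG.im) (mc hF.im hG.re),
      integral_mul_real hF.re hG.im, integral_mul_real hF.im hG.re]
    ring

end IsPrimitive

/-! ### Functions in `L²_per` and `H¹_per` -/

theorem MemL2Per.intervalIntegrable {f : ℝ → ℂ} (h : MemL2Per f) (x y : ℝ) :
    IntervalIntegrable f volume x y := by
  refine h.periodic.intervalIntegrable₀ one_ne_zero ?_ x y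
  rw [intervalIntegrable_iff_integrableOn_Ioc_of_le zero_le_one]
  exact h.memLp.integrable (by norm_num)

theorem HasH1PerDeriv.isPrimitive {u g : ℝ → ℂ} (h : HasH1PerDeriv u g) : IsPrimitive u g :=
  ⟨h.memL2.intervalIntegrable, h.integral_eq⟩

theorem integral_zero_one_eq {f : ℝ → ℂ} (h : Function.Periodic f 1) (b : ℝ) :
    ∫ x in (0 : ℝ)..1, f x = ∫ x in b..(b + 1), f x := by
  have := h.intervalIntegral_add_eq 0 b
  simpa using this

theorem periodic_eq_of_int {f : ℝ → ℂ} (h : Function.Periodic f 1) {x y : ℝ}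
    (hk : ∃ k : ℤ, y = x + k) : f y = f x := by
  obtain ⟨k, rfl⟩ := hk
  have := h.int_mul k x
  simpa using this

/-- A constant is a smooth periodic function. -/
theorem hasH1PerDeriv_const (z : ℂ) : HasH1PerDeriv (fun _ => z) (fun _ => 0) where
  periodic _ := rfl
  memL2 := ⟨fun _ => rfl, MemLp.zero⟩
  integral_eq x y := by simp


/-! ### From the weak formulation to an integral equation -/

theorem intervalIntegrable_fun_sum {ι : Type*} {s : Finset ι} {f : ι → ℝ → ℂ} {a b : ℝ}
    (h : ∀ i ∈ s, IntervalIntegrable (f i) volume a b) :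
    IntervalIntegrable (fun x => ∑ i ∈ s, f i x) volume a b := by
  have := IntervalIntegrable.sum s h
  rwa [Finset.sum_fn] at this

theorem integral_indicator_Ioi {f : ℝ → ℂ} (hf : ∀ x y : ℝ, IntervalIntegrable f volume x y)
    {b x p : ℝ} (hb : b ≤ p) :
    IntervalIntegrable (fun t => (if p < t then 1 else 0 : ℂ) * f t) volume b x ∧
    ∫ t in b..x, (if p < t then 1 else 0 : ℂ) * f t = ∫ t in p..(max x p), f t := by
  have e : (fun t => (if p < t then 1 else 0 : ℂ) * f t) = Set.indicator (Set.Ioi p) f := by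
    ext t
    by_cases h : p < t <;> simp [h]
  have hi : ∀ y z : ℝ, IntervalIntegrable
      (fun t => (if p < t then 1 else 0 : ℂ) * f t) volume y z := by
    intro y z
    rw [e, intervalIntegrable_iff]
    exact (intervalIntegrable_iff.1 (hf y z)).indicator measurableSet_Ioi
  refine ⟨hi b x, ?_⟩
  have h0 : ∀ y, y ≤ p → ∫ t in b..y, (if p < t then 1 else 0 : ℂ) * f t = 0 := by
    intro y hy
    rw [intervalIntegral.integral_congr (g := fun _ => (0 : ℂ))]
    · simp
    · intro t ht
      have h2 := ht.2
      have : t ≤ p := h2.trans (max_le hb hy)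
      simp [not_lt.2 this]
  rcases le_total x p with h | h
  · rw [max_eq_right h, h0 x h, intervalIntegral.integral_same]
  · rw [max_eq_left h, ← intervalIntegral.integral_add_adjacent_intervals (hi b p) (hi p x),
      h0 p le_rfl, zero_add]
    apply intervalIntegral.integral_congr_ae
    refine Filter.Eventually.of_forall fun t ht => ?_
    rw [Set.uIoc_of_le h] at ht
    simp [ht.1]

/-- An eigenfunction solves, on a period cell `[b, b + 1]`, the twice integrated eigenvalue
equation. -/
theorem IsDiracEigenfunction.exists_integral_eq {n : ℕ} {Z pos : Fin n → ℝ} {E : ℝ} {u : ℝ → ℂ}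
    (h : IsDiracEigenfunction Z pos E u) {b : ℝ} {pos' : Fin n → ℝ}
    (hpos' : ∀ i, pos' i ∈ Set.Icc b (b + 1)) (hk : ∀ i, ∃ k : ℤ, pos' i = pos i + k) :
    ∃ κ : ℂ, ∀ x ∈ Set.Icc b (b + 1),
      u x = u b + (∫ t in b..x, (κ - E * ∫ y in b..t, u y))
        - ∑ i, (Z i : ℂ) * u (pos i) * (max (x - pos' i) 0 : ℝ) := by
  obtain ⟨-, g, hug, hw⟩ := h
  have hu : IsPrimitive u g := hug.isPrimitive
  have huc : Continuous u := hu.continuous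
  set U : ℝ → ℂ := fun x => ∫ y in b..x, u y with hU
  have hUd : ∀ x, HasDerivAt U (u x) x := fun x =>
    intervalIntegral.integral_hasDerivAt_right (huc.intervalIntegrable _ _)
      (huc.stronglyMeasurableAtFilter _ _) huc.continuousAt
  have hUp : IsPrimitive U u := IsPrimitive.of_hasDerivAt hUd huc
  have hUc : Continuous U := hUp.continuous
  set G : ℝ → ℂ := fun x => E * U x + ∑ i, (Z i : ℂ) * u (pos i) * (if pos' i < x then 1 else 0)
    with hG
  set τ : ℝ → ℝ := fun x => b + Int.fract (x - b) with hτ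
  have hτp : Function.Periodic τ 1 := by
    intro x
    simp only [hτ]
    rw [show x + 1 - b = (x - b) + 1 by ring, Int.fract_add_one]
  have hτm : Measurable τ := by
    simp only [hτ]
    exact measurable_const.add (measurable_fract.comp (measurable_id.sub_const b))
  have hτI : ∀ x, τ x ∈ Set.Icc b (b + 1) := fun x =>
    ⟨by simp only [hτ]; linarith [Int.fract_nonneg (x - b)],
      by simp only [hτ]; linarith [(Int.fract_lt_one (x - b)).le]⟩
  have hτe : ∀ x, x ∈ Set.Ico b (b + 1) → τ x = x := by
    intro x hx
    simp only [hτ]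
    rw [Int.fract_eq_self.2 ⟨by linarith [hx.1], by linarith [hx.2]⟩]
    ring
  have hGm : Measurable G := by
    simp only [hG]
    refine (hUc.measurable.const_mul _).add (Finset.measurable_sum _ fun i _ => ?_)
    exact (Measurable.ite measurableSet_Ioi measurable_const measurable_const).const_mul _
  have hGb : ∃ M, ∀ x ∈ Set.Icc b (b + 1), ‖G x‖ ≤ M := by
    obtain ⟨M, hM⟩ := isCompact_Icc.exists_bound_of_continuousOn
      (hUc.continuousOn (s := Set.Icc b (b + 1)))
    refine ⟨|E| * M + ∑ i, ‖(Z i : ℂ) * u (pos i)‖, fun x hx => ?_⟩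
    refine (norm_add_le _ _).trans (add_le_add ?_ ?_)
    · rw [norm_mul, Complex.norm_real, Real.norm_eq_abs]
      exact mul_le_mul_of_nonneg_left (hM x hx) (abs_nonneg _)
    · refine (norm_sum_le _ _).trans (Finset.sum_le_sum fun i _ => ?_)
      rw [norm_mul]
      refine mul_le_of_le_one_right (norm_nonneg _) ?_
      split_ifs <;> simp
  obtain ⟨M, hM⟩ := hGb
  have hGL : MemL2Per (fun x => G (τ x)) := by
    refine ⟨fun x => by simp only [hτp x], ?_⟩
    exact MemLp.of_bound (hGm.comp hτm).aestronglyMeasurable M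
      (Filter.Eventually.of_forall fun x => hM _ (hτI x))
  set h0 : ℝ → ℂ := fun x => g x + G (τ x) with hh0
  have hh0L : MemL2Per h0 :=
    ⟨hug.memL2.periodic.add hGL.periodic, hug.memL2.memLp.add hGL.memLp⟩
  set μ : ℂ := ∫ x in b..(b + 1), h0 x with hμ
  set v' : ℝ → ℂ := fun x => h0 x - μ with hv'
  have hv'L : MemL2Per v' :=
    ⟨fun x => by simp only [hv', hh0L.periodic x], hh0L.memLp.sub (memLp_const _)⟩
  have hv'i := hv'L.intervalIntegrable
  set v : ℝ → ℂ := fun x => ∫ t in b..x, v' t with hv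
  have hvp : IsPrimitive v v' :=
    ⟨hv'i, fun x y => (intervalIntegral.integral_interval_sub_left (hv'i _ _) (hv'i _ _)).symm⟩
  have hvb : v b = 0 := by simp [hv]
  have hvb1 : v (b + 1) = 0 := by
    simp only [hv, hv']
    rw [intervalIntegral.integral_sub (hh0L.intervalIntegrable _ _) (by simp)]
    simp [hμ]
  have hvper : Function.Periodic v 1 := by
    intro x
    have h1 := hv'L.periodic.intervalIntegral_add_eq x b
    have h2 := hvp.integral_eq x (x + 1)
    have h3 := hvp.integral_eq b (b + 1)
    rw [h1, h3, hvb, hvb1] at h2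
    linear_combination -h2
  have hvH : HasH1PerDeriv v v' := ⟨hvper, hv'L, hvp.integral_eq⟩
  have weak := hw v v' hvH
  have hgv : IntervalIntegrable (fun x => g x * conj (v' x)) volume 0 1 := by
    rw [intervalIntegrable_iff_integrableOn_Ioc_of_le zero_le_one]
    exact hug.memL2.memLp.integrable_mul hv'L.memLp.star
  have hgvper : Function.Periodic (fun x => g x * conj (v' x)) 1 := fun x => by
    simp only [hug.memL2.periodic x, hv'L.periodic x]
  have hgv' := fun x y => hgvper.intervalIntegrable₀ one_ne_zero hgv x y
  have hcv := hvp.complexConj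
  have hcvi := hcv.integrable
  rw [integral_zero_one_eq hgvper b,
    integral_zero_one_eq (f := fun x => u x * conj (v x))
      (fun x => by simp only [hug.periodic x, hvper x]) b] at weak
  have hUv : ∫ x in b..(b + 1), u x * conj (v x) = - ∫ x in b..(b + 1), U x * conj (v' x) := by
    have := hcv.integral_mul hUp b (b + 1)
    simp only [hvb, hvb1, map_zero, zero_mul, sub_zero, zero_sub] at this
    simp_rw [mul_comm (u _), mul_comm (U _)]
    exact this
  have hjump : ∀ i, conj (v (pos i))
      = - ∫ x in b..(b + 1), (if pos' i < x then 1 else 0 : ℂ) * conj (v' x) := by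
    intro i
    rw [(integral_indicator_Ioi hcvi (hpos' i).1).2, max_eq_left (hpos' i).2, hcv.integral_eq,
      hvb1, periodic_eq_of_int hvper (hk i)]
    simp
  have hGv : ∫ x in b..(b + 1), G (τ x) * conj (v' x)
      = E * (∫ x in b..(b + 1), U x * conj (v' x))
        + ∑ i, (Z i : ℂ) * u (pos i) *
          ∫ x in b..(b + 1), (if pos' i < x then 1 else 0 : ℂ) * conj (v' x) := by
    have i1 : IntervalIntegrable (fun x => U x * conj (v' x)) volume b (b + 1) :=
      (hcvi _ _).continuousOn_mul hUc.continuousOn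
    have i2 := fun i => (integral_indicator_Ioi hcvi (x := b + 1) (hpos' i).1).1
    rw [← intervalIntegral.integral_const_mul]
    simp_rw [← intervalIntegral.integral_const_mul]
    rw [← intervalIntegral.integral_finsetSum (fun i _ => (i2 i).const_mul _),
      ← intervalIntegral.integral_add (i1.const_mul _)
        (intervalIntegrable_fun_sum fun i _ => (i2 i).const_mul _)]
    apply intervalIntegral.integral_congr_ae
    have hne : ∀ᵐ x : ℝ, x ≠ b + 1 := by simp [ae_iff, measure_singleton]
    filter_upwards [hne] with x hx hxm
    rw [Set.uIoc_of_le (by linarith)] at hxm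
    rw [hτe x ⟨hxm.1.le, lt_of_le_of_ne hxm.2 hx⟩]
    simp only [hG]
    rw [add_mul, Finset.sum_mul]
    simp only [mul_assoc]
  have iGv : IntervalIntegrable (fun x => G (τ x) * conj (v' x)) volume b (b + 1) := by
    have : Function.Periodic (fun x => G (τ x) * conj (v' x)) 1 := fun x => by
      simp only [hτp x, hv'L.periodic x]
    refine this.intervalIntegrable₀ one_ne_zero ?_ _ _
    rw [intervalIntegrable_iff_integrableOn_Ioc_of_le zero_le_one]
    exact hGL.memLp.integrable_mul hv'L.memLp.star
  have hzero : ∫ x in b..(b + 1), v' x * conj (v' x) = 0 := by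
    have e : ∀ x, v' x * conj (v' x)
        = (g x * conj (v' x) + G (τ x) * conj (v' x)) - μ * conj (v' x) := by
      intro x; simp only [hv', hh0]; ring
    simp_rw [e]
    rw [intervalIntegral.integral_sub ((hgv' _ _).add iGv) ((hcvi _ _).const_mul _),
      intervalIntegral.integral_add (hgv' _ _) iGv, intervalIntegral.integral_const_mul,
      hcv.integral_eq, hvb, hvb1, hGv]
    rw [hUv] at weak
    simp_rw [hjump] at weak
    simp only [map_zero, sub_zero, mul_zero]
    rw [sub_eq_iff_eq_add] at weak
    rw [weak]
    simp only [mul_neg, Finset.sum_neg_distrib, mul_assoc]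
    ring
  have hv0 : ∀ᵐ x ∂(volume.restrict (Set.Ioc b (b + 1))), v' x = 0 := by
    have e : ∀ x, v' x * conj (v' x) = ((‖v' x‖ ^ 2 : ℝ) : ℂ) := by
      intro x
      rw [Complex.mul_conj, Complex.normSq_eq_norm_sq]
    have hi : IntervalIntegrable (fun x => ‖v' x‖ ^ 2) volume b (b + 1) := by
      have : Function.Periodic (fun x => ‖v' x‖ ^ 2) 1 := fun x => by
        simp only [hv'L.periodic x]
      refine this.intervalIntegrable₀ one_ne_zero ?_ _ _
      rw [intervalIntegrable_iff_integrableOn_Ioc_of_le zero_le_one]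
      exact hv'L.memLp.integrable_norm_pow (by norm_num)
    simp_rw [e] at hzero
    rw [intervalIntegral.integral_ofReal, Complex.ofReal_eq_zero,
      intervalIntegral.integral_of_le (by linarith),
      integral_eq_zero_iff_of_nonneg (fun x => by positivity) hi.1] at hzero
    filter_upwards [hzero] with x hx
    simpa using hx
  have hvz : ∀ x ∈ Set.Icc b (b + 1), v x = 0 := by
    intro x hx
    simp only [hv]
    rw [intervalIntegral.integral_of_le hx.1]
    apply integral_eq_zero_of_ae
    exact ae_restrict_of_ae_restrict_of_subset (Set.Ioc_subset_Ioc_right hx.2) hv0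
  refine ⟨μ, fun x hx => ?_⟩
  have hvx := hvz x hx
  have i2 := fun i => integral_indicator_Ioi (f := fun _ => (1 : ℂ)) (x := x)
    (fun x y => continuous_const.intervalIntegrable x y) (hpos' i).1
  simp only [mul_one] at i2
  have hsplit : v x = (u x - u b) - (∫ t in b..x, (μ - E * U t))
      + ∑ i, (Z i : ℂ) * u (pos i) * (max (x - pos' i) 0 : ℝ) := by
    have e1 : ∀ i, ((max (x - pos' i) 0 : ℝ) : ℂ)
        = ∫ t in b..x, (if pos' i < t then 1 else 0 : ℂ) := by
      intro i
      rw [(i2 i).2]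
      simp only [intervalIntegral.integral_const, Complex.real_smul, mul_one]
      rw [← max_sub_sub_right, sub_self]
    have i3 : IntervalIntegrable (fun t => μ - E * U t) volume b x :=
      (continuous_const.sub (continuous_const.mul hUc)).intervalIntegrable _ _
    simp_rw [e1, ← intervalIntegral.integral_const_mul]
    rw [← intervalIntegral.integral_finsetSum (fun i _ => ((i2 i).1).const_mul _),
      ← hu.integral_eq, ← intervalIntegral.integral_sub (hu.integrable _ _) i3,
      ← intervalIntegral.integral_add ((hu.integrable _ _).sub i3)
        (intervalIntegrable_fun_sum fun i _ => (i2 i).1.const_mul _)]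
    simp only [hv]
    apply intervalIntegral.integral_congr_ae
    have hne : ∀ᵐ x : ℝ, x ≠ b + 1 := by simp [ae_iff, measure_singleton]
    filter_upwards [hne] with t ht htm
    rw [Set.uIoc_of_le hx.1] at htm
    simp only [hv', hh0]
    rw [hτe t ⟨htm.1.le, lt_of_le_of_ne (htm.2.trans hx.2) ht⟩]
    simp only [hG]
    ring
  rw [hvx] at hsplit
  linear_combination -hsplit

/-- Local form of the eigenvalue equation around the atom `i₀`, when all the other atoms sit on the
boundary of the period cell `[b, b + 1]`. -/
theorem IsDiracEigenfunction.exists_local {n : ℕ} {Z pos : Fin n → ℝ} {E : ℝ} {u : ℝ → ℂ}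
    (h : IsDiracEigenfunction Z pos E u) {b : ℝ} (i₀ : Fin n)
    (hi₀ : pos i₀ ∈ Set.Icc b (b + 1)) (hk : ∀ i, i ≠ i₀ → ∃ k : ℤ, b = pos i + k) :
    ∃ g : ℝ → ℂ, (∀ x, HasDerivAt g (-E * u x) x) ∧ ∀ x ∈ Set.Icc b (b + 1),
      u x = u (pos i₀) + (∫ t in (pos i₀)..x, g t)
        - (Z i₀ : ℂ) * u (pos i₀) * (max (x - pos i₀) 0 : ℝ) := by
  have huc : Continuous u := by
    obtain ⟨-, g, hug, -⟩ := h
    exact hug.isPrimitive.continuous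
  obtain ⟨κ, hκ⟩ := h.exists_integral_eq (b := b)
    (pos' := fun i => if i = i₀ then pos i₀ else b)
    (fun i => by
      by_cases hi : i = i₀
      · simpa [hi] using hi₀
      · simp [hi])
    (fun i => by
      by_cases hi : i = i₀
      · exact ⟨0, by simp [hi]⟩
      · simpa [hi] using hk i hi)
  set c := pos i₀ with hc
  set σ : ℂ := ∑ i ∈ Finset.univ.erase i₀, (Z i : ℂ) * u (pos i) with hσ
  set g : ℝ → ℂ := fun t => κ - σ - E * ∫ y in b..t, u y with hg
  have hgd : ∀ x, HasDerivAt g (-E * u x) x := by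
    intro x
    have := (intervalIntegral.integral_hasDerivAt_right (huc.intervalIntegrable b x)
      (huc.stronglyMeasurableAtFilter _ _) huc.continuousAt).const_mul (E : ℂ)
    simpa [hg] using this.const_sub (κ - σ)
  have hgc : Continuous g := continuous_iff_continuousAt.2 fun x => (hgd x).continuousAt
  have hgi := fun x y => hgc.intervalIntegrable (μ := volume) x y
  have key : ∀ x ∈ Set.Icc b (b + 1),
      u x = u b + (∫ t in b..x, g t) - (Z i₀ : ℂ) * u c * (max (x - c) 0 : ℝ) := by
    intro x hx
    rw [hκ x hx, ← Finset.add_sum_erase _ _ (Finset.mem_univ i₀)]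
    have e1 : ∑ i ∈ Finset.univ.erase i₀, (Z i : ℂ) * u (pos i) *
        ((max (x - (if i = i₀ then c else b)) 0 : ℝ) : ℂ) = σ * (x - b) := by
      rw [hσ, Finset.sum_mul]
      refine Finset.sum_congr rfl fun i hi => ?_
      rw [if_neg (Finset.ne_of_mem_erase hi), max_eq_left (by linarith [hx.1])]
      push_cast; ring
    have hUc : Continuous fun t => ∫ y in b..t, u y :=
      intervalIntegral.continuous_primitive (fun x y => huc.intervalIntegrable x y) b
    have e2 : ∫ t in b..x, g t = (∫ t in b..x, (κ - E * ∫ y in b..t, u y)) - σ * (x - b) := by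
      have : ∀ t, g t = (κ - E * ∫ y in b..t, u y) - σ := by intro t; simp only [hg]; ring
      have i3 : IntervalIntegrable (fun t => κ - E * ∫ y in b..t, u y) volume b x :=
        (continuous_const.sub (continuous_const.mul hUc)).intervalIntegrable _ _
      simp_rw [this]
      rw [intervalIntegral.integral_sub i3 (by simp)]
      simp [mul_comm]
    rw [e1, e2, if_pos rfl]
    ring
  refine ⟨g, hgd, fun x hx => ?_⟩
  have h1 := key x hx
  have h2 := key c hi₀
  rw [← intervalIntegral.integral_add_adjacent_intervals (hgi b c) (hgi c x)] at h1
  rw [h1]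
  simp only [sub_self, max_self, Complex.ofReal_zero, mul_zero, sub_zero] at h2
  linear_combination -h2


/-! ### Fundamental solutions of `w'' = -ε w` -/

theorem exists_fundamental_solutions (ε : ℝ) :
    ∃ f : (ℝ → ℝ) × (ℝ → ℝ), f.1 0 = 1 ∧ f.2 0 = 0 ∧ (∀ x, HasDerivAt f.1 (-ε * f.2 x) x) ∧
      ∀ x, HasDerivAt f.2 (f.1 x) x := by
  rcases lt_trichotomy ε 0 with h | h | h
  · set w := √(-ε) with hw
    have hw0 : w ≠ 0 := (Real.sqrt_pos.2 (by linarith)).ne'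
    have hw2 : w * w = -ε := Real.mul_self_sqrt (by linarith)
    have hd : ∀ x : ℝ, HasDerivAt (fun y => w * y) w x := fun x => by
      simpa using (hasDerivAt_id x).const_mul w
    refine ⟨⟨fun x => Real.cosh (w * x), fun x => Real.sinh (w * x) / w⟩, by simp, by simp,
      fun x => ?_, fun x => ?_⟩
    · refine ((hd x).cosh).congr_deriv ?_
      rw [← hw2]; field_simp
    · refine ((hd x).sinh.div_const w).congr_deriv ?_
      field_simp
  · refine ⟨⟨fun _ => 1, fun x => x⟩, rfl, rfl, fun x => ?_, fun x => hasDerivAt_id x⟩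
    simpa [h] using hasDerivAt_const x (1 : ℝ)
  · set w := √ε with hw
    have hw0 : w ≠ 0 := (Real.sqrt_pos.2 h).ne'
    have hw2 : w * w = ε := Real.mul_self_sqrt h.le
    have hd : ∀ x : ℝ, HasDerivAt (fun y => w * y) w x := fun x => by
      simpa using (hasDerivAt_id x).const_mul w
    refine ⟨⟨fun x => Real.cos (w * x), fun x => Real.sin (w * x) / w⟩, by simp, by simp,
      fun x => ?_, fun x => ?_⟩
    · refine ((hd x).cos).congr_deriv ?_
      rw [← hw2]; field_simp
    · refine ((hd x).sin.div_const w).congr_deriv ?_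
      field_simp

/-- The solution of `w'' = -ε w` with `w(0) = 1`, `w'(0) = 0`. -/
def cosSol (ε : ℝ) : ℝ → ℝ := (exists_fundamental_solutions ε).choose.1

/-- The solution of `w'' = -ε w` with `w(0) = 0`, `w'(0) = 1`. -/
def sinSol (ε : ℝ) : ℝ → ℝ := (exists_fundamental_solutions ε).choose.2

theorem cosSol_zero (ε : ℝ) : cosSol ε 0 = 1 := (exists_fundamental_solutions ε).choose_spec.1

theorem sinSol_zero (ε : ℝ) : sinSol ε 0 = 0 := (exists_fundamental_solutions ε).choose_spec.2.1

theorem hasDerivAt_cosSol (ε x : ℝ) : HasDerivAt (cosSol ε) (-ε * sinSol ε x) x :=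
  (exists_fundamental_solutions ε).choose_spec.2.2.1 x

theorem hasDerivAt_sinSol (ε x : ℝ) : HasDerivAt (sinSol ε) (cosSol ε x) x :=
  (exists_fundamental_solutions ε).choose_spec.2.2.2 x

theorem contDiff_cosSol_sinSol (ε : ℝ) :
    ContDiff ℝ (⊤ : ℕ∞) (cosSol ε) ∧ ContDiff ℝ (⊤ : ℕ∞) (sinSol ε) := by
  have hc : deriv (cosSol ε) = fun x => -ε * sinSol ε x := funext fun x => (hasDerivAt_cosSol ε x).deriv
  have hs : deriv (sinSol ε) = cosSol ε := funext fun x => (hasDerivAt_sinSol ε x).deriv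
  have dc : Differentiable ℝ (cosSol ε) := fun x => (hasDerivAt_cosSol ε x).differentiableAt
  have ds : Differentiable ℝ (sinSol ε) := fun x => (hasDerivAt_sinSol ε x).differentiableAt
  have key : ∀ n : ℕ, ContDiff ℝ n (cosSol ε) ∧ ContDiff ℝ n (sinSol ε) := by
    intro n
    induction n with
    | zero => exact ⟨contDiff_zero.2 dc.continuous, contDiff_zero.2 ds.continuous⟩
    | succ n ih =>
      push_cast
      rw [contDiff_succ_iff_deriv, contDiff_succ_iff_deriv, hc, hs]
      exact ⟨⟨dc, by simp, contDiff_const.mul ih.2⟩, ⟨ds, by simp, ih.1⟩⟩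
  exact ⟨contDiff_infty.2 fun n => (key n).1, contDiff_infty.2 fun n => (key n).2⟩

theorem eq_of_hasDerivAt_zero {w : ℝ → ℂ} {w' : ℝ → ℂ} {s : Set ℝ} (hs : Convex ℝ s)
    (h : ∀ x ∈ s, HasDerivAt w (w' x) x) (h0 : ∀ x ∈ s, w' x = 0) {x y : ℝ} (hx : x ∈ s)
    (hy : y ∈ s) : w y = w x := by
  have := hs.norm_image_sub_le_of_norm_hasDerivWithin_le (C := 0)
    (fun x hx => (h x hx).hasDerivWithinAt) (fun x hx => by rw [h0 x hx]; simp) hx hy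
  rw [zero_mul] at this
  exact sub_eq_zero.1 (norm_le_zero_iff.1 this)

theorem cosSol_sq_add (ε x : ℝ) : cosSol ε x ^ 2 + ε * sinSol ε x ^ 2 = 1 := by
  have h : ∀ x, HasDerivAt (fun x => cosSol ε x ^ 2 + ε * sinSol ε x ^ 2) 0 x := fun x => by
    refine (((hasDerivAt_cosSol ε x).pow 2).add
      (((hasDerivAt_sinSol ε x).pow 2).const_mul ε)).congr_deriv ?_
    simp; ring
  have := is_const_of_deriv_eq_zero (fun x => (h x).differentiableAt) (fun x => (h x).deriv) x 0
  simpa [cosSol_zero, sinSol_zero] using this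

/-- Solutions of `w'' = -ε w` are linear combinations of the fundamental solutions. -/
theorem eq_fundamental {ε : ℝ} {w w₁ w₂ : ℝ → ℂ} {s : Set ℝ} (hs : Convex ℝ s) (h0 : 0 ∈ s)
    (h1 : ∀ x ∈ s, HasDerivAt w (w₁ x) x) (h2 : ∀ x ∈ s, HasDerivAt w₁ (w₂ x) x)
    (h : ∀ x ∈ s, w₂ x = -ε * w x) {x : ℝ} (hx : x ∈ s) :
    w x = w 0 * cosSol ε x + w₁ 0 * sinSol ε x ∧
      w₁ x = -ε * (w 0 * sinSol ε x) + w₁ 0 * cosSol ε x := by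
  have hc := fun x => (hasDerivAt_cosSol ε x).ofReal_comp
  have hS := fun x => (hasDerivAt_sinSol ε x).ofReal_comp
  have a1 := eq_of_hasDerivAt_zero (w := fun x => -ε * (w x * sinSol ε x) - w₁ x * cosSol ε x) hs
    (fun x hx => (((h1 x hx).mul (hS x)).const_mul (-ε : ℂ)).sub ((h2 x hx).mul (hc x)))
    (fun x hx => by rw [h x hx]; push_cast; ring) h0 hx
  have a2 := eq_of_hasDerivAt_zero (w := fun x => w x * cosSol ε x - w₁ x * sinSol ε x) hs
    (fun x hx => ((h1 x hx).mul (hc x)).sub ((h2 x hx).mul (hS x)))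
    (fun x hx => by rw [h x hx]; push_cast; ring) h0 hx
  simp only [cosSol_zero, sinSol_zero, Complex.ofReal_one, Complex.ofReal_zero, mul_zero, mul_one,
    zero_sub, sub_zero] at a1 a2
  have e : (cosSol ε x : ℂ) ^ 2 + ε * (sinSol ε x : ℂ) ^ 2 = 1 := by
    exact_mod_cast cosSol_sq_add ε x
  constructor
  · linear_combination (cosSol ε x : ℂ) * a2 - (sinSol ε x : ℂ) * a1 - w x * e
  · linear_combination -(cosSol ε x : ℂ) * a1 - ε * (sinSol ε x : ℂ) * a2 - w₁ x * e

/-- The solution of `w'' = -ε w` with `w(0) = 1`, `w'(0) = -Z/2`. -/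
def cuspSol (Z ε x : ℝ) : ℝ := cosSol ε x - Z / 2 * sinSol ε x

theorem contDiff_cuspSol (Z ε : ℝ) : ContDiff ℝ (⊤ : ℕ∞) (cuspSol Z ε) :=
  (contDiff_cosSol_sinSol ε).1.sub (contDiff_const.mul (contDiff_cosSol_sinSol ε).2)

theorem cuspSol_zero (Z ε : ℝ) : cuspSol Z ε 0 = 1 := by simp [cuspSol, cosSol_zero, sinSol_zero]

theorem hasDerivAt_cuspSol (Z ε x : ℝ) :
    HasDerivAt (cuspSol Z ε) (-ε * sinSol ε x - Z / 2 * cosSol ε x) x :=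
  (hasDerivAt_cosSol ε x).sub ((hasDerivAt_sinSol ε x).const_mul _)

theorem deriv_deriv_cuspSol (Z ε : ℝ) :
    deriv (deriv (cuspSol Z ε)) = fun x => -ε * cuspSol Z ε x := by
  have e : deriv (cuspSol Z ε) = fun x => -ε * sinSol ε x - Z / 2 * cosSol ε x :=
    funext fun x => (hasDerivAt_cuspSol Z ε x).deriv
  rw [e]
  ext x
  refine (((hasDerivAt_sinSol ε x).const_mul (-ε)).sub
    ((hasDerivAt_cosSol ε x).const_mul (Z / 2))).deriv.trans ?_
  simp only [cuspSol]; ring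

/-! ### Eigenfunctions around an atom -/

theorem IsDiracEigenfunction.continuous {n : ℕ} {Z pos : Fin n → ℝ} {E : ℝ} {u : ℝ → ℂ}
    (h : IsDiracEigenfunction Z pos E u) : Continuous u := by
  obtain ⟨-, g, hug, -⟩ := h
  exact hug.isPrimitive.continuous

theorem IsDiracEigenfunction.periodic {n : ℕ} {Z pos : Fin n → ℝ} {E : ℝ} {u : ℝ → ℂ}
    (h : IsDiracEigenfunction Z pos E u) : Function.Periodic u 1 := by
  obtain ⟨-, g, hug, -⟩ := h
  exact hug.periodic

theorem IsDiracEigenfunction.even_odd {n : ℕ} {Z pos : Fin n → ℝ} {E : ℝ} {u : ℝ → ℂ}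
    (h : IsDiracEigenfunction Z pos E u) {b r : ℝ} (i₀ : Fin n) (hr : 0 ≤ r)
    (hb : b ≤ pos i₀ - r) (hb' : pos i₀ + r ≤ b + 1)
    (hk : ∀ i, i ≠ i₀ → ∃ k : ℤ, b = pos i + k) :
    (∀ s ∈ Set.Icc 0 r, u (pos i₀ + s) + u (pos i₀ - s) = 2 * u (pos i₀) * cuspSol (Z i₀) E s) ∧
    ∃ g : ℝ → ℂ, (∀ x, HasDerivAt g (-E * u x) x) ∧
      g (pos i₀ + r) - g (pos i₀ - r) - Z i₀ * u (pos i₀) =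
        -E * (2 * u (pos i₀) * sinSol E r) - Z i₀ * u (pos i₀) * cosSol E r ∧
      ∃ B : ℂ, ∀ s ∈ Set.Icc 0 r, u (pos i₀ + s) - u (pos i₀ - s) = B * sinSol E s := by
  obtain ⟨g, hg, hu⟩ := h.exists_local i₀ (b := b) ⟨by linarith, by linarith⟩ hk
  set c := pos i₀ with hc
  have hgc : Continuous g := continuous_iff_continuousAt.2 fun x => (hg x).continuousAt
  set P : ℝ → ℂ := fun x => ∫ t in c..x, g t with hP
  have hPd : ∀ x, HasDerivAt P (g x) x := fun x =>
    intervalIntegral.integral_hasDerivAt_right (hgc.intervalIntegrable _ _)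
      (hgc.stronglyMeasurableAtFilter _ _) hgc.continuousAt
  have hP0 : P c = 0 := by simp [hP]
  have hplus : ∀ s ∈ Set.Icc 0 r, u (c + s) = u c + P (c + s) - Z i₀ * u c * s := by
    intro s hs
    rw [hu (c + s) ⟨by linarith [hs.1], by linarith [hs.2]⟩, add_sub_cancel_left,
      max_eq_left hs.1]
  have hminus : ∀ s ∈ Set.Icc 0 r, u (c - s) = u c + P (c - s) := by
    intro s hs
    rw [hu (c - s) ⟨by linarith [hs.2], by linarith [hs.1]⟩, max_eq_right (by linarith [hs.1])]
    simp [hP]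
  have dp : ∀ {f f' : ℝ → ℂ}, (∀ x, HasDerivAt f (f' x) x) → ∀ s : ℝ,
      HasDerivAt (fun s => f (c + s)) (f' (c + s)) s := fun hf s => by
    simpa using (hf (c + s)).comp_const_add c s
  have dm : ∀ {f f' : ℝ → ℂ}, (∀ x, HasDerivAt f (f' x) x) → ∀ s : ℝ,
      HasDerivAt (fun s => f (c - s)) (-f' (c - s)) s := fun hf s => by
    simpa using (hf (c - s)).comp_const_sub c s
  have dl : ∀ (z : ℂ) (s : ℝ), HasDerivAt (fun s : ℝ => z * s) z s := fun z s => by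
    simpa using (Complex.ofRealCLM.hasDerivAt (x := s)).const_mul z
  have h0r : (0 : ℝ) ∈ Set.Icc 0 r := ⟨le_rfl, hr⟩
  have hev := fun s (hs : s ∈ Set.Icc 0 r) => eq_fundamental (ε := E)
    (w := fun s : ℝ => 2 * u c + (P (c + s) + P (c - s)) - Z i₀ * u c * s)
    (w₁ := fun s => g (c + s) + -g (c - s) - Z i₀ * u c)
    (w₂ := fun s => -E * u (c + s) + - -(-E * u (c - s))) (convex_Icc 0 r) h0r
    (fun s _ => (((dp hPd s).add (dm hPd s)).const_add _).sub (dl _ s))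
    (fun s _ => ((dp hg s).add (dm hg s).neg).sub_const _)
    (fun s hs => by rw [hplus s hs, hminus s hs]; ring) hs
  have hod := fun s (hs : s ∈ Set.Icc 0 r) => eq_fundamental (ε := E)
    (w := fun s : ℝ => (P (c + s) - P (c - s)) - Z i₀ * u c * s)
    (w₁ := fun s => g (c + s) - -g (c - s) - Z i₀ * u c)
    (w₂ := fun s => -E * u (c + s) - - - (-E * u (c - s))) (convex_Icc 0 r) h0r
    (fun s _ => ((dp hPd s).sub (dm hPd s)).sub (dl _ s))
    (fun s _ => ((dp hg s).sub (dm hg s).neg).sub_const _)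
    (fun s hs => by rw [hplus s hs, hminus s hs]; ring) hs
  simp only [add_zero, sub_zero, hP0, Complex.ofReal_zero, mul_zero, sub_self, zero_mul,
    zero_add] at hev hod
  refine ⟨fun s hs => ?_, g, hg, ?_, g c - -g c - Z i₀ * u c, fun s hs => ?_⟩
  · rw [hplus s hs, hminus s hs]
    have := (hev s hs).1
    simp only [cuspSol]
    push_cast
    linear_combination this
  · have := (hev r ⟨hr, le_rfl⟩).2
    linear_combination this
  · rw [hplus s hs, hminus s hs]
    have := (hod s hs).1
    linear_combination this

theorem IsDiracEigenfunction.sum_integral {n : ℕ} {Z pos : Fin n → ℝ} {E : ℝ} {u : ℝ → ℂ}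
    (h : IsDiracEigenfunction Z pos E u) :
    -(∑ i, (Z i : ℂ) * u (pos i)) = E * ∫ x in (0 : ℝ)..1, u x := by
  obtain ⟨-, g, hug, hw⟩ := h
  simpa using hw _ _ (hasH1PerDeriv_const 1)

theorem cuspSol_one_sub {Z ε : ℝ} (h : -ε * sinSol ε (1 / 2) - Z / 2 * cosSol ε (1 / 2) = 0)
    (s : ℝ) : cuspSol Z ε (1 - s) = cuspSol Z ε s := by
  have hd := fun x => (hasDerivAt_cuspSol Z ε x).ofReal_comp
  have hd2 : ∀ x, HasDerivAt (fun x : ℝ => ((-ε * sinSol ε x - Z / 2 * cosSol ε x : ℝ) : ℂ))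
      ((-ε * cuspSol Z ε x : ℝ) : ℂ) x := fun x =>
    ((((hasDerivAt_sinSol ε x).const_mul (-ε)).sub
      ((hasDerivAt_cosSol ε x).const_mul (Z / 2))).congr_deriv
      (by simp only [cuspSol]; ring)).ofReal_comp
  have key := (eq_fundamental (ε := ε)
    (w := fun t : ℝ => (cuspSol Z ε (1 / 2 + t) : ℂ) - cuspSol Z ε (1 / 2 - t))
    (w₁ := fun t : ℝ => ((-ε * sinSol ε (1 / 2 + t) - Z / 2 * cosSol ε (1 / 2 + t) : ℝ) : ℂ)
      - -((-ε * sinSol ε (1 / 2 - t) - Z / 2 * cosSol ε (1 / 2 - t) : ℝ) : ℂ))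
    (w₂ := fun t : ℝ => ((-ε * cuspSol Z ε (1 / 2 + t) : ℝ) : ℂ)
      - - -((-ε * cuspSol Z ε (1 / 2 - t) : ℝ) : ℂ))
    convex_univ (Set.mem_univ 0)
    (fun t _ => ((hd (1 / 2 + t)).comp_const_add _ t).sub ((hd (1 / 2 - t)).comp_const_sub _ t))
    (fun t _ => ((hd2 (1 / 2 + t)).comp_const_add _ t).sub
      ((hd2 (1 / 2 - t)).comp_const_sub _ t).neg)
    (fun t _ => by push_cast; ring) (Set.mem_univ (s - 1 / 2))).1
  simp only [add_zero, sub_zero, h, sub_self, zero_mul, Complex.ofReal_zero,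
    neg_zero] at key
  rw [show (1 / 2 + (s - 1 / 2) : ℝ) = s by ring,
    show (1 / 2 - (s - 1 / 2) : ℝ) = 1 - s by ring, sub_eq_zero] at key
  exact_mod_cast key.symm

theorem sinSol_neg (ε x : ℝ) : sinSol ε (-x) = -sinSol ε x := by
  have hd := fun x => (hasDerivAt_sinSol ε x).ofReal_comp
  have hd2 := fun x => (hasDerivAt_cosSol ε x).ofReal_comp
  have key := (eq_fundamental (ε := ε) (w := fun t : ℝ => (sinSol ε (0 - t) : ℂ))
    (w₁ := fun t : ℝ => -(cosSol ε (0 - t) : ℂ))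
    (w₂ := fun t : ℝ => - -((-ε * sinSol ε (0 - t) : ℝ) : ℂ)) convex_univ (Set.mem_univ 0)
    (fun t _ => (hd (0 - t)).comp_const_sub _ t)
    (fun t _ => ((hd2 (0 - t)).comp_const_sub _ t).neg)
    (fun t _ => by push_cast; ring) (Set.mem_univ x)).1
  simp only [zero_sub, neg_zero, sinSol_zero, cosSol_zero, Complex.ofReal_zero, zero_mul,
    zero_add, Complex.ofReal_one, neg_mul, one_mul] at key
  exact_mod_cast key

theorem sinSol_periodic {ε : ℝ} (h : sinSol ε (1 / 2) = 0) : Function.Periodic (sinSol ε) 1 := by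
  have hd := fun x => (hasDerivAt_sinSol ε x).ofReal_comp
  have hd2 := fun x => (hasDerivAt_cosSol ε x).ofReal_comp
  have key : ∀ x, sinSol ε (1 / 2 + x) = cosSol ε (1 / 2) * sinSol ε x := by
    intro x
    have key := (eq_fundamental (ε := ε) (w := fun t : ℝ => (sinSol ε (1 / 2 + t) : ℂ))
      (w₁ := fun t : ℝ => (cosSol ε (1 / 2 + t) : ℂ))
      (w₂ := fun t : ℝ => ((-ε * sinSol ε (1 / 2 + t) : ℝ) : ℂ)) convex_univ (Set.mem_univ 0)
      (fun t _ => (hd (1 / 2 + t)).comp_const_add _ t)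
      (fun t _ => (hd2 (1 / 2 + t)).comp_const_add _ t)
      (fun t _ => by push_cast; ring) (Set.mem_univ x)).1
    simp only [add_zero, h, Complex.ofReal_zero, zero_mul, zero_add] at key
    exact_mod_cast key
  intro x
  rw [show x + 1 = 1 / 2 + (1 / 2 + x) by ring, key, key, ← mul_assoc]
  have := cosSol_sq_add ε (1 / 2)
  rw [h] at this
  rw [← sq, show cosSol ε (1 / 2) ^ 2 = 1 by linarith, one_mul]

/-- A non-smooth real eigenfunction of the one-atom operator does not vanish at the atom, is even
around the atom, and is the cusp solution on a period cell starting at the atom. -/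
theorem nonsmooth_eigenfunction {Z c ε : ℝ} (hZ : 0 < Z) {φ : ℝ → ℝ}
    (h : IsDiracEigenfunction ![Z] ![c] ε (fun x => (φ x : ℂ)))
    (hns : ¬ ContDiff ℝ (⊤ : ℕ∞) φ) :
    φ c ≠ 0 ∧ (∀ s ∈ Set.Icc (0 : ℝ) (1 / 2), φ (c - s) = φ (c + s)) ∧
      (∀ s ∈ Set.Icc (0 : ℝ) 1, φ (c + s) = φ c * cuspSol Z ε s) ∧
      ∀ s, cuspSol Z ε (1 - s) = cuspSol Z ε s := by
  have hper := h.periodic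
  have hφper : Function.Periodic φ 1 := fun x => Complex.ofReal_injective (hper x)
  obtain ⟨hev, g, hg, hgr, B, hB⟩ := h.even_odd (b := c - 1 / 2) (r := 1 / 2) 0 (by norm_num)
    (by simp) (by simp; linarith) (fun i hi => absurd (Subsingleton.elim i 0) hi)
  simp only [Matrix.cons_val_zero] at hev hg hgr hB
  have hgd : g (c + 1 / 2) - g (c - 1 / 2) - Z * φ c = 0 := by
    have hc : Continuous fun x => -(ε : ℂ) * (φ x : ℂ) := continuous_const.mul h.continuous
    have h1 := intervalIntegral.integral_eq_sub_of_hasDerivAt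
      (a := c - 1 / 2) (b := c - 1 / 2 + 1) (fun x _ => hg x) (hc.intervalIntegrable _ _)
    have h2 := h.sum_integral
    rw [integral_zero_one_eq hper (c - 1 / 2)] at h2
    rw [intervalIntegral.integral_const_mul, show c - 1 / 2 + 1 = c + 1 / 2 by ring] at h1
    rw [show c - 1 / 2 + 1 = c + 1 / 2 by ring] at h2
    simp only [Finset.univ_unique, Fin.default_eq_zero, Finset.sum_singleton,
      Matrix.cons_val_zero] at h2
    linear_combination -h1 + h2
  rw [hgd] at hgr
  have hgr' : φ c * (-ε * sinSol ε (1 / 2) - Z / 2 * cosSol ε (1 / 2)) = 0 := by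
    have : (0 : ℝ) = -ε * (2 * φ c * sinSol ε (1 / 2)) - Z * φ c * cosSol ε (1 / 2) := by
      exact_mod_cast hgr
    linarith
  have hodd : B * sinSol ε (1 / 2) = 0 := by
    rw [← hB (1 / 2) ⟨by norm_num, le_rfl⟩, sub_eq_zero]
    have := hper (c - 1 / 2)
    rw [show c - 1 / 2 + 1 = c + 1 / 2 by ring] at this
    exact this
  have hcs := cosSol_sq_add ε (1 / 2)
  have hS : sinSol ε (1 / 2) ≠ 0 := by
    intro hS
    have hc0 : φ c = 0 := by
      rcases mul_eq_zero.1 hgr' with h1 | h1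
      · exact h1
      · rw [hS, mul_zero, zero_sub, neg_eq_zero, mul_eq_zero] at h1
        rcases h1 with h1 | h1
        · linarith
        · rw [hS, h1] at hcs; norm_num at hcs
    apply hns
    have hloc : ∀ s ∈ Set.Icc (-(1 / 2) : ℝ) (1 / 2), φ (c + s) = B.re / 2 * sinSol ε s := by
      have h1 : ∀ s ∈ Set.Icc (0 : ℝ) (1 / 2), φ (c + s) + φ (c - s) = 0 := fun s hs => by
        have := hev s hs
        rw [hc0] at this
        simp only [Complex.ofReal_zero, mul_zero, zero_mul] at this
        exact_mod_cast this
      have h2 : ∀ s ∈ Set.Icc (0 : ℝ) (1 / 2), φ (c + s) - φ (c - s) = B.re * sinSol ε s :=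
        fun s hs => by
        have := congrArg Complex.re (hB s hs)
        simpa using this
      intro s hs
      rcases le_total 0 s with h0 | h0
      · linarith [h1 s ⟨h0, hs.2⟩, h2 s ⟨h0, hs.2⟩]
      · have h3 := h1 (-s) ⟨by linarith, by linarith [hs.1]⟩
        have h4 := h2 (-s) ⟨by linarith, by linarith [hs.1]⟩
        rw [sinSol_neg] at h4
        simp only [sub_neg_eq_add] at h3 h4
        linarith
    have hglob : φ = fun x => B.re / 2 * sinSol ε (x - c) := by
      ext x
      have h1 := hφper.sub_int_mul_eq (x := x) (round (x - c))
      have h2 := (sinSol_periodic hS).sub_int_mul_eq (x := x - c) (round (x - c))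
      rw [mul_one] at h1 h2
      have h3 := abs_sub_round (x - c)
      rw [← h1, ← h2, ← hloc _ (by rw [abs_le] at h3; exact h3)]
      ring_nf
    rw [hglob]
    exact contDiff_const.mul ((contDiff_cosSol_sinSol ε).2.comp (contDiff_id.sub contDiff_const))
  have hB0 : B = 0 := by
    rcases mul_eq_zero.1 hodd with h1 | h1
    · exact h1
    · exact absurd (by exact_mod_cast h1) hS
  have heven : ∀ s ∈ Set.Icc (0 : ℝ) (1 / 2), φ (c - s) = φ (c + s) := by
    intro s hs
    have := hB s hs
    rw [hB0, zero_mul, sub_eq_zero] at this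
    exact_mod_cast this.symm
  have hhalf : ∀ s ∈ Set.Icc (0 : ℝ) (1 / 2), φ (c + s) = φ c * cuspSol Z ε s := by
    intro s hs
    have := hev s hs
    have h1 : φ (c + s) + φ (c - s) = 2 * φ c * cuspSol Z ε s := by exact_mod_cast this
    rw [heven s hs] at h1
    linarith
  have hc0 : φ c ≠ 0 := by
    intro hc0
    apply hns
    have : φ = fun _ => 0 := by
      ext x
      have h1 := hφper.sub_int_mul_eq (x := x) (round (x - c))
      rw [mul_one] at h1
      have h3 := abs_sub_round (x - c)
      rw [← h1]
      rw [abs_le] at h3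
      rcases le_total 0 (x - c - round (x - c)) with h4 | h4
      · have := hhalf _ ⟨h4, h3.2⟩
        rw [hc0, zero_mul] at this
        rw [← this]; ring_nf
      · have h5 := hhalf (-(x - c - round (x - c))) ⟨by linarith, by linarith⟩
        rw [← heven _ ⟨by linarith, by linarith⟩, hc0, zero_mul] at h5
        rw [← h5]; ring_nf
    rw [this]
    exact contDiff_const
  have hsym := cuspSol_one_sub (mul_eq_zero.1 hgr' |>.resolve_left hc0)
  refine ⟨hc0, heven, fun s hs => ?_, hsym⟩
  rcases le_total s (1 / 2) with h1 | h1
  · exact hhalf s ⟨hs.1, h1⟩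
  · have h2 := hhalf (1 - s) ⟨by linarith [hs.2], by linarith⟩
    rw [hsym, ← heven _ ⟨by linarith [hs.2], by linarith⟩] at h2
    rw [← h2, ← hφper (c - (1 - s))]
    ring_nf


/-! ### Scaling of the pseudo polynomials -/

theorem IsPseudoPoly.unique {d : ℕ} (hd : 1 ≤ d) {η : ℝ} (hη : 0 < η) {f : ℝ → ℝ} {q : ℝ[X]}
    (h : IsPseudoPoly d η f q) : pseudoPoly d η f = q :=
  (existsUnique_isPseudoPoly hd hη f).unique (isPseudoPoly_pseudoPoly hd hη f) h

theorem iteratedDeriv_eval (p : ℝ[X]) (k : ℕ) :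
    iteratedDeriv k (fun x => p.eval x) = fun x => (derivative^[k] p).eval x := by
  induction k with
  | zero => simp
  | succ k ih =>
    rw [iteratedDeriv_succ, ih, Function.iterate_succ_apply']
    ext x
    exact (derivative^[k] p).deriv

/-- The even polynomials of degree at most `2d - 2` whose derivatives of order `< d` at `1` vanish,
except the `k`-th which is `1`. -/
def evenBasis (d k : ℕ) : ℝ[X] :=
  pseudoPoly d 1 (fun t => (C ((k.factorial : ℝ)⁻¹) * (X - C 1) ^ k : ℝ[X]).eval t)

theorem evenBasis_even {d : ℕ} (hd : 1 ≤ d) (k : ℕ) (x : ℝ) :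
    (evenBasis d k).eval (-x) = (evenBasis d k).eval x :=
  (isPseudoPoly_pseudoPoly hd one_pos _).even x

theorem natDegree_evenBasis_le {d : ℕ} (hd : 1 ≤ d) (k : ℕ) :
    (evenBasis d k).natDegree ≤ 2 * d - 2 :=
  (isPseudoPoly_pseudoPoly hd one_pos _).natDegree_le

theorem iterate_derivative_evenBasis {d : ℕ} (hd : 1 ≤ d) (k : ℕ) {j : ℕ} (hj : j < d) :
    (derivative^[j] (evenBasis d k)).eval 1 = if j = k then 1 else 0 := by
  rw [evenBasis, (isPseudoPoly_pseudoPoly hd one_pos _).deriv_eq j hj, iteratedDeriv_eval]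
  simp only
  rw [iterate_derivative_C_mul, iterate_derivative_X_sub_pow]
  rcases lt_trichotomy j k with h | h | h
  · simp [h.ne, Nat.sub_ne_zero_of_lt h]
  · subst h
    simp [Nat.descFactorial_self, Nat.factorial_ne_zero]
  · simp [h.ne', Nat.descFactorial_of_lt h]

theorem evenBasis_zero {d : ℕ} (hd : 1 ≤ d) : evenBasis d 0 = 1 := by
  refine IsPseudoPoly.unique hd one_pos ⟨by simp, by simp, fun k _ => ?_⟩
  rw [iteratedDeriv_eval]
  simp

theorem iterate_derivative_comp_C_mul_X (p : ℝ[X]) (a : ℝ) (k : ℕ) :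
    derivative^[k] (p.comp (C a * X)) = C (a ^ k) * (derivative^[k] p).comp (C a * X) := by
  induction k with
  | zero => simp
  | succ k ih =>
    rw [Function.iterate_succ_apply', ih, derivative_C_mul, derivative_comp,
      Function.iterate_succ_apply', derivative_C_mul, derivative_X, pow_succ, C_mul]
    ring

theorem pseudoPoly_eq_sum {d : ℕ} (hd : 1 ≤ d) {η : ℝ} (hη : 0 < η) (f : ℝ → ℝ) :
    pseudoPoly d η f = ∑ k ∈ Finset.range d,
      C (η ^ k * iteratedDeriv k f η) * (evenBasis d k).comp (C η⁻¹ * X) := by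
  refine IsPseudoPoly.unique hd hη ⟨fun x => ?_, ?_, fun j hj => ?_⟩
  · simp [eval_finsetSum, evenBasis_even hd]
  · refine natDegree_sum_le_of_forall_le _ _ fun k _ => ?_
    refine natDegree_C_mul_le _ _ |>.trans (natDegree_comp_le.trans ?_)
    refine (Nat.mul_le_mul (natDegree_evenBasis_le hd k) ((natDegree_C_mul_le _ _).trans natDegree_X_le)).trans ?_
    simp
  · rw [iterate_derivative_sum, eval_finsetSum, Finset.sum_eq_single j]
    · rw [iterate_derivative_C_mul, iterate_derivative_comp_C_mul_X]
      simp only [eval_mul, eval_C, eval_comp, eval_X, inv_mul_cancel₀ hη.ne',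
        iterate_derivative_evenBasis hd j hj, if_true, inv_pow]
      field_simp
    · intro k _ hk
      rw [iterate_derivative_C_mul, iterate_derivative_comp_C_mul_X]
      simp [inv_mul_cancel₀ hη.ne', iterate_derivative_evenBasis hd k hj, hk.symm]
    · intro h
      exact absurd (Finset.mem_range.2 hj) h

theorem pseudoPoly_eval_mul {d : ℕ} (hd : 1 ≤ d) {η : ℝ} (hη : 0 < η) (f : ℝ → ℝ) (t : ℝ) :
    (pseudoPoly d η f).eval (η * t) = ∑ k ∈ Finset.range d,
      η ^ k * iteratedDeriv k f η * (evenBasis d k).eval t := by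
  rw [pseudoPoly_eq_sum hd hη, eval_finsetSum]
  simp [hη.ne']

/-- The derivatives of order `l ≥ 1` of the pseudo polynomials are `O(η^(1 - l))`. -/
theorem exists_bound_iterate_derivative_pseudoPoly {d : ℕ} (hd : 1 ≤ d) {l : ℕ} (hl : 1 ≤ l) :
    ∃ K, 0 ≤ K ∧ ∀ η, 0 < η → η ≤ 1 → ∀ (f : ℝ → ℝ) (M : ℝ),
      (∀ k < d, |iteratedDeriv k f η| ≤ M) → ∀ s, |s| ≤ η →
        |(derivative^[l] (pseudoPoly d η f)).eval s| ≤ K * M / η ^ (l - 1) := by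
  have hb : ∀ k, ∃ K, 0 ≤ K ∧ ∀ t ∈ Set.Icc (-1 : ℝ) 1,
      |(derivative^[l] (evenBasis d k)).eval t| ≤ K := by
    intro k
    obtain ⟨K, hK⟩ := isCompact_Icc.exists_bound_of_continuousOn
      ((derivative^[l] (evenBasis d k)).continuous.continuousOn (s := Set.Icc (-1 : ℝ) 1))
    exact ⟨K, (norm_nonneg _).trans (hK 0 (by simp)), fun t ht => hK t ht⟩
  choose K hK0 hK using hb
  refine ⟨∑ k ∈ Finset.range d, K k, Finset.sum_nonneg fun k _ => hK0 k, ?_⟩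
  intro η hη hη1 f M hM s hs
  have hM0 : 0 ≤ M := (abs_nonneg _).trans (hM 0 hd)
  rw [pseudoPoly_eq_sum hd hη, iterate_derivative_sum, eval_finsetSum]
  refine (Finset.abs_sum_le_sum_abs _ _).trans ?_
  rw [Finset.sum_mul, Finset.sum_div]
  refine Finset.sum_le_sum fun k hk => ?_
  rw [iterate_derivative_C_mul, iterate_derivative_comp_C_mul_X]
  simp only [eval_mul, eval_C, eval_comp, eval_X]
  rcases Nat.eq_zero_or_pos k with rfl | hk0
  · rw [evenBasis_zero hd, iterate_derivative_one (by omega)]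
    simp only [eval_zero, mul_zero, abs_zero]
    have := hK0 0
    positivity
  · have h1 : |(derivative^[l] (evenBasis d k)).eval (η⁻¹ * s)| ≤ K k := by
      apply hK
      rw [Set.mem_Icc, ← abs_le, abs_mul, abs_inv, abs_of_pos hη, inv_mul_le_iff₀ hη]
      linarith
    rw [abs_mul, abs_mul (η ^ k), abs_mul (η⁻¹ ^ l), abs_of_pos (pow_pos hη k),
      abs_of_pos (pow_pos (inv_pos.2 hη) l)]
    have h2 : η ^ k * (η⁻¹) ^ l ≤ 1 / η ^ (l - 1) := by
      rw [inv_pow, le_div_iff₀ (by positivity)]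
      have e : η ^ l = η ^ (l - 1) * η := by rw [← pow_succ]; congr 1; omega
      rw [e]
      have : η ^ k ≤ η ^ 1 := pow_le_pow_of_le_one hη.le hη1 hk0
      field_simp
      simpa using this
    calc η ^ k * |iteratedDeriv k f η| *
          ((η⁻¹) ^ l * |(derivative^[l] (evenBasis d k)).eval (η⁻¹ * s)|)
        = (η ^ k * (η⁻¹) ^ l) * (|iteratedDeriv k f η| *
          |(derivative^[l] (evenBasis d k)).eval (η⁻¹ * s)|) := by ring
      _ ≤ (1 / η ^ (l - 1)) * (M * K k) := by
          gcongr
          exact hM k (Finset.mem_range.1 hk)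
      _ = K k * M / η ^ (l - 1) := by ring

/-! ### The pseudo wave functions -/

theorem pseudoFun_periodic {d : ℕ} {c η : ℝ} {φ : ℝ → ℝ} (h : Function.Periodic φ 1) :
    Function.Periodic (pseudoFun d c η φ) 1 := by
  intro x
  have e : x + 1 - c = (x - c) + 1 := by ring
  have e2 : (x - c) + 1 - ((round (x - c) : ℤ) + 1 : ℝ) = x - c - round (x - c) := by ring
  simp only [pseudoFun, e, round_add_one, Int.cast_add, Int.cast_one, e2, h x]

theorem pseudoFun_of_le {d : ℕ} {c η : ℝ} (φ : ℝ → ℝ) {s : ℝ} (hη : η < 1 / 2) (hs : |s| ≤ η) :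
    pseudoFun d c η φ (c + s) = (pseudoPoly d η (fun t => φ (c + t))).eval s := by
  have hr : round s = 0 := by
    rw [round_eq_zero_iff]
    rw [abs_le] at hs
    constructor <;> linarith
  rw [pseudoFun]
  simp [hr, hs]

theorem pseudoFun_of_lt {d : ℕ} {c η : ℝ} (φ : ℝ → ℝ) {s : ℝ} (h1 : η < s) (h2 : s < 1 - η) :
    pseudoFun d c η φ (c + s) = φ (c + s) := by
  rw [pseudoFun, if_neg]
  rw [add_sub_cancel_left, not_le]
  rcases le_or_gt (round s) 0 with h | h
  · have : (round s : ℝ) ≤ 0 := by exact_mod_cast h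
    exact lt_of_lt_of_le (by linarith) (le_abs_self _)
  · have : (1 : ℝ) ≤ round s := by exact_mod_cast h
    exact lt_of_lt_of_le (by linarith) (neg_le_abs _)

/-! ### Iterated integration by parts -/

theorem integral_mul_exp_eq_sum {D : ℕ → ℝ → ℂ} (hD : ∀ k x, HasDerivAt (D k) (D (k + 1) x) x)
    {l : ℂ} (hl : l ≠ 0) (a b : ℝ) (n : ℕ) :
    ∫ s in a..b, D 0 s * Complex.exp (l * s) =
      ∑ k ∈ Finset.range n, (-1) ^ k * (l⁻¹) ^ (k + 1) *
        (D k b * Complex.exp (l * b) - D k a * Complex.exp (l * a)) +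
      (-1) ^ n * (l⁻¹) ^ n * ∫ s in a..b, D n s * Complex.exp (l * s) := by
  have hc : ∀ k, Continuous (D k) := fun k =>
    continuous_iff_continuousAt.2 fun x => (hD k x).continuousAt
  have he : ∀ x : ℝ, HasDerivAt (fun s : ℝ => l⁻¹ * Complex.exp (l * s)) (Complex.exp (l * x)) x := by
    intro x
    have h1 : HasDerivAt (fun s : ℝ => l * (s : ℂ)) l x := by
      simpa using (Complex.ofRealCLM.hasDerivAt (x := x)).const_mul l
    exact (h1.cexp.const_mul l⁻¹).congr_deriv (by field_simp)
  have hce : Continuous fun s : ℝ => Complex.exp (l * s) := by fun_prop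
  induction n with
  | zero => simp
  | succ n ih =>
    rw [ih, Finset.sum_range_succ, intervalIntegral.integral_mul_deriv_eq_deriv_mul
      (fun x _ => hD n x) (fun x _ => he x) ((hc _).intervalIntegrable _ _)
      (hce.intervalIntegrable _ _)]
    have : ∫ x in a..b, D (n + 1) x * (l⁻¹ * Complex.exp (l * x))
        = l⁻¹ * ∫ x in a..b, D (n + 1) x * Complex.exp (l * x) := by
      rw [← intervalIntegral.integral_const_mul]
      congr 1; ext x; ring
    rw [this]
    ring

theorem iteratedDeriv_one_sub {U : ℝ → ℝ} (hU : ContDiff ℝ (⊤ : ℕ∞) U)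
    (hs : ∀ s, U (1 - s) = U s) (k : ℕ) (s : ℝ) :
    iteratedDeriv k U (1 - s) = (-1) ^ k * iteratedDeriv k U s := by
  induction k generalizing s with
  | zero => simp [hs]
  | succ k ih =>
    have hd : ∀ x, HasDerivAt (iteratedDeriv k U) (iteratedDeriv (k + 1) U x) x := fun x => by
      rw [iteratedDeriv_succ]
      exact (hU.differentiable_iteratedDeriv k (by exact_mod_cast ENat.natCast_lt_top k) x).hasDerivAt
    have h1 := (hd (1 - s)).comp_const_sub 1 s
    have h2 : (fun x => iteratedDeriv k U (1 - x)) = fun x => (-1) ^ k * iteratedDeriv k U x :=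
      funext fun x => ih x
    rw [h2] at h1
    have h3 := h1.unique ((hd s).const_mul _)
    rw [pow_succ]
    linarith

theorem iterate_derivative_eval_neg {q : ℝ[X]} (hq : ∀ x, q.eval (-x) = q.eval x) (k : ℕ) (s : ℝ) :
    (derivative^[k] q).eval (-s) = (-1) ^ k * (derivative^[k] q).eval s := by
  have hcomp : q.comp (C (-1) * X) = q := by
    apply Polynomial.funext
    intro x
    simpa using hq x
  have h := iterate_derivative_comp_C_mul_X q (-1) k
  rw [hcomp] at h
  have h2 := congrArg (fun p : ℝ[X] => p.eval (-s)) h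
  simpa using h2

/-- Fourier coefficients of the pseudo wave functions. -/
theorem exists_bound_fourier_pseudoFun {d : ℕ} (hd : 1 ≤ d) {c η₀ : ℝ} (hη₀ : η₀ < 1 / 2)
    {φ U : ℝ → ℝ} (hφ : Function.Periodic φ 1) (hU : ContDiff ℝ (⊤ : ℕ∞) U)
    (hφU : ∀ s ∈ Set.Icc (0 : ℝ) 1, φ (c + s) = U s) (hUs : ∀ s, U (1 - s) = U s) :
    ∃ K, 0 ≤ K ∧ ∀ η, 0 < η → η ≤ η₀ → ∀ m : ℤ, 1 ≤ m →
      ‖∫ x in (0 : ℝ)..1, (pseudoFun d c η φ x : ℂ) * Complex.exp (-(2 * Real.pi * Complex.I * m) * x)‖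
        ≤ K / (η ^ (d - 1) * (m : ℝ) ^ (d + 1)) := by
  have hUd : ∀ k x, HasDerivAt (iteratedDeriv k U) (iteratedDeriv (k + 1) U x) x := fun k x => by
    rw [iteratedDeriv_succ]
    exact (hU.differentiable_iteratedDeriv k (by exact_mod_cast ENat.natCast_lt_top k) x).hasDerivAt
  have hUc : ∀ k, Continuous (iteratedDeriv k U) := fun k =>
    continuous_iff_continuousAt.2 fun x => (hUd k x).continuousAt
  have hM : ∃ M, 0 ≤ M ∧ ∀ k < d + 2, ∀ x ∈ Set.Icc (0 : ℝ) 1, |iteratedDeriv k U x| ≤ M := by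
    have : ∀ k, ∃ M, 0 ≤ M ∧ ∀ x ∈ Set.Icc (0 : ℝ) 1, |iteratedDeriv k U x| ≤ M := fun k => by
      obtain ⟨M, hM⟩ := isCompact_Icc.exists_bound_of_continuousOn
        ((hUc k).continuousOn (s := Set.Icc (0 : ℝ) 1))
      exact ⟨M, (norm_nonneg _).trans (hM 0 (by simp)), fun x hx => hM x hx⟩
    choose M hM0 hM using this
    refine ⟨∑ k ∈ Finset.range (d + 2), M k, Finset.sum_nonneg fun k _ => hM0 k,
      fun k hk x hx => (hM k x hx).trans ?_⟩
    exact Finset.single_le_sum (fun k _ => hM0 k) (Finset.mem_range.2 hk)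
  obtain ⟨M, hM0, hM⟩ := hM
  obtain ⟨K₁, hK₁0, hK₁⟩ := exists_bound_iterate_derivative_pseudoPoly hd hd
  obtain ⟨K₂, hK₂0, hK₂⟩ := exists_bound_iterate_derivative_pseudoPoly hd (l := d + 1) (by omega)
  refine ⟨2 * (K₁ * M) + 2 * M + (2 * (K₂ * M) + M), by positivity, fun η hη hηη₀ m hm => ?_⟩
  have hη2 : η < 1 / 2 := hηη₀.trans_lt hη₀
  have hη1 : η ≤ 1 := by linarith
  set q := pseudoPoly d η (fun t => φ (c + t)) with hq
  have hqp := isPseudoPoly_pseudoPoly hd hη (fun t => φ (c + t))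
  have hfU : ∀ k, iteratedDeriv k (fun t => φ (c + t)) η = iteratedDeriv k U η := by
    intro k
    apply Filter.EventuallyEq.iteratedDeriv_eq
    filter_upwards [Ioo_mem_nhds hη (show η < 1 by linarith)] with t ht
    exact hφU t ⟨ht.1.le, ht.2.le⟩
  have hfM : ∀ k < d, |iteratedDeriv k (fun t => φ (c + t)) η| ≤ M := fun k hk => by
    rw [hfU]; exact hM k (by omega) η ⟨hη.le, hη1⟩
  have hq1 : ∀ s, |s| ≤ η → |(derivative^[d] q).eval s| ≤ K₁ * M / η ^ (d - 1) :=
    hK₁ η hη hη1 _ M hfM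
  have hq2 : ∀ s, |s| ≤ η → |(derivative^[d + 1] q).eval s| ≤ K₂ * M / η ^ d := by
    simpa using hK₂ η hη hη1 _ M hfM
  set l : ℂ := -(2 * Real.pi * Complex.I * m) with hl
  have hm0 : (0 : ℝ) < m := by exact_mod_cast hm
  have hlI : l = ((-(2 * Real.pi * m) : ℝ) : ℂ) * Complex.I := by rw [hl]; push_cast; ring
  have hl0 : l ≠ 0 := by
    rw [hlI]
    have : (-(2 * Real.pi * m) : ℝ) ≠ 0 := by
      have := Real.pi_pos
      exact neg_ne_zero.2 (by positivity)
    exact mul_ne_zero (by exact_mod_cast this) Complex.I_ne_zero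
  have hlm : ‖l⁻¹‖ ≤ (m : ℝ)⁻¹ := by
    rw [norm_inv, hlI, norm_mul, Complex.norm_I, mul_one, Complex.norm_real, norm_neg,
      Real.norm_of_nonneg (by positivity)]
    apply inv_anti₀ hm0
    nlinarith [Real.pi_gt_three]
  have hexp : ∀ s : ℝ, ‖Complex.exp (l * s)‖ = 1 := fun s => by
    rw [hlI, show ((-(2 * Real.pi * m) : ℝ) : ℂ) * Complex.I * s
      = ((-(2 * Real.pi * m) * s : ℝ) : ℂ) * Complex.I by push_cast; ring,
      Complex.norm_exp_ofReal_mul_I]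
  have hexp1 : Complex.exp l = 1 := by
    rw [hl, show -(2 * Real.pi * Complex.I * m) = ((-m : ℤ) : ℂ) * (2 * Real.pi * Complex.I) by
      push_cast; ring, Complex.exp_int_mul_two_pi_mul_I]
  have hexpp : ∀ x : ℝ, Complex.exp (l * (x + 1 : ℝ)) = Complex.exp (l * x) := fun x => by
    push_cast
    rw [mul_add, Complex.exp_add, mul_one, hexp1, mul_one]
  -- the two pieces of the integral
  have hper : Function.Periodic (fun x : ℝ => (pseudoFun d c η φ x : ℂ) * Complex.exp (l * x)) 1 :=
    fun x => by simp only [pseudoFun_periodic hφ x, hexpp]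
  set Dq : ℕ → ℝ → ℂ := fun k s => ((derivative^[k] q).eval s : ℝ) with hDq
  set DU : ℕ → ℝ → ℂ := fun k s => (iteratedDeriv k U s : ℝ) with hDU
  have hDqd : ∀ k x, HasDerivAt (Dq k) (Dq (k + 1) x) x := fun k x => by
    simp only [hDq, Function.iterate_succ_apply']
    exact ((derivative^[k] q).hasDerivAt x).ofReal_comp
  have hDUd : ∀ k x, HasDerivAt (DU k) (DU (k + 1) x) x := fun k x => (hUd k x).ofReal_comp
  have hDqc : ∀ k, Continuous (Dq k) := fun k =>
    continuous_iff_continuousAt.2 fun x => (hDqd k x).continuousAt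
  have hDUc : ∀ k, Continuous (DU k) := fun k =>
    continuous_iff_continuousAt.2 fun x => (hDUd k x).continuousAt
  have hce : Continuous fun s : ℝ => Complex.exp (l * s) := by fun_prop
  have e1 : ∀ s ∈ Set.Icc (-η) η, (pseudoFun d c η φ (s + c) : ℂ) = Dq 0 s := fun s hs => by
    rw [add_comm, pseudoFun_of_le φ hη2 (abs_le.2 hs)]
    rfl
  have e2 : ∀ s ∈ Set.Ioo η (1 - η), (pseudoFun d c η φ (s + c) : ℂ) = DU 0 s := fun s hs => by
    rw [add_comm, pseudoFun_of_lt φ hs.1 hs.2, hφU s ⟨by linarith [hs.1], by linarith [hs.2]⟩]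
    simp [hDU]
  have hexps : ∀ s : ℝ, Complex.exp (l * (s + c : ℝ)) = Complex.exp (l * c) * Complex.exp (l * s) := by
    intro s
    push_cast
    rw [mul_add, Complex.exp_add, mul_comm]
  set F : ℝ → ℂ := fun s => (pseudoFun d c η φ (s + c) : ℂ) * Complex.exp (l * (s + c : ℝ)) with hF
  have f1 : Set.EqOn F (fun s => Complex.exp (l * c) * (Dq 0 s * Complex.exp (l * s)))
      (Set.uIcc (-η) η) := fun s hs => by
    rw [Set.uIcc_of_le (by linarith)] at hs
    simp only [hF]
    rw [e1 s hs, hexps]; ring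
  have f2 : ∀ᵐ s : ℝ, s ∈ Set.uIoc η (1 - η) →
      F s = Complex.exp (l * c) * (DU 0 s * Complex.exp (l * s)) := by
    have hne : ∀ᵐ x : ℝ, x ≠ 1 - η := by simp [ae_iff, measure_singleton]
    filter_upwards [hne] with s hs hsm
    rw [Set.uIoc_of_le (by linarith)] at hsm
    simp only [hF]
    rw [e2 s ⟨hsm.1, lt_of_le_of_ne hsm.2 hs⟩, hexps]; ring
  have i1 : IntervalIntegrable F volume (-η) η := by
    have : IntervalIntegrable (fun s => Complex.exp (l * c) * (Dq 0 s * Complex.exp (l * s)))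
        volume (-η) η := (continuous_const.mul ((hDqc 0).mul hce)).intervalIntegrable _ _
    exact this.congr (fun s hs => (f1 (Set.uIoc_subset_uIcc hs)).symm)
  have i2 : IntervalIntegrable F volume η (1 - η) := by
    have : IntervalIntegrable (fun s => Complex.exp (l * c) * (DU 0 s * Complex.exp (l * s)))
        volume η (1 - η) := (continuous_const.mul ((hDUc 0).mul hce)).intervalIntegrable _ _
    refine this.congr_ae ?_
    rw [Filter.EventuallyEq, ae_restrict_iff' measurableSet_uIoc]
    filter_upwards [f2] with s hs hsm
    exact (hs hsm).symm
  have hsplit : ∫ x in (0 : ℝ)..1, (pseudoFun d c η φ x : ℂ) * Complex.exp (l * x)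
      = Complex.exp (l * c) * ((∫ s in (-η)..η, Dq 0 s * Complex.exp (l * s)) +
        ∫ s in η..(1 - η), DU 0 s * Complex.exp (l * s)) := by
    rw [integral_zero_one_eq hper (-η + c)]
    have h1 := intervalIntegral.integral_comp_add_right (a := -η) (b := 1 - η)
      (fun x : ℝ => (pseudoFun d c η φ x : ℂ) * Complex.exp (l * x)) c
    rw [show -η + c + 1 = 1 - η + c by ring, ← h1,
      ← intervalIntegral.integral_add_adjacent_intervals i1 i2,
      intervalIntegral.integral_congr f1, intervalIntegral.integral_congr_ae f2,
      intervalIntegral.integral_const_mul, intervalIntegral.integral_const_mul, mul_add]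
  rw [hsplit, norm_mul, hexp, one_mul, integral_mul_exp_eq_sum hDqd hl0 (-η) η (d + 1),
    integral_mul_exp_eq_sum hDUd hl0 η (1 - η) (d + 1)]
  have hend : Complex.exp (l * (1 - η : ℝ)) = Complex.exp (l * (-η : ℝ)) := by
    rw [← hexpp (-η)]; congr 3; ring
  have hcancel : ∀ k < d,
      (Dq k η * Complex.exp (l * η) - Dq k (-η) * Complex.exp (l * (-η : ℝ))) +
      (DU k (1 - η) * Complex.exp (l * (1 - η : ℝ)) - DU k η * Complex.exp (l * η)) = 0 := by
    intro k hk
    have h1 : Dq k η = DU k η := by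
      simp only [hDq, hDU, hq]
      rw [hqp.deriv_eq k hk, hfU]
    have h2 : Dq k (-η) = DU k (1 - η) := by
      have h3 : Dq k (-η) = (-1) ^ k * Dq k η := by
        simp only [hDq]
        rw [iterate_derivative_eval_neg hqp.even]; push_cast; ring
      rw [h3, h1]
      simp only [hDU]
      rw [iteratedDeriv_one_sub hU hUs]; push_cast; ring
    rw [h1, h2, hend]
    ring
  have hsum : ∑ k ∈ Finset.range (d + 1), (-1) ^ k * (l⁻¹) ^ (k + 1) *
        (Dq k η * Complex.exp (l * η) - Dq k (-η) * Complex.exp (l * (-η : ℝ))) +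
      ∑ k ∈ Finset.range (d + 1), (-1) ^ k * (l⁻¹) ^ (k + 1) *
        (DU k (1 - η) * Complex.exp (l * (1 - η : ℝ)) - DU k η * Complex.exp (l * η)) =
      (-1) ^ d * (l⁻¹) ^ (d + 1) *
       ((Dq d η * Complex.exp (l * η) - Dq d (-η) * Complex.exp (l * (-η : ℝ))) +
      (DU d (1 - η) * Complex.exp (l * (1 - η : ℝ)) - DU d η * Complex.exp (l * η))) := by
    rw [← Finset.sum_add_distrib, Finset.sum_range_succ, Finset.sum_eq_zero, zero_add]
    · ring
    · intro k hk
      rw [← mul_add, hcancel k (Finset.mem_range.1 hk), mul_zero]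
  set A : ℂ := (Dq d η * Complex.exp (l * η) - Dq d (-η) * Complex.exp (l * (-η : ℝ))) +
      (DU d (1 - η) * Complex.exp (l * (1 - η : ℝ)) - DU d η * Complex.exp (l * η)) with hA
  set I₁ : ℂ := ∫ s in (-η)..η, Dq (d + 1) s * Complex.exp (l * s) with hI₁
  set I₂ : ℂ := ∫ s in η..(1 - η), DU (d + 1) s * Complex.exp (l * s) with hI₂
  rw [add_add_add_comm, hsum]
  have hηd : 1 ≤ 1 / η ^ (d - 1) := by
    rw [le_div_iff₀ (by positivity), one_mul]
    exact pow_le_one₀ hη.le hη1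
  have bA : ‖A‖ ≤ 2 * (K₁ * M / η ^ (d - 1)) + 2 * M := by
    have a1 : ‖Dq d η‖ ≤ K₁ * M / η ^ (d - 1) := by
      simp only [hDq, Complex.norm_real, Real.norm_eq_abs]
      exact hq1 η (abs_of_pos hη).le
    have a2 : ‖Dq d (-η)‖ ≤ K₁ * M / η ^ (d - 1) := by
      simp only [hDq, Complex.norm_real, Real.norm_eq_abs]
      exact hq1 (-η) (by rw [abs_neg, abs_of_pos hη])
    have a3 : ‖DU d η‖ ≤ M := by
      simp only [hDU, Complex.norm_real, Real.norm_eq_abs]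
      exact hM d (by omega) η ⟨hη.le, hη1⟩
    have a4 : ‖DU d (1 - η)‖ ≤ M := by
      simp only [hDU, Complex.norm_real, Real.norm_eq_abs]
      exact hM d (by omega) (1 - η) ⟨by linarith, by linarith⟩
    calc ‖A‖ ≤ (‖Dq d η‖ + ‖Dq d (-η)‖) + (‖DU d (1 - η)‖ + ‖DU d η‖) := by
          refine (norm_add_le _ _).trans (add_le_add ?_ ?_) <;>
          · refine (norm_sub_le _ _).trans ?_
            rw [norm_mul, norm_mul, hexp, hexp, mul_one, mul_one]
      _ ≤ _ := by linarith
  have bI₁ : ‖I₁‖ ≤ 2 * (K₂ * M / η ^ (d - 1)) := by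
    have := intervalIntegral.norm_integral_le_of_norm_le_const (a := -η) (b := η)
      (C := K₂ * M / η ^ d) (f := fun s => Dq (d + 1) s * Complex.exp (l * s)) (fun s hs => by
        rw [Set.uIoc_of_le (by linarith)] at hs
        rw [norm_mul, hexp, mul_one]
        simp only [hDq, Complex.norm_real, Real.norm_eq_abs]
        exact hq2 s (abs_le.2 ⟨hs.1.le, hs.2⟩))
    refine this.trans (le_of_eq ?_)
    rw [sub_neg_eq_add, abs_of_pos (by linarith)]
    have e : η ^ d = η ^ (d - 1) * η := by rw [← pow_succ]; congr 1; omega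
    rw [e]
    field_simp
    ring
  have bI₂ : ‖I₂‖ ≤ M := by
    have := intervalIntegral.norm_integral_le_of_norm_le_const (a := η) (b := 1 - η)
      (C := M) (f := fun s => DU (d + 1) s * Complex.exp (l * s)) (fun s hs => by
        rw [Set.uIoc_of_le (by linarith)] at hs
        rw [norm_mul, hexp, mul_one]
        simp only [hDU, Complex.norm_real, Real.norm_eq_abs]
        exact hM (d + 1) (by omega) s ⟨by linarith [hs.1], by linarith [hs.2]⟩)
    refine this.trans ?_
    rw [abs_of_pos (by linarith)]
    nlinarith
  have hpow : ‖(l⁻¹) ^ (d + 1)‖ ≤ 1 / (m : ℝ) ^ (d + 1) := by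
    rw [norm_pow, one_div, ← inv_pow]
    exact pow_le_pow_left₀ (norm_nonneg _) hlm _
  have hfin : (-1) ^ d * (l⁻¹) ^ (d + 1) * A + ((-1) ^ (d + 1) * (l⁻¹) ^ (d + 1) * I₁ +
      (-1) ^ (d + 1) * (l⁻¹) ^ (d + 1) * I₂) = (-1) ^ d * (l⁻¹) ^ (d + 1) * (A - I₁ - I₂) := by
    ring
  rw [hfin, norm_mul, norm_mul, norm_pow, norm_neg, norm_one, one_pow, one_mul]
  have hA3 : ‖A - I₁ - I₂‖ ≤ (2 * (K₁ * M) + 2 * M + (2 * (K₂ * M) + M)) * (1 / η ^ (d - 1)) := by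
    refine (norm_sub_le _ _).trans ((add_le_add_left (norm_sub_le _ _) _).trans ?_)
    have : M ≤ M * (1 / η ^ (d - 1)) := le_mul_of_one_le_right hM0 hηd
    simp only [div_eq_mul_one_div (K₁ * M), div_eq_mul_one_div (K₂ * M)] at bA bI₁
    nlinarith
  calc ‖(l⁻¹) ^ (d + 1)‖ * ‖A - I₁ - I₂‖
      ≤ (1 / (m : ℝ) ^ (d + 1)) *
        ((2 * (K₁ * M) + 2 * M + (2 * (K₂ * M) + M)) * (1 / η ^ (d - 1))) := by gcongr
    _ = _ := by field_simp


open Filter Topology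

/-! ### Leading order behaviour at the origin -/

theorem tendsto_div_pow_of_derivs {D : ℕ → ℝ → ℝ} (hD : ∀ k x, HasDerivAt (D k) (D (k + 1) x) x)
    {n : ℕ} (h0 : ∀ i < n, D i 0 = 0) :
    Tendsto (fun s => D 0 s / s ^ n) (𝓝[>] 0) (𝓝 (D n 0 / n.factorial)) := by
  induction n generalizing D with
  | zero =>
    have : Tendsto (D 0) (𝓝[>] 0) (𝓝 (D 0 0)) :=
      (hD 0 0).continuousAt.tendsto.mono_left nhdsWithin_le_nhds
    simpa using this
  | succ n ih =>
    have h1 := ih (D := fun k => D (k + 1)) (fun k x => hD (k + 1) x)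
      (fun i hi => h0 (i + 1) (by omega))
    refine HasDerivAt.lhopital_zero_nhdsGT (f' := D 1) (g' := fun s => (n + 1 : ℝ) * s ^ n)
      (Eventually.of_forall fun x => hD 0 x) (Eventually.of_forall fun x => ?_) ?_ ?_ ?_ ?_
    · simpa using hasDerivAt_pow (n + 1) x
    · filter_upwards [self_mem_nhdsWithin] with x hx
      have : (0 : ℝ) < x := hx
      positivity
    · have : Tendsto (D 0) (𝓝[>] 0) (𝓝 (D 0 0)) :=
        (hD 0 0).continuousAt.tendsto.mono_left nhdsWithin_le_nhds
      rwa [h0 0 (by omega)] at this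
    · have : Tendsto (fun s : ℝ => s ^ (n + 1)) (𝓝[>] 0) (𝓝 (0 ^ (n + 1))) :=
        ((continuous_pow (n + 1)).tendsto 0).mono_left nhdsWithin_le_nhds
      simpa using this
    · have h2 := h1.div_const (n + 1 : ℝ)
      refine (h2.congr fun s => ?_).trans_eq ?_
      · rw [div_div, mul_comm (s ^ n)]
      · rw [div_div, Nat.factorial_succ]
        push_cast
        rw [mul_comm ((n : ℝ) + 1)]

theorem exists_bound_of_derivs {D : ℕ → ℝ → ℝ} (hD : ∀ k x, HasDerivAt (D k) (D (k + 1) x) x)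
    {n : ℕ} (h0 : ∀ i < n, D i 0 = 0) :
    ∃ M, 0 ≤ M ∧ ∀ s ∈ Set.Icc (0 : ℝ) 1, |D 0 s| ≤ M * s ^ n := by
  induction n generalizing D with
  | zero =>
    obtain ⟨M, hM⟩ := isCompact_Icc.exists_bound_of_continuousOn
      ((continuous_iff_continuousAt.2 fun x => (hD 0 x).continuousAt).continuousOn
        (s := Set.Icc (0 : ℝ) 1))
    exact ⟨M, (norm_nonneg _).trans (hM 0 (by simp)), fun s hs => by simpa using hM s hs⟩
  | succ n ih =>
    obtain ⟨M, hM0, hM⟩ := ih (D := fun k => D (k + 1)) (fun k x => hD (k + 1) x)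
      (fun i hi => h0 (i + 1) (by omega))
    refine ⟨M, hM0, fun s hs => ?_⟩
    have h1 := (convex_Icc (0 : ℝ) s).norm_image_sub_le_of_norm_hasDerivWithin_le
      (C := M * s ^ n) (f := D 0) (x := 0) (y := s)
      (fun x _ => (hD 0 x).hasDerivWithinAt)
      (fun x hx => (hM x ⟨hx.1, hx.2.trans hs.2⟩).trans
        (mul_le_mul_of_nonneg_left (pow_le_pow_left₀ hx.1 hx.2 n) hM0))
      ⟨le_rfl, hs.1⟩ ⟨hs.1, le_rfl⟩
    rw [h0 0 (by omega), sub_zero, sub_zero, Real.norm_eq_abs, Real.norm_eq_abs,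
      abs_of_nonneg hs.1] at h1
    rw [pow_succ, ← mul_assoc]
    exact h1

/-- The even extension of a function on `(0, ∞)`, with prescribed value at `0`. -/
def evenExt (g : ℝ → ℝ) (v x : ℝ) : ℝ := if x = 0 then v else g |x|

theorem continuous_evenExt {g : ℝ → ℝ} {v : ℝ} (hg : ContinuousOn g (Set.Ioi 0))
    (hv : Tendsto g (𝓝[>] 0) (𝓝 v)) : Continuous (evenExt g v) := by
  rw [continuous_iff_continuousAt]
  intro x
  by_cases hx : x = 0
  · subst hx
    have h1 : Tendsto (fun y : ℝ => |y|) (𝓝[≠] 0) (𝓝[>] 0) := by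
      refine tendsto_nhdsWithin_iff.2 ⟨?_, ?_⟩
      · have := (continuous_abs (G := ℝ)).tendsto 0
        rw [abs_zero] at this
        exact this.mono_left nhdsWithin_le_nhds
      · filter_upwards [self_mem_nhdsWithin] with y hy
        exact abs_pos.2 hy
    rw [continuousAt_iff_punctured_nhds]
    have h2 : evenExt g v 0 = v := by simp [evenExt]
    rw [h2]
    refine (hv.comp h1).congr' ?_
    filter_upwards [self_mem_nhdsWithin] with y hy
    simp [evenExt, show y ≠ 0 from hy]
  · have h1 : ContinuousAt (fun y => g |y|) x :=
      ContinuousAt.comp (g := g) (f := fun y : ℝ => |y|)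
        (hg.continuousAt (Ioi_mem_nhds (abs_pos.2 hx))) continuous_abs.continuousAt
    refine h1.congr ?_
    filter_upwards [isOpen_ne.mem_nhds hx] with y hy
    simp [evenExt, show y ≠ 0 from hy]

theorem hasDerivAt_iteratedDeriv {f : ℝ → ℝ} (hf : ContDiff ℝ (⊤ : ℕ∞) f) (k : ℕ) (x : ℝ) :
    HasDerivAt (iteratedDeriv k f) (iteratedDeriv (k + 1) f x) x := by
  rw [iteratedDeriv_succ]
  exact (hf.differentiable_iteratedDeriv k (by exact_mod_cast ENat.natCast_lt_top k) x).hasDerivAt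

/-! ### The rescaled Gram matrix -/

/-- `s^(l - n) f^(l)(s)`, extended by its limit at `0` when `f(s) ~ s^n / n!`. -/
def scaledDeriv (f : ℝ → ℝ) (n l : ℕ) : ℝ → ℝ :=
  evenExt (fun s => s ^ l * iteratedDeriv l f s / s ^ n)
    (if l ≤ n then ((n - l).factorial : ℝ)⁻¹ else 0)

theorem continuous_scaledDeriv {f : ℝ → ℝ} (hf : ContDiff ℝ (⊤ : ℕ∞) f) {n : ℕ}
    (h0 : ∀ k < n, iteratedDeriv k f 0 = 0) (h1 : iteratedDeriv n f 0 = 1) (l : ℕ) :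
    Continuous (scaledDeriv f n l) := by
  have hd := hasDerivAt_iteratedDeriv hf
  have hc : ∀ k, Continuous (iteratedDeriv k f) := fun k =>
    continuous_iff_continuousAt.2 fun x => (hd k x).continuousAt
  refine continuous_evenExt ?_ ?_
  · refine ContinuousOn.div ((continuous_pow l).mul (hc l)).continuousOn
      (continuous_pow n).continuousOn fun x hx => ?_
    exact pow_ne_zero _ (ne_of_gt hx)
  · by_cases hl : l ≤ n
    · rw [if_pos hl]
      have := tendsto_div_pow_of_derivs (D := fun k => iteratedDeriv (l + k) f)
        (fun k x => hd (l + k) x) (n := n - l) (fun i hi => h0 (l + i) (by omega))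
      rw [Nat.add_sub_cancel' hl, h1, one_div] at this
      refine this.congr' ?_
      filter_upwards [self_mem_nhdsWithin] with s hs
      have hs0 : s ≠ 0 := ne_of_gt hs
      obtain ⟨k, rfl⟩ := Nat.exists_eq_add_of_le hl
      rw [Nat.add_sub_cancel_left, pow_add, add_zero]
      field_simp
    · rw [if_neg hl]
      obtain ⟨k, rfl⟩ := Nat.exists_eq_add_of_lt (not_le.1 hl)
      have : Tendsto (fun s => s ^ (k + 1) * iteratedDeriv (n + k + 1) f s) (𝓝[>] 0)
          (𝓝 (0 ^ (k + 1) * iteratedDeriv (n + k + 1) f 0)) :=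
        (((continuous_pow (k + 1)).mul (hc _)).tendsto 0).mono_left nhdsWithin_le_nhds
      rw [zero_pow (by omega), zero_mul] at this
      refine this.congr' ?_
      filter_upwards [self_mem_nhdsWithin] with s hs
      have hs0 : s ≠ 0 := ne_of_gt hs
      rw [eq_div_iff (pow_ne_zero n hs0)]
      ring

/-- The rescaled pseudo polynomial `t ↦ η^(-n) q_η(η t)` of a function `f(s) ~ s^n / n!`. -/
def scaledPoly (d : ℕ) (f : ℝ → ℝ) (n : ℕ) (η t : ℝ) : ℝ :=
  ∑ l ∈ Finset.range d, scaledDeriv f n l η * (evenBasis d l).eval t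

/-- The rescaled function `t ↦ η^(-n) f(η |t|)`, for `f(s) ~ s^n / n!` and `n` even. -/
def scaledFun (f : ℝ → ℝ) (n : ℕ) (η t : ℝ) : ℝ := t ^ n * scaledDeriv f n 0 (η * t)

theorem scaledPoly_mul {d : ℕ} (hd : 1 ≤ d) (f : ℝ → ℝ) (n : ℕ) {η : ℝ} (hη : 0 < η) (t : ℝ) :
    η ^ n * scaledPoly d f n η t = (pseudoPoly d η f).eval (η * t) := by
  rw [pseudoPoly_eval_mul hd hη, scaledPoly, Finset.mul_sum]
  refine Finset.sum_congr rfl fun l _ => ?_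
  rw [scaledDeriv, evenExt, if_neg hη.ne', abs_of_pos hη]
  field_simp

theorem scaledPoly_zero {d : ℕ} (hd : 1 ≤ d) (f : ℝ → ℝ) {n : ℕ} (hn : Even n)
    (hnd : n ≤ 2 * d - 2) (t : ℝ) : scaledPoly d f n 0 t = t ^ n / n.factorial := by
  set p : ℝ[X] := C ((n.factorial : ℝ)⁻¹) * X ^ n with hp
  have h1 : pseudoPoly d 1 (fun x => p.eval x) = p := by
    refine IsPseudoPoly.unique hd one_pos ⟨fun x => ?_, ?_, fun k _ => ?_⟩
    · simp [hp, hn.neg_pow]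
    · exact (natDegree_C_mul_X_pow_le _ _).trans hnd
    · rw [iteratedDeriv_eval]
  have h2 := pseudoPoly_eval_mul hd one_pos (fun x => p.eval x) t
  rw [h1, one_mul] at h2
  have h3 : p.eval t = t ^ n / n.factorial := by simp [hp]; ring
  rw [← h3, h2, scaledPoly]
  refine Finset.sum_congr rfl fun l _ => ?_
  rw [iteratedDeriv_eval, one_pow, one_mul, scaledDeriv, evenExt, if_pos rfl]
  congr 1
  simp only [hp]
  rw [iterate_derivative_C_mul, iterate_derivative_X_pow_eq_C_mul]
  split_ifs with h
  · simp only [eval_mul, eval_C, eval_pow, eval_X, one_pow, mul_one]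
    rw [Nat.descFactorial_eq_div h, Nat.cast_div (Nat.factorial_dvd_factorial (Nat.sub_le _ _))
      (by positivity)]
    have := Nat.factorial_ne_zero n
    field_simp
  · simp [Nat.descFactorial_of_lt (not_le.1 h)]

theorem scaledFun_mul {f : ℝ → ℝ} {n : ℕ} (hn : Even n)
    (h0 : ∀ k < n, iteratedDeriv k f 0 = 0) (h1 : iteratedDeriv n f 0 = 1) {η : ℝ} (hη : 0 < η)
    (t : ℝ) : η ^ n * scaledFun f n η t = f (η * |t|) := by
  rw [scaledFun, scaledDeriv, evenExt]
  by_cases ht : t = 0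
  · subst ht
    simp only [mul_zero, if_true, abs_zero, Nat.sub_zero, Nat.zero_le]
    rcases Nat.eq_zero_or_pos n with rfl | hn0
    · simpa using h1.symm
    · rw [zero_pow hn0.ne']
      simpa using (h0 0 hn0).symm
  · rw [if_neg (mul_ne_zero hη.ne' ht), abs_mul, abs_of_pos hη, iteratedDeriv_zero, pow_zero,
      one_mul, mul_pow, hn.pow_abs]
    have : t ^ n ≠ 0 := pow_ne_zero _ ht
    field_simp

theorem scaledFun_zero (f : ℝ → ℝ) (n : ℕ) (t : ℝ) :
    scaledFun f n 0 t = t ^ n / n.factorial := by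
  simp [scaledFun, scaledDeriv, evenExt, div_eq_mul_inv]

theorem det_moment_ne_zero {N : ℕ} {ρ : ℝ → ℝ} (hρ_cont : Continuous ρ) (hρ_nonneg : ∀ t, 0 ≤ ρ t)
    (hρ_supp : tsupport ρ = Set.Icc (-1) 1) :
    (Matrix.of fun k j : Fin N => ∫ t in (-1 : ℝ)..1, ρ t *
      (t ^ (2 * (k : ℕ)) / (2 * (k : ℕ)).factorial) *
      (t ^ (2 * (j : ℕ)) / (2 * (j : ℕ)).factorial)).det ≠ 0 := by
  intro hdet
  obtain ⟨v, hv0, hv⟩ := Matrix.exists_mulVec_eq_zero_iff.2 hdet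
  set p : ℝ[X] := ∑ j : Fin N, C (v j / (2 * (j : ℕ)).factorial) * X ^ (2 * (j : ℕ)) with hp
  have hpe : ∀ t, p.eval t = ∑ j : Fin N, v j * (t ^ (2 * (j : ℕ)) / (2 * (j : ℕ)).factorial) := by
    intro t
    simp only [hp, eval_finsetSum, eval_mul, eval_C, eval_pow, eval_X]
    exact Finset.sum_congr rfl fun j _ => by ring
  have hp0 : p ≠ 0 := by
    intro h
    apply hv0
    funext j
    have h1 := congrArg (fun p : ℝ[X] => p.coeff (2 * (j : ℕ))) h
    simp only [hp, finsetSum_coeff, coeff_C_mul, coeff_X_pow, coeff_zero] at h1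
    rw [Finset.sum_eq_single j] at h1
    · simpa [Nat.factorial_ne_zero] using h1
    · intro b _ hb
      have : 2 * (j : ℕ) ≠ 2 * (b : ℕ) := fun h => hb (Fin.ext (by omega))
      simp [this]
    · simp
  have hint : ∫ t in (-1 : ℝ)..1, ρ t * p.eval t ^ 2 = 0 := by
    have h1 : ∑ k : Fin N, v k * ∑ j : Fin N, (∫ t in (-1 : ℝ)..1, ρ t *
        (t ^ (2 * (k : ℕ)) / (2 * (k : ℕ)).factorial) *
        (t ^ (2 * (j : ℕ)) / (2 * (j : ℕ)).factorial)) * v j = 0 := by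
      refine Finset.sum_eq_zero fun k _ => ?_
      have := congrFun hv k
      simp only [Matrix.mulVec, dotProduct, Matrix.of_apply, Pi.zero_apply] at this
      rw [this, mul_zero]
    rw [← h1]
    simp_rw [← intervalIntegral.integral_mul_const, Finset.mul_sum,
      ← intervalIntegral.integral_const_mul]
    rw [← Finset.sum_congr rfl fun k _ => intervalIntegral.integral_finsetSum fun j _ =>
      (by fun_prop : Continuous _).intervalIntegrable _ _]
    rw [← intervalIntegral.integral_finsetSum fun k _ =>
      (by fun_prop : Continuous _).intervalIntegrable _ _]
    congr 1
    ext t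
    rw [hpe, sq, Finset.sum_mul_sum, Finset.mul_sum]
    refine Finset.sum_congr rfl fun k _ => ?_
    rw [Finset.mul_sum]
    exact Finset.sum_congr rfl fun j _ => by ring
  have hpos : ∃ c, 0 < ρ c ∧ p.eval c ≠ 0 := by
    have hne : ∃ c, ρ c ≠ 0 := by
      by_contra! h
      have : ρ = 0 := funext h
      rw [this] at hρ_supp
      have h2 : (0 : ℝ) ∈ tsupport (0 : ℝ → ℝ) := by rw [hρ_supp]; simp
      simp at h2
    obtain ⟨c, hc⟩ := hne
    have hU : {x | 0 < ρ x} ∈ 𝓝 c :=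
      (isOpen_lt continuous_const hρ_cont).mem_nhds (lt_of_le_of_ne (hρ_nonneg c) hc.symm)
    have hinf : {x | 0 < ρ x}.Infinite := infinite_of_mem_nhds c hU
    by_contra! h
    exact hp0 (Polynomial.eq_zero_of_infinite_isRoot p (hinf.mono fun x hx => h x hx))
  obtain ⟨c, hc, hpc⟩ := hpos
  have hcI : c ∈ Set.Icc (-1 : ℝ) 1 := by
    rw [← hρ_supp]
    exact subset_tsupport _ (Function.mem_support.2 hc.ne')
  have := intervalIntegral.integral_pos (a := (-1 : ℝ)) (b := 1) (by norm_num)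
    (f := fun t => ρ t * p.eval t ^ 2)
    (hρ_cont.mul (p.continuous.pow 2)).continuousOn
    (fun x _ => mul_nonneg (hρ_nonneg x) (sq_nonneg _))
    ⟨c, hcI, mul_pos hc (by positivity)⟩
  linarith

/-- Uniform stability of the linear systems of the projection coefficients. -/
theorem exists_stability_bound {N d : ℕ} (hd : 1 ≤ d) (hNd : N ≤ d) {ρ : ℝ → ℝ}
    (hρ_cont : Continuous ρ) (hρ_nonneg : ∀ t, 0 ≤ ρ t) (hρ_supp : tsupport ρ = Set.Icc (-1) 1)
    {f : Fin N → ℝ → ℝ} (hf : ∀ j, ContDiff ℝ (⊤ : ℕ∞) (f j))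
    (hf0 : ∀ j : Fin N, ∀ k < 2 * (j : ℕ), iteratedDeriv k (f j) 0 = 0)
    (hf1 : ∀ j : Fin N, iteratedDeriv (2 * (j : ℕ)) (f j) 0 = 1) {η₀ : ℝ}
    (hdet : ∀ η, 0 < η → η ≤ η₀ → (Matrix.of fun k j : Fin N => ∫ t in (-1 : ℝ)..1, ρ t *
      (pseudoPoly d η (f k)).eval (η * t) * f j (η * |t|)).det ≠ 0) :
    ∃ C, 0 ≤ C ∧ ∀ η, 0 < η → η ≤ η₀ → ∀ (γ : Fin N → ℂ) (R : ℝ → ℂ) (δ : ℝ),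
      (∀ t ∈ Set.Icc (-1 : ℝ) 1, ‖R t‖ ≤ δ) →
      (∀ k, ∑ j, γ j * ((∫ t in (-1 : ℝ)..1, ρ t * (pseudoPoly d η (f k)).eval (η * t) *
          f j (η * |t|) : ℝ) : ℂ) =
        ∫ t in (-1 : ℝ)..1, ((ρ t * (pseudoPoly d η (f k)).eval (η * t) : ℝ) : ℂ) * R t) →
      ∀ j, ‖γ j‖ * η ^ (2 * (j : ℕ)) ≤ C * δ := by
  have he : ∀ j : Fin N, Even (2 * (j : ℕ)) := fun j => even_two_mul _
  have hsc := fun (j : Fin N) l => continuous_scaledDeriv (hf j) (hf0 j) (hf1 j) l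
  have hQc : ∀ k : Fin N, Continuous fun x : ℝ × ℝ => scaledPoly d (f k) (2 * k) x.1 x.2 := by
    intro k
    simp only [scaledPoly]
    refine continuous_finsetSum _ fun l _ => ?_
    exact ((hsc k l).comp continuous_fst).mul ((evenBasis d l).continuous.comp continuous_snd)
  have hFc : ∀ j : Fin N, Continuous fun x : ℝ × ℝ => scaledFun (f j) (2 * j) x.1 x.2 := by
    intro j
    simp only [scaledFun]
    exact (continuous_snd.pow _).mul ((hsc j 0).comp (continuous_fst.mul continuous_snd))
  set G : ℝ → Matrix (Fin N) (Fin N) ℝ := fun η => Matrix.of fun k j : Fin N =>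
    ∫ t in (-1 : ℝ)..1, ρ t * scaledPoly d (f k) (2 * k) η t * scaledFun (f j) (2 * j) η t with hG
  have hGc : Continuous G := by
    refine continuous_matrix fun k j => ?_
    simp only [hG, Matrix.of_apply]
    refine intervalIntegral.continuous_parametric_intervalIntegral_of_continuous' ?_ _ _
    exact ((hρ_cont.comp continuous_snd).mul (hQc k)).mul (hFc j)
  have hGe : ∀ η, 0 < η → ∀ k j, ∫ t in (-1 : ℝ)..1, ρ t * (pseudoPoly d η (f k)).eval (η * t) *
      f j (η * |t|) = η ^ (2 * (k : ℕ)) * (G η k j * η ^ (2 * (j : ℕ))) := by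
    intro η hη k j
    simp only [hG, Matrix.of_apply]
    rw [← intervalIntegral.integral_mul_const, ← intervalIntegral.integral_const_mul]
    congr 1
    ext t
    rw [← scaledPoly_mul hd (f k) (2 * k) hη, ← scaledFun_mul (he j) (hf0 j) (hf1 j) hη]
    ring
  have hGdet : ∀ η ∈ Set.Icc 0 η₀, (G η).det ≠ 0 := by
    intro η hη
    rcases hη.1.eq_or_lt with rfl | h
    · have := det_moment_ne_zero (N := N) hρ_cont hρ_nonneg hρ_supp
      convert this using 5 with k j
      congr 1
      ext t
      rw [scaledPoly_zero hd _ (he k) (by have := k.2; omega), scaledFun_zero]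
    · intro h0
      apply hdet η h hη.2
      have : (Matrix.of fun k j : Fin N => ∫ t in (-1 : ℝ)..1, ρ t *
          (pseudoPoly d η (f k)).eval (η * t) * f j (η * |t|)) =
          Matrix.diagonal (fun k : Fin N => η ^ (2 * (k : ℕ))) * G η *
            Matrix.diagonal (fun k : Fin N => η ^ (2 * (k : ℕ))) := by
        ext k j
        rw [Matrix.mul_diagonal, Matrix.diagonal_mul, Matrix.of_apply, hGe η h]
        ring
      rw [this, Matrix.det_mul, Matrix.det_mul, h0]
      simp
  have hinv : ContinuousOn (fun η => (G η)⁻¹) (Set.Icc 0 η₀) := by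
    have : ∀ η, (G η)⁻¹ = (G η).det⁻¹ • (G η).adjugate := fun η => by
      rw [Matrix.inv_def, Ring.inverse_eq_inv']
    simp_rw [this]
    exact (hGc.matrix_det.continuousOn.inv₀ hGdet).smul hGc.matrix_adjugate.continuousOn
  have hinvb : ∃ L, 0 ≤ L ∧ ∀ η ∈ Set.Icc 0 η₀, ∀ j k, |(G η)⁻¹ j k| ≤ L := by
    have : ∀ j k, ∃ L, 0 ≤ L ∧ ∀ η ∈ Set.Icc 0 η₀, |(G η)⁻¹ j k| ≤ L := fun j k => by
      have hc : ContinuousOn (fun η => (G η)⁻¹ j k) (Set.Icc 0 η₀) := fun η hη =>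
        ((continuous_apply_apply j k).tendsto _).comp (hinv η hη)
      obtain ⟨L, hL⟩ := isCompact_Icc.exists_bound_of_continuousOn hc
      exact ⟨max L 0, le_max_right _ _, fun η hη => (hL η hη).trans (le_max_left _ _)⟩
    choose L hL0 hL using this
    refine ⟨∑ j, ∑ k, L j k, Finset.sum_nonneg fun j _ => Finset.sum_nonneg fun k _ => hL0 j k,
      fun η hη j k => (hL j k η hη).trans ?_⟩
    exact (Finset.single_le_sum (fun k _ => hL0 j k) (Finset.mem_univ k)).trans
      (Finset.single_le_sum (f := fun j => ∑ k, L j k)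
        (fun j _ => Finset.sum_nonneg fun k _ => hL0 j k) (Finset.mem_univ j))
  obtain ⟨L, hL0, hL⟩ := hinvb
  have hQb : ∃ M, 0 ≤ M ∧ ∀ k, ∀ η ∈ Set.Icc 0 η₀, ∀ t ∈ Set.Icc (-1 : ℝ) 1,
      |ρ t * scaledPoly d (f k) (2 * k) η t| ≤ M := by
    have : ∀ k : Fin N, ∃ M, 0 ≤ M ∧ ∀ η ∈ Set.Icc 0 η₀, ∀ t ∈ Set.Icc (-1 : ℝ) 1,
        |ρ t * scaledPoly d (f k) (2 * k) η t| ≤ M := fun k => by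
      obtain ⟨M, hM⟩ := (isCompact_Icc.prod isCompact_Icc).exists_bound_of_continuousOn
        (s := Set.Icc 0 η₀ ×ˢ Set.Icc (-1 : ℝ) 1)
        ((hρ_cont.comp continuous_snd).mul (hQc k)).continuousOn
      exact ⟨max M 0, le_max_right _ _, fun η hη t ht =>
        (hM (η, t) ⟨hη, ht⟩).trans (le_max_left _ _)⟩
    choose M hM0 hM using this
    refine ⟨∑ k, M k, Finset.sum_nonneg fun k _ => hM0 k, fun k η hη t ht =>
      (hM k η hη t ht).trans (Finset.single_le_sum (fun k _ => hM0 k) (Finset.mem_univ k))⟩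
  obtain ⟨M, hM0, hM⟩ := hQb
  refine ⟨N * (L * (2 * M)), by positivity, fun η hη hηη₀ γ R δ hR hsys j => ?_⟩
  have hδ : 0 ≤ δ := (norm_nonneg _).trans (hR 0 (by simp))
  have hηI : η ∈ Set.Icc 0 η₀ := ⟨hη.le, hηη₀⟩
  set w : Fin N → ℂ := fun k =>
    ∫ t in (-1 : ℝ)..1, ((ρ t * scaledPoly d (f k) (2 * k) η t : ℝ) : ℂ) * R t with hw
  have hwb : ∀ k, ‖w k‖ ≤ 2 * M * δ := by
    intro k
    have := intervalIntegral.norm_integral_le_of_norm_le_const (a := (-1 : ℝ)) (b := 1)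
      (C := M * δ) (f := fun t => ((ρ t * scaledPoly d (f k) (2 * k) η t : ℝ) : ℂ) * R t)
      (fun t ht => by
        rw [Set.uIoc_of_le (by norm_num)] at ht
        have ht' : t ∈ Set.Icc (-1 : ℝ) 1 := ⟨ht.1.le, ht.2⟩
        rw [norm_mul, Complex.norm_real]
        exact mul_le_mul (hM k η hηI t ht') (hR t ht') (norm_nonneg _) hM0)
    refine this.trans (le_of_eq ?_)
    norm_num
    ring
  have hsys' : ∀ k, ∑ i, (G η k i : ℂ) * (γ i * (η : ℂ) ^ (2 * (i : ℕ))) = w k := by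
    intro k
    have h1 := hsys k
    have hη' : (η : ℂ) ^ (2 * (k : ℕ)) ≠ 0 := pow_ne_zero _ (by exact_mod_cast hη.ne')
    have h2 : ∫ t in (-1 : ℝ)..1, ((ρ t * (pseudoPoly d η (f k)).eval (η * t) : ℝ) : ℂ) * R t
        = (η : ℂ) ^ (2 * (k : ℕ)) * w k := by
      rw [hw, ← intervalIntegral.integral_const_mul]
      congr 1
      ext t
      rw [← scaledPoly_mul hd (f k) (2 * k) hη]
      push_cast
      ring
    rw [h2] at h1
    apply mul_left_cancel₀ hη'
    rw [← h1, Finset.mul_sum]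
    refine Finset.sum_congr rfl fun i _ => ?_
    rw [hGe η hη]
    push_cast
    ring
  have hsol : γ j * (η : ℂ) ^ (2 * (j : ℕ)) = ∑ k, ((G η)⁻¹ j k : ℂ) * w k := by
    simp_rw [← hsys', Finset.mul_sum]
    rw [Finset.sum_comm]
    have h1 : (G η)⁻¹ * G η = 1 := Matrix.nonsing_inv_mul _ (isUnit_iff_ne_zero.2 (hGdet η hηI))
    have h2 : ∀ i, ∑ k, ((G η)⁻¹ j k : ℂ) * ((G η k i : ℂ) * (γ i * (η : ℂ) ^ (2 * (i : ℕ)))) =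
        (if j = i then 1 else 0) * (γ i * (η : ℂ) ^ (2 * (i : ℕ))) := by
      intro i
      have h3 := congrFun (congrFun h1 j) i
      rw [Matrix.mul_apply, Matrix.one_apply] at h3
      simp_rw [← mul_assoc]
      rw [← Finset.sum_mul, ← Finset.sum_mul]
      have h4 : ∑ k, ((G η)⁻¹ j k : ℂ) * (G η k i : ℂ) = if j = i then 1 else 0 := by
        have := congrArg (fun x : ℝ => (x : ℂ)) h3
        push_cast at this
        rw [this]
        split_ifs <;> simp
      rw [h4]
    simp_rw [h2]
    simp
  have h1 : ‖γ j‖ * η ^ (2 * (j : ℕ)) = ‖γ j * (η : ℂ) ^ (2 * (j : ℕ))‖ := by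
    rw [norm_mul, norm_pow, Complex.norm_real, Real.norm_of_nonneg hη.le]
  rw [h1, hsol]
  refine (norm_sum_le _ _).trans ?_
  have h2 : ∀ k ∈ Finset.univ, ‖((G η)⁻¹ j k : ℂ) * w k‖ ≤ L * (2 * M * δ) := by
    intro k _
    rw [norm_mul, Complex.norm_real]
    exact mul_le_mul (hL η hηI j k) (hwb k) (norm_nonneg _) hL0
  refine (Finset.sum_le_card_nsmul _ _ _ h2).trans (le_of_eq ?_)
  rw [Finset.card_univ, Fintype.card_fin, nsmul_eq_mul]
  ring


/-! ### Stability of the projection coefficients for cusp functions -/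

theorem iteratedDeriv_cuspSol_add_two (Z ε : ℝ) (k : ℕ) (x : ℝ) :
    iteratedDeriv (k + 2) (cuspSol Z ε) x = -ε * iteratedDeriv k (cuspSol Z ε) x := by
  rw [iteratedDeriv_succ', iteratedDeriv_succ', deriv_deriv_cuspSol, iteratedDeriv_const_mul_field]

theorem iteratedDeriv_cuspSol_zero (Z ε : ℝ) (l : ℕ) :
    iteratedDeriv (2 * l) (cuspSol Z ε) 0 = (-ε) ^ l ∧
      iteratedDeriv (2 * l + 1) (cuspSol Z ε) 0 = -(Z / 2) * (-ε) ^ l := by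
  induction l with
  | zero =>
    refine ⟨by simp [cuspSol_zero], ?_⟩
    rw [mul_zero, zero_add, iteratedDeriv_one, (hasDerivAt_cuspSol Z ε 0).deriv, cosSol_zero,
      sinSol_zero]
    simp
  | succ l ih =>
    rw [show 2 * (l + 1) = 2 * l + 2 by ring, show 2 * l + 2 + 1 = (2 * l + 1) + 2 by ring,
      iteratedDeriv_cuspSol_add_two, iteratedDeriv_cuspSol_add_two, ih.1, ih.2]
    constructor <;> ring

theorem pseudoPoly_congr {d : ℕ} {η : ℝ} (hd : 1 ≤ d) (hη : 0 < η) {f g : ℝ → ℝ}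
    (h : ∀ k < d, iteratedDeriv k f η = iteratedDeriv k g η) :
    pseudoPoly d η f = pseudoPoly d η g := by
  have hg := isPseudoPoly_pseudoPoly hd hη g
  exact IsPseudoPoly.unique hd hη ⟨hg.even, hg.natDegree_le, fun k hk => by
    rw [hg.deriv_eq k hk, h k hk]⟩

theorem iteratedDeriv_linear_combination {ι : Type*} (s : Finset ι) (a : ι → ℝ) {U : ι → ℝ → ℝ}
    (hU : ∀ i, ContDiff ℝ (⊤ : ℕ∞) (U i)) (k : ℕ) (x : ℝ) :
    iteratedDeriv k (fun y => ∑ i ∈ s, a i * U i y) x = ∑ i ∈ s, a i * iteratedDeriv k (U i) x := by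
  rw [iteratedDeriv_fun_sum fun i _ =>
    (contDiff_const.mul ((hU i).of_le (by exact_mod_cast le_top))).contDiffAt]
  exact Finset.sum_congr rfl fun i _ => by rw [iteratedDeriv_const_mul_field]

theorem pseudoPoly_linear_combination {ι : Type*} (s : Finset ι) {d : ℕ} {η : ℝ} (hd : 1 ≤ d)
    (hη : 0 < η) (a : ι → ℝ) {U : ι → ℝ → ℝ} (hU : ∀ i, ContDiff ℝ (⊤ : ℕ∞) (U i)) :
    pseudoPoly d η (fun y => ∑ i ∈ s, a i * U i y) = ∑ i ∈ s, C (a i) * pseudoPoly d η (U i) := by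
  have hq := fun i => isPseudoPoly_pseudoPoly hd hη (U i)
  refine IsPseudoPoly.unique hd hη ⟨fun x => ?_, ?_, fun k hk => ?_⟩
  · simp [eval_finsetSum, (hq _).even]
  · exact natDegree_sum_le_of_forall_le _ _ fun i _ =>
      (natDegree_C_mul_le _ _).trans (hq i).natDegree_le
  · rw [iterate_derivative_sum, eval_finsetSum, iteratedDeriv_linear_combination s a hU]
    refine Finset.sum_congr rfl fun i _ => ?_
    rw [iterate_derivative_C_mul, eval_mul, eval_C, (hq i).deriv_eq k hk]

theorem exists_cusp_stability_bound {N d : ℕ} (hN : 1 ≤ N) (hNd : N ≤ d) {ρ : ℝ → ℝ}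
    (hρ_cont : Continuous ρ) (hρ_nonneg : ∀ t, 0 ≤ ρ t) (hρ_supp : tsupport ρ = Set.Icc (-1) 1)
    (Z E : ℝ) {A ε : Fin N → ℝ} (hA : ∀ i, A i ≠ 0) (hε : Function.Injective ε) {η₀ : ℝ}
    (hη₀ : η₀ ≤ 1)
    (hdet : ∀ η, 0 < η → η ≤ η₀ → (Matrix.of fun k i : Fin N => ∫ t in (-1 : ℝ)..1, ρ t *
      (pseudoPoly d η (fun s => A k * cuspSol Z (ε k) s)).eval (η * t) *
        (A i * cuspSol Z (ε i) (η * |t|))).det ≠ 0) :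
    ∃ C, 0 ≤ C ∧ ∀ η, 0 < η → η ≤ η₀ → ∀ (α : Fin N → ℂ) (z : ℂ),
      (∀ k, ∑ i, α i * ((∫ t in (-1 : ℝ)..1, ρ t *
          (pseudoPoly d η (fun s => A k * cuspSol Z (ε k) s)).eval (η * t) *
          (A i * cuspSol Z (ε i) (η * |t|)) : ℝ) : ℂ) =
        z * ((∫ t in (-1 : ℝ)..1, ρ t *
          (pseudoPoly d η (fun s => A k * cuspSol Z (ε k) s)).eval (η * t) *
          cuspSol Z E (η * |t|) : ℝ) : ℂ)) →
      (∀ i, ‖α i‖ ≤ C * ‖z‖) ∧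
      ∀ j < N, ‖z * (E : ℂ) ^ j - ∑ i, α i * (A i * (ε i : ℂ) ^ j)‖ * η ^ (2 * j) ≤
        C * ‖z‖ * η ^ (2 * N) := by
  have hd : 1 ≤ d := hN.trans hNd
  set U : Fin N → ℝ → ℝ := fun i s => A i * cuspSol Z (ε i) s with hU
  have hUs : ∀ i, ContDiff ℝ (⊤ : ℕ∞) (U i) := fun i =>
    contDiff_const.mul (contDiff_cuspSol Z (ε i))
  set K : Matrix (Fin N) (Fin N) ℝ :=
    Matrix.diagonal A * Matrix.vandermonde (fun i => -ε i) with hK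
  have hKe : ∀ i j, K i j = A i * (-ε i) ^ (j : ℕ) := fun i j => by
    rw [hK, Matrix.diagonal_mul, Matrix.vandermonde_apply]
  have hKdet : K.det ≠ 0 := by
    rw [hK, Matrix.det_mul, Matrix.det_diagonal]
    refine mul_ne_zero (Finset.prod_ne_zero_iff.2 fun i _ => hA i) ?_
    exact Matrix.det_vandermonde_ne_zero_iff.2 (neg_injective.comp hε)
  set P := K⁻¹ with hP
  have hPK : P * K = 1 := Matrix.nonsing_inv_mul _ (isUnit_iff_ne_zero.2 hKdet)
  have hKP : K * P = 1 := Matrix.mul_nonsing_inv _ (isUnit_iff_ne_zero.2 hKdet)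
  have hPdet : P.det ≠ 0 := by
    intro h
    have := congrArg Matrix.det hPK
    rw [Matrix.det_mul, h, zero_mul, Matrix.det_one] at this
    exact zero_ne_one this
  set f : Fin N → ℝ → ℝ := fun j s => ∑ i, P j i * U i s with hf
  have hfs : ∀ j, ContDiff ℝ (⊤ : ℕ∞) (f j) := fun j =>
    ContDiff.sum fun i _ => contDiff_const.mul (hUs i)
  have hfU : ∀ i s, U i s = ∑ j, K i j * f j s := by
    intro i s
    simp only [hf, Finset.mul_sum]
    rw [Finset.sum_comm]
    simp_rw [← mul_assoc]
    simp_rw [← Finset.sum_mul, ← Matrix.mul_apply, hKP, Matrix.one_apply]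
    simp
  have hfd : ∀ (j l : Fin N), iteratedDeriv (2 * (l : ℕ)) (f j) 0 = (if j = l then 1 else 0) ∧
      iteratedDeriv (2 * (l : ℕ) + 1) (f j) 0 = -(Z / 2) * (if j = l then 1 else 0) := by
    intro j l
    have h1 : ∑ i, P j i * K i l = if j = l then 1 else 0 := by
      rw [← Matrix.mul_apply, hPK, Matrix.one_apply]
    have h2 : ∀ k x i, iteratedDeriv k (U i) x = A i * iteratedDeriv k (cuspSol Z (ε i)) x :=
      fun k x i => by simp only [hU]; rw [iteratedDeriv_const_mul_field]
    simp only [hf]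
    rw [iteratedDeriv_linear_combination _ _ hUs, iteratedDeriv_linear_combination _ _ hUs, ← h1,
      Finset.mul_sum]
    constructor
    · refine Finset.sum_congr rfl fun i _ => ?_
      rw [h2, (iteratedDeriv_cuspSol_zero Z (ε i) l).1, hKe]
    · refine Finset.sum_congr rfl fun i _ => ?_
      rw [h2, (iteratedDeriv_cuspSol_zero Z (ε i) l).2, hKe]
      ring
  have hf0 : ∀ j : Fin N, ∀ k < 2 * (j : ℕ), iteratedDeriv k (f j) 0 = 0 := by
    intro j k hk
    have hlN : k / 2 < N := by have := j.2; omega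
    have hne : j ≠ ⟨k / 2, hlN⟩ := by
      rw [Ne, Fin.ext_iff]
      simp only
      omega
    have h := hfd j ⟨k / 2, hlN⟩
    rw [if_neg hne] at h
    simp only [mul_zero] at h
    rcases Nat.mod_two_eq_zero_or_one k with hm | hm
    · rw [show k = 2 * (k / 2) by omega]; exact h.1
    · rw [show k = 2 * (k / 2) + 1 by omega]; exact h.2
  have hf1 : ∀ j : Fin N, iteratedDeriv (2 * (j : ℕ)) (f j) 0 = 1 := fun j => by
    rw [(hfd j j).1, if_pos rfl]
  -- the residual
  set r : ℝ → ℝ := fun s => cuspSol Z E s - ∑ j : Fin N, (-E) ^ (j : ℕ) * f j s with hr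
  have hrs : ContDiff ℝ (⊤ : ℕ∞) r :=
    (contDiff_cuspSol Z E).sub (ContDiff.sum fun j _ => contDiff_const.mul (hfs j))
  have hrd : ∀ k < 2 * N, iteratedDeriv k r 0 = 0 := by
    intro k hk
    have hlN : k / 2 < N := by omega
    simp only [hr]
    rw [iteratedDeriv_fun_sub
      (((contDiff_cuspSol Z E).of_le (by exact_mod_cast le_top)).contDiffAt)
      ((ContDiff.sum fun j _ => contDiff_const.mul
        ((hfs j).of_le (by exact_mod_cast le_top))).contDiffAt),
      iteratedDeriv_linear_combination _ _ hfs]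
    rcases Nat.mod_two_eq_zero_or_one k with hm | hm
    · rw [show k = 2 * (k / 2) by omega, (iteratedDeriv_cuspSol_zero Z E (k / 2)).1]
      have : ∀ j : Fin N, iteratedDeriv (2 * (k / 2)) (f j) 0 =
          if j = ⟨k / 2, hlN⟩ then 1 else 0 := fun j => (hfd j ⟨k / 2, hlN⟩).1
      simp [this]
    · rw [show k = 2 * (k / 2) + 1 by omega, (iteratedDeriv_cuspSol_zero Z E (k / 2)).2]
      have : ∀ j : Fin N, iteratedDeriv (2 * (k / 2) + 1) (f j) 0 =
          -(Z / 2) * if j = ⟨k / 2, hlN⟩ then 1 else 0 := fun j => (hfd j ⟨k / 2, hlN⟩).2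
      simp only [this]
      simp
      ring
  obtain ⟨M, hM0, hM⟩ := exists_bound_of_derivs (D := fun k => iteratedDeriv k r)
    (hasDerivAt_iteratedDeriv hrs) hrd
  simp only [iteratedDeriv_zero] at hM
  have hUc : ∀ i, Continuous (U i) := fun i => (hUs i).continuous
  have hfc : ∀ i, Continuous (f i) := fun i => (hfs i).continuous
  have hqf : ∀ η, 0 < η → ∀ k t, (pseudoPoly d η (f k)).eval t =
      ∑ i, P k i * (pseudoPoly d η (U i)).eval t := by
    intro η hη k t
    rw [pseudoPoly_linear_combination Finset.univ hd hη (P k) hUs, eval_finsetSum]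
    simp
  -- the Gram matrix in the new basis
  have hmat : ∀ η, 0 < η → (Matrix.of fun k j : Fin N => ∫ t in (-1 : ℝ)..1, ρ t *
      (pseudoPoly d η (f k)).eval (η * t) * f j (η * |t|)) = P * (Matrix.of fun k i : Fin N =>
      ∫ t in (-1 : ℝ)..1, ρ t * (pseudoPoly d η (U k)).eval (η * t) * U i (η * |t|)) * P.transpose := by
    intro η hη
    ext k j
    simp only [Matrix.mul_apply, Matrix.of_apply, Matrix.transpose_apply]
    have hc : ∀ i l, Continuous fun t =>
        ρ t * (pseudoPoly d η (U l)).eval (η * t) * U i (η * |t|) := fun i l => by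
      have := hUc i
      fun_prop
    simp_rw [← intervalIntegral.integral_const_mul]
    rw [← Finset.sum_congr rfl fun i _ => congrArg (· * P j i)
      (intervalIntegral.integral_finsetSum fun l _ =>
        ((hc i l).const_mul (P k l)).intervalIntegrable _ _)]
    simp_rw [← intervalIntegral.integral_mul_const]
    rw [← intervalIntegral.integral_finsetSum fun i _ =>
      ((continuous_finsetSum _ fun l _ => (hc i l).const_mul (P k l)).mul_const _).intervalIntegrable _ _]
    congr 1
    ext t
    rw [hqf η hη]
    simp only [hf]
    rw [mul_assoc, Finset.sum_mul_sum, Finset.sum_comm, Finset.mul_sum]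
    refine Finset.sum_congr rfl fun i _ => ?_
    rw [Finset.mul_sum, Finset.sum_mul]
    exact Finset.sum_congr rfl fun l _ => by ring
  obtain ⟨C₁, hC₁0, hC₁⟩ := exists_stability_bound hd hNd hρ_cont hρ_nonneg hρ_supp hfs hf0 hf1
    (η₀ := η₀) (fun η hη hηη₀ => by
      rw [hmat η hη, Matrix.det_mul, Matrix.det_mul, Matrix.det_transpose]
      exact mul_ne_zero (mul_ne_zero hPdet (hdet η hη hηη₀)) hPdet)
  set S : ℝ := ∑ i, ∑ j : Fin N, |P j i| * (C₁ * M + |E| ^ (j : ℕ)) with hS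
  have hS0 : 0 ≤ S := Finset.sum_nonneg fun i _ => Finset.sum_nonneg fun j _ => by positivity
  refine ⟨C₁ * M + S, by positivity, fun η hη hηη₀ α z hsys => ?_⟩
  set γ : Fin N → ℂ := fun j => ∑ i, α i * (K i j : ℂ) - z * (-E : ℂ) ^ (j : ℕ) with hγ
  have hη1 : η ≤ 1 := hηη₀.trans hη₀
  have hbase := hC₁ η hη hηη₀ γ (fun t => z * (r (η * |t|) : ℂ)) (‖z‖ * (M * η ^ (2 * N)))
    (fun t ht => by
      rw [norm_mul, Complex.norm_real, Real.norm_eq_abs]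
      have ht1 : |t| ≤ 1 := abs_le.2 ht
      have h1 : η * |t| ≤ η := mul_le_of_le_one_right hη.le ht1
      have h0 : 0 ≤ η * |t| := by positivity
      refine mul_le_mul_of_nonneg_left ((hM _ ⟨h0, h1.trans hη1⟩).trans ?_) (norm_nonneg _)
      exact mul_le_mul_of_nonneg_left (pow_le_pow_left₀ h0 h1 _) hM0)
    (fun k => by
      have hcr : Continuous r := hrs.continuous
      have e1 : ∫ t in (-1 : ℝ)..1, ((ρ t * (pseudoPoly d η (f k)).eval (η * t) : ℝ) : ℂ) *
          (z * (r (η * |t|) : ℂ)) = z * ((∫ t in (-1 : ℝ)..1,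
            ρ t * (pseudoPoly d η (f k)).eval (η * t) * r (η * |t|) : ℝ) : ℂ) := by
        rw [← intervalIntegral.integral_ofReal, ← intervalIntegral.integral_const_mul]
        congr 1
        ext t
        push_cast
        ring
      -- the system tested against the pseudo polynomials of the new basis
      have hcU : ∀ (l : Fin N) (F : ℝ → ℝ), Continuous F → Continuous fun t =>
          ρ t * (pseudoPoly d η (U l)).eval (η * t) * F (η * |t|) := fun l F hF => by fun_prop
      have hlin : ∀ F : ℝ → ℝ, Continuous F →
          ∫ t in (-1 : ℝ)..1, ρ t * (pseudoPoly d η (f k)).eval (η * t) * F (η * |t|) =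
          ∑ l, P k l * ∫ t in (-1 : ℝ)..1,
            ρ t * (pseudoPoly d η (U l)).eval (η * t) * F (η * |t|) := by
        intro F hF
        simp_rw [← intervalIntegral.integral_const_mul]
        rw [← intervalIntegral.integral_finsetSum fun l _ =>
          ((hcU l F hF).const_mul (P k l)).intervalIntegrable _ _]
        congr 1
        ext t
        rw [hqf η hη, Finset.mul_sum, Finset.sum_mul]
        exact Finset.sum_congr rfl fun l _ => by ring
      have hsys' : ∑ i, α i * ((∫ t in (-1 : ℝ)..1, ρ t *
          (pseudoPoly d η (f k)).eval (η * t) * U i (η * |t|) : ℝ) : ℂ) =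
          z * ((∫ t in (-1 : ℝ)..1, ρ t * (pseudoPoly d η (f k)).eval (η * t) *
            cuspSol Z E (η * |t|) : ℝ) : ℂ) := by
        rw [hlin _ (contDiff_cuspSol Z E).continuous]
        simp_rw [fun i => hlin _ (hUc i)]
        push_cast
        simp_rw [Finset.mul_sum]
        rw [Finset.sum_comm]
        refine Finset.sum_congr rfl fun l _ => ?_
        have := congrArg (fun w : ℂ => (P k l : ℂ) * w) (hsys l)
        simp only [Finset.mul_sum] at this
        rw [mul_left_comm z, ← this]
        exact Finset.sum_congr rfl fun i _ => by ring
      have hcf : ∀ F : ℝ → ℝ, Continuous F → Continuous fun t =>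
          ρ t * (pseudoPoly d η (f k)).eval (η * t) * F (η * |t|) := fun F hF => by fun_prop
      have hUf : ∀ i, ∫ t in (-1 : ℝ)..1, ρ t * (pseudoPoly d η (f k)).eval (η * t) * U i (η * |t|) =
          ∑ j, K i j * ∫ t in (-1 : ℝ)..1,
            ρ t * (pseudoPoly d η (f k)).eval (η * t) * f j (η * |t|) := by
        intro i
        simp_rw [← intervalIntegral.integral_const_mul]
        rw [← intervalIntegral.integral_finsetSum fun j _ =>
          ((hcf _ (hfc j)).const_mul (K i j)).intervalIntegrable _ _]
        congr 1
        ext t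
        rw [hfU i, Finset.mul_sum]
        exact Finset.sum_congr rfl fun j _ => by ring
      have hrf : ∫ t in (-1 : ℝ)..1, ρ t * (pseudoPoly d η (f k)).eval (η * t) * r (η * |t|) =
          (∫ t in (-1 : ℝ)..1, ρ t * (pseudoPoly d η (f k)).eval (η * t) * cuspSol Z E (η * |t|)) -
          ∑ j : Fin N, (-E) ^ (j : ℕ) * ∫ t in (-1 : ℝ)..1,
            ρ t * (pseudoPoly d η (f k)).eval (η * t) * f j (η * |t|) := by
        simp_rw [← intervalIntegral.integral_const_mul]
        rw [← intervalIntegral.integral_finsetSum fun j _ =>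
          ((hcf _ (hfc j)).const_mul _).intervalIntegrable _ _,
          ← intervalIntegral.integral_sub
            ((hcf _ (contDiff_cuspSol Z E).continuous).intervalIntegrable _ _)
            ((continuous_finsetSum _ fun j _ => (hcf _ (hfc j)).const_mul _).intervalIntegrable _ _)]
        congr 1
        ext t
        simp only [hr]
        rw [mul_sub, Finset.mul_sum]
        congr 1
        exact Finset.sum_congr rfl fun j _ => by ring
      rw [e1, hrf]
      push_cast
      rw [mul_sub, ← hsys']
      simp_rw [hUf]
      simp only [hγ, sub_mul, Finset.sum_sub_distrib]
      push_cast
      congr 1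
      · simp_rw [Finset.sum_mul, Finset.mul_sum]
        rw [Finset.sum_comm]
        exact Finset.sum_congr rfl fun i _ => Finset.sum_congr rfl fun j _ => by ring
      · rw [Finset.mul_sum]
        exact Finset.sum_congr rfl fun j _ => by ring)
  have hγb : ∀ j : Fin N, ‖γ j‖ ≤ C₁ * M * ‖z‖ := by
    intro j
    have h1 := hbase j
    have h2 : η ^ (2 * N) ≤ η ^ (2 * (j : ℕ)) :=
      pow_le_pow_of_le_one hη.le hη1 (by have := j.2; omega)
    have h3 : 0 < η ^ (2 * (j : ℕ)) := by positivity
    refine le_of_mul_le_mul_right (h1.trans ?_) h3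
    calc C₁ * (‖z‖ * (M * η ^ (2 * N))) = C₁ * M * ‖z‖ * η ^ (2 * N) := by ring
      _ ≤ C₁ * M * ‖z‖ * η ^ (2 * (j : ℕ)) := by gcongr
  refine ⟨fun i => ?_, fun j hj => ?_⟩
  · have hα : α i = ∑ j, (P j i : ℂ) * (γ j + z * (-E : ℂ) ^ (j : ℕ)) := by
      simp only [hγ, sub_add_cancel, Finset.mul_sum]
      rw [Finset.sum_comm]
      have : ∀ l, ∑ j, (P j i : ℂ) * (α l * (K l j : ℂ)) = (if l = i then 1 else 0) * α l := by
        intro l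
        have h1 := congrArg (fun x : ℝ => (x : ℂ)) (congrFun (congrFun hKP l) i)
        rw [Matrix.mul_apply, Matrix.one_apply] at h1
        push_cast at h1
        have h2 : ∑ j, (P j i : ℂ) * (α l * (K l j : ℂ)) =
            (∑ j, (K l j : ℂ) * (P j i : ℂ)) * α l := by
          rw [Finset.sum_mul]
          exact Finset.sum_congr rfl fun j _ => by ring
        rw [h2, h1]
        split_ifs <;> simp
      simp_rw [this]
      simp
    have h1 : ‖α i‖ ≤ (∑ j : Fin N, |P j i| * (C₁ * M + |E| ^ (j : ℕ))) * ‖z‖ := by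
      rw [hα, Finset.sum_mul]
      refine (norm_sum_le _ _).trans (Finset.sum_le_sum fun j _ => ?_)
      rw [norm_mul, Complex.norm_real, Real.norm_eq_abs, mul_assoc]
      refine mul_le_mul_of_nonneg_left ((norm_add_le _ _).trans ?_) (abs_nonneg _)
      rw [norm_mul, norm_pow, norm_neg, Complex.norm_real, Real.norm_eq_abs, add_mul]
      exact add_le_add (hγb j) (le_of_eq (mul_comm _ _))
    refine h1.trans (mul_le_mul_of_nonneg_right ?_ (norm_nonneg _))
    have h2 : ∑ j : Fin N, |P j i| * (C₁ * M + |E| ^ (j : ℕ)) ≤ S :=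
      Finset.single_le_sum (f := fun i => ∑ j : Fin N, |P j i| * (C₁ * M + |E| ^ (j : ℕ)))
        (fun i _ => Finset.sum_nonneg fun j _ => by positivity) (Finset.mem_univ i)
    have h3 : 0 ≤ C₁ * M := by positivity
    linarith
  · have h1 : z * (E : ℂ) ^ j - ∑ i, α i * (A i * (ε i : ℂ) ^ j) = -((-1) ^ j * γ ⟨j, hj⟩) := by
      simp only [hγ, hKe, mul_sub, Finset.mul_sum]
      have h2 : (-1 : ℂ) ^ j * (-1) ^ j = 1 := by rw [← mul_pow]; simp
      have h3 : ∀ x : ℝ, (-(x : ℂ)) ^ j = (-1) ^ j * (x : ℂ) ^ j := fun x => neg_pow _ _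
      push_cast
      simp_rw [h3]
      rw [neg_sub]
      congr 1
      · linear_combination (-(z * (E : ℂ) ^ j)) * h2
      · refine Finset.sum_congr rfl fun i _ => ?_
        linear_combination (-(α i * (A i * (ε i : ℂ) ^ j))) * h2
    rw [h1, norm_neg, norm_mul, norm_pow, norm_neg, norm_one, one_pow, one_mul]
    have h2 := hbase ⟨j, hj⟩
    simp only at h2
    refine h2.trans ?_
    have h3 : 0 ≤ S * ‖z‖ * η ^ (2 * N) := by positivity
    nlinarith


/-! ### Fourier coefficients of eigenfunctions -/

/-- The `m`-th Fourier mode `x ↦ e^{-2iπmx}`. -/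
def mode (m : ℤ) (x : ℝ) : ℂ := Complex.exp (-(2 * Real.pi * Complex.I * m) * x)

theorem hasDerivAt_mode (m : ℤ) (x : ℝ) :
    HasDerivAt (mode m) (-(2 * Real.pi * Complex.I * m) * mode m x) x := by
  have h1 : HasDerivAt (fun s : ℝ => -(2 * Real.pi * Complex.I * m) * (s : ℂ))
      (-(2 * Real.pi * Complex.I * m)) x := by
    simpa using (Complex.ofRealCLM.hasDerivAt (x := x)).const_mul (-(2 * Real.pi * Complex.I * m))
  exact h1.cexp.congr_deriv (mul_comm _ _)

theorem continuous_mode (m : ℤ) : Continuous (mode m) :=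
  continuous_iff_continuousAt.2 fun x => (hasDerivAt_mode m x).continuousAt

theorem norm_mode (m : ℤ) (x : ℝ) : ‖mode m x‖ = 1 := by
  rw [mode, show -(2 * Real.pi * Complex.I * m) * x = ((-(2 * Real.pi * m) * x : ℝ) : ℂ) * Complex.I
    by push_cast; ring, Complex.norm_exp_ofReal_mul_I]

theorem mode_periodic (m : ℤ) : Function.Periodic (mode m) 1 := by
  intro x
  rw [mode, mode]
  push_cast
  rw [mul_add, Complex.exp_add, mul_one]
  have : Complex.exp (-(2 * Real.pi * Complex.I * m)) = 1 := by
    rw [show -(2 * Real.pi * Complex.I * m) = ((-m : ℤ) : ℂ) * (2 * Real.pi * Complex.I) by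
      push_cast; ring, Complex.exp_int_mul_two_pi_mul_I]
  rw [this, mul_one]

theorem conj_mode (m : ℤ) (x : ℝ) : conj (mode (-m) x) = mode m x := by
  rw [mode, mode, ← Complex.exp_conj]
  congr 1
  simp [Complex.conj_ofNat]

theorem memL2Per_of_continuous {f : ℝ → ℂ} (hf : Continuous f) (hp : Function.Periodic f 1) :
    MemL2Per f := by
  refine ⟨hp, ?_⟩
  obtain ⟨M, hM⟩ := isCompact_Icc.exists_bound_of_continuousOn
    (hf.continuousOn (s := Set.Icc (0 : ℝ) 1))
  refine MemLp.of_bound hf.aestronglyMeasurable M ?_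
  rw [ae_restrict_iff' measurableSet_Ioc]
  exact Filter.Eventually.of_forall fun x hx => hM x ⟨hx.1.le, hx.2⟩

theorem IsDiracEigenfunction.fourier_eq {n : ℕ} {Z pos : Fin n → ℝ} {E : ℝ} {u : ℝ → ℂ}
    (h : IsDiracEigenfunction Z pos E u) (m : ℤ) :
    ((2 * Real.pi * m) ^ 2 : ℂ) * ∫ x in (0 : ℝ)..1, u x * mode m x =
      ∑ i, (Z i : ℂ) * u (pos i) * mode m (pos i) + E * ∫ x in (0 : ℝ)..1, u x * mode m x := by
  obtain ⟨-, g, hug, hw⟩ := h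
  have hu : IsPrimitive u g := hug.isPrimitive
  have hc : Continuous fun x => -(2 * Real.pi * Complex.I * (-m : ℤ)) * mode (-m) x :=
    continuous_const.mul (continuous_mode _)
  have hprim := IsPrimitive.of_hasDerivAt (hasDerivAt_mode (-m)) hc
  have hH : HasH1PerDeriv (mode (-m)) (fun x => -(2 * Real.pi * Complex.I * (-m : ℤ)) * mode (-m) x) :=
    ⟨mode_periodic _, memL2Per_of_continuous hc fun x => by simp only [mode_periodic (-m) x],
      hprim.integral_eq⟩
  have weak := hw _ _ hH
  simp only [map_mul, conj_mode] at weak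
  have e : conj (-(2 * Real.pi * Complex.I * ((-m : ℤ) : ℂ))) = -(2 * Real.pi * Complex.I * m) := by
    simp [Complex.conj_ofNat]
  simp only [e] at weak
  have hprim2 := IsPrimitive.of_hasDerivAt (hasDerivAt_mode m)
    (continuous_const.mul (continuous_mode _))
  have ibp := hprim2.integral_mul hu 0 1
  have hp := mode_periodic m 0
  rw [zero_add] at hp
  have hup := hug.periodic 0
  rw [zero_add] at hup
  rw [hp, hup, sub_self, zero_sub] at ibp
  have e1 : ∫ x in (0 : ℝ)..1, g x * (-(2 * Real.pi * Complex.I * m) * mode m x) =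
      -(2 * Real.pi * Complex.I * m) * ∫ x in (0 : ℝ)..1, mode m x * g x := by
    rw [← intervalIntegral.integral_const_mul]
    congr 1; ext x; ring
  have e2 : ∫ x in (0 : ℝ)..1, -(2 * Real.pi * Complex.I * m) * mode m x * u x =
      -(2 * Real.pi * Complex.I * m) * ∫ x in (0 : ℝ)..1, u x * mode m x := by
    rw [← intervalIntegral.integral_const_mul]
    congr 1; ext x; ring
  rw [e1, ibp, e2] at weak
  have e3 : ∑ i, (Z i : ℂ) * u (pos i) * mode m (pos i) =
      ∑ i, (Z i : ℂ) * (u (pos i) * mode m (pos i)) :=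
    Finset.sum_congr rfl fun i _ => by ring
  rw [e3]
  linear_combination weak + (4 * (Real.pi : ℂ) ^ 2 * m ^ 2 * ∫ x in (0 : ℝ)..1, u x * mode m x) *
    Complex.I_sq

/-- Expansion of the Fourier coefficients of an eigenfunction in powers of `m⁻²`. -/
theorem IsDiracEigenfunction.fourier_expansion {n : ℕ} {Z pos : Fin n → ℝ} {E : ℝ} {u : ℝ → ℂ}
    (h : IsDiracEigenfunction Z pos E u) {m : ℤ} (hm : 1 ≤ m) (K : ℕ) :
    ∫ x in (0 : ℝ)..1, u x * mode m x =
      ∑ k ∈ Finset.range K, ((2 * Real.pi * m) ^ 2 : ℂ)⁻¹ ^ (k + 1) * ((E : ℂ) ^ k *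
        ∑ i, (Z i : ℂ) * u (pos i) * mode m (pos i)) +
      ((2 * Real.pi * m) ^ 2 : ℂ)⁻¹ ^ K * (E : ℂ) ^ K * ∫ x in (0 : ℝ)..1, u x * mode m x := by
  have hne : ((2 * Real.pi * m) ^ 2 : ℂ) ≠ 0 := by
    have h1 : (m : ℂ) ≠ 0 := by exact_mod_cast (by omega : m ≠ 0)
    have h2 : (Real.pi : ℂ) ≠ 0 := by exact_mod_cast Real.pi_ne_zero
    exact pow_ne_zero _ (mul_ne_zero (mul_ne_zero two_ne_zero h2) h1)
  induction K with
  | zero => simp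
  | succ K ih =>
    have h1 := h.fourier_eq m
    set w : ℂ := ((2 * Real.pi * m) ^ 2 : ℂ) with hw
    set I := ∫ x in (0 : ℝ)..1, u x * mode m x
    have h2 : I = w⁻¹ * (∑ i, (Z i : ℂ) * u (pos i) * mode m (pos i) + E * I) := by
      rw [← h1, inv_mul_cancel_left₀ hne]
    rw [Finset.sum_range_succ]
    linear_combination ih + (w⁻¹ ^ K * (E : ℂ) ^ K) * h2

theorem norm_inv_two_pi_mul_sq_le {m : ℤ} (hm : 1 ≤ m) :
    ‖((2 * Real.pi * m) ^ 2 : ℂ)⁻¹‖ ≤ 1 / (m : ℝ) ^ 2 := by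
  have hm0 : (0 : ℝ) < m := by exact_mod_cast hm
  rw [show ((2 * Real.pi * m) ^ 2 : ℂ) = (((2 * Real.pi * m) ^ 2 : ℝ) : ℂ) by push_cast; ring,
    norm_inv, Complex.norm_real, Real.norm_of_nonneg (by positivity), one_div]
  apply inv_anti₀ (by positivity)
  apply pow_le_pow_left₀ hm0.le
  nlinarith [Real.pi_gt_three]

theorem IsDiracEigenfunction.exists_fourier_bound {n : ℕ} {Z pos : Fin n → ℝ} {E : ℝ} {u : ℝ → ℂ}
    (h : IsDiracEigenfunction Z pos E u) :
    ∃ C, 0 ≤ C ∧ ∀ m : ℤ, 1 ≤ m → ‖∫ x in (0 : ℝ)..1, u x * mode m x‖ ≤ C / (m : ℝ) ^ 2 := by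
  obtain ⟨M, hM⟩ := isCompact_Icc.exists_bound_of_continuousOn
    (h.continuous.continuousOn (s := Set.Icc (0 : ℝ) 1))
  have hM0 : 0 ≤ M := (norm_nonneg _).trans (hM 0 (by simp))
  refine ⟨∑ i, ‖(Z i : ℂ) * u (pos i)‖ + |E| * M,
    add_nonneg (Finset.sum_nonneg fun i _ => norm_nonneg _) (by positivity), fun m hm => ?_⟩
  have h1 := h.fourier_expansion hm 1
  simp only [Finset.sum_range_one, zero_add, pow_one, pow_zero, one_mul] at h1
  rw [mul_assoc _ (E : ℂ), ← mul_add] at h1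
  rw [h1, norm_mul, div_eq_mul_one_div, mul_comm]
  refine mul_le_mul ?_ (norm_inv_two_pi_mul_sq_le hm) (norm_nonneg _)
    (add_nonneg (Finset.sum_nonneg fun i _ => norm_nonneg _) (by positivity))
  refine (norm_add_le _ _).trans (add_le_add ((norm_sum_le _ _).trans ?_) ?_)
  · refine Finset.sum_le_sum fun i _ => ?_
    rw [norm_mul, norm_mode, mul_one]
  · rw [norm_mul, Complex.norm_real, Real.norm_eq_abs]
    refine mul_le_mul_of_nonneg_left ?_ (abs_nonneg _)
    have := intervalIntegral.norm_integral_le_of_norm_le_const (a := (0 : ℝ)) (b := 1) (C := M)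
      (f := fun x => u x * mode m x) (fun x hx => by
        rw [Set.uIoc_of_le zero_le_one] at hx
        rw [norm_mul, norm_mode, mul_one]
        exact hM x ⟨hx.1.le, hx.2⟩)
    simpa using this

/-! ### Projections -/

theorem rhoScaled_periodic (ρ : ℝ → ℝ) (η : ℝ) : Function.Periodic (rhoScaled ρ η) 1 := by
  intro t
  rw [rhoScaled, rhoScaled, ← (Equiv.addRight (1 : ℤ)).tsum_eq]
  congr 1
  ext k
  simp only [Equiv.coe_addRight, Int.cast_add, Int.cast_one]
  congr 2
  ring

theorem rho_eq_zero {ρ : ℝ → ℝ} (hρ_supp : tsupport ρ = Set.Icc (-1) 1) {t : ℝ} (ht : 1 < |t|) :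
    ρ t = 0 := by
  by_contra h
  have h1 : t ∈ tsupport ρ := subset_tsupport _ (Function.mem_support.2 h)
  rw [hρ_supp, Set.mem_Icc, ← abs_le] at h1
  linarith

theorem rhoScaled_of_abs_le {ρ : ℝ → ℝ} (hρ_supp : tsupport ρ = Set.Icc (-1) 1) {η s : ℝ}
    (hη : 0 < η) (hη2 : η < 1 / 2) (hs : |s| ≤ 1 / 2) : rhoScaled ρ η s = ρ (s / η) := by
  rw [rhoScaled, tsum_eq_single 0]
  · simp
  · intro k hk
    apply rho_eq_zero hρ_supp
    rw [abs_div, abs_of_pos hη, lt_div_iff₀ hη, one_mul]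
    have h1 : (1 : ℝ) ≤ |(k : ℝ)| := by exact_mod_cast Int.one_le_abs hk
    have h2 : |(k : ℝ)| ≤ |s - k| + |s| := by
      have := abs_sub_abs_le_abs_sub (k : ℝ) s
      rw [abs_sub_comm] at this
      linarith
    linarith

theorem preProj_periodic {N d : ℕ} {ρ : ℝ → ℝ} {c η : ℝ} {φ : Fin N → ℝ → ℝ}
    (hφ : ∀ i, Function.Periodic (φ i) 1) (k : Fin N) :
    Function.Periodic (preProj d ρ c η φ k) 1 := by
  intro x
  rw [preProj, preProj, pseudoFun_periodic (hφ k), show x + 1 - c = x - c + 1 by ring,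
    rhoScaled_periodic]

theorem preProj_add {N d : ℕ} {ρ : ℝ → ℝ} (hρ_supp : tsupport ρ = Set.Icc (-1) 1) {c η : ℝ}
    (hη : 0 < η) (hη2 : η < 1 / 2) (φ : Fin N → ℝ → ℝ) (k : Fin N) {s : ℝ} (hs : |s| ≤ 1 / 2) :
    preProj d ρ c η φ k (c + s) =
      ρ (s / η) * (pseudoPoly d η (fun t => φ k (c + t))).eval s := by
  rw [preProj, add_sub_cancel_left, rhoScaled_of_abs_le hρ_supp hη hη2 hs]
  by_cases h : |s| ≤ η
  · rw [pseudoFun_of_le _ hη2 h]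
  · rw [rho_eq_zero hρ_supp, zero_mul, zero_mul]
    rw [abs_div, abs_of_pos hη, lt_div_iff₀ hη, one_mul]
    exact not_le.1 h

theorem preProj_mul_intervalIntegrable {N d : ℕ} {ρ : ℝ → ℝ} (hρ_cont : Continuous ρ)
    (hρ_supp : tsupport ρ = Set.Icc (-1) 1) {c η : ℝ} (hη : 0 < η) (hη2 : η < 1 / 2)
    {φ : Fin N → ℝ → ℝ} (hφ : ∀ i, Function.Periodic (φ i) 1) (k : Fin N) {f : ℝ → ℂ}
    (hf : Function.Periodic f 1) (hfi : ∀ a b, IntervalIntegrable f volume a b) (a b : ℝ) :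
    IntervalIntegrable (fun t => (preProj d ρ c η φ k t : ℂ) * f t) volume a b := by
  have hp : Function.Periodic (fun t => (preProj d ρ c η φ k t : ℂ) * f t) 1 := fun t => by
    simp only [preProj_periodic hφ k t, hf t]
  refine hp.intervalIntegrable one_ne_zero (t := c - 1 / 2) ?_ a b
  have h1 : IntervalIntegrable (fun t => ((ρ ((t - c) / η) *
      (pseudoPoly d η (fun t => φ k (c + t))).eval (t - c) : ℝ) : ℂ) * f t) volume
      (c - 1 / 2) (c - 1 / 2 + 1) := by
    refine (hfi _ _).continuousOn_mul (Continuous.continuousOn ?_)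
    fun_prop
  refine h1.congr fun t ht => ?_
  rw [Set.uIoc_of_le (by linarith)] at ht
  have := preProj_add (d := d) hρ_supp (c := c) hη hη2 φ k (s := t - c)
    (abs_le.2 ⟨by linarith [ht.1], by linarith [ht.2]⟩)
  rw [add_sub_cancel] at this
  simp only [this]

/-- Scalar products with the functions `p_k`, in rescaled variables. -/
theorem integral_preProj_mul {N d : ℕ} {ρ : ℝ → ℝ} (hρ_supp : tsupport ρ = Set.Icc (-1) 1)
    {c η : ℝ} (hη : 0 < η) (hη2 : η < 1 / 2) {φ : Fin N → ℝ → ℝ}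
    (hφ : ∀ i, Function.Periodic (φ i) 1) (k : Fin N) {f : ℝ → ℂ} (hf : Function.Periodic f 1) :
    ∫ t in (0 : ℝ)..1, (preProj d ρ c η φ k t : ℂ) * f t = η * ∫ t in (-1 : ℝ)..1,
      ((ρ t * (pseudoPoly d η (fun t => φ k (c + t))).eval (η * t) : ℝ) : ℂ) * f (c + η * t) := by
  have hp : Function.Periodic (fun t => (preProj d ρ c η φ k t : ℂ) * f t) 1 := fun t => by
    simp only [preProj_periodic hφ k t, hf t]
  set F : ℝ → ℂ := fun s => ((ρ (s / η) *
    (pseudoPoly d η (fun t => φ k (c + t))).eval s : ℝ) : ℂ) * f (c + s) with hF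
  have h1 := intervalIntegral.integral_comp_add_left (a := -(1 / 2)) (b := 1 / 2)
    (fun t => (preProj d ρ c η φ k t : ℂ) * f t) c
  rw [integral_zero_one_eq hp (c + -(1 / 2)), show c + -(1 / 2) + 1 = c + 1 / 2 by ring, ← h1]
  have h2 : ∫ s in (-(1 / 2) : ℝ)..(1 / 2), (preProj d ρ c η φ k (c + s) : ℂ) * f (c + s) =
      ∫ s in (-(1 / 2) : ℝ)..(1 / 2), F s := by
    refine intervalIntegral.integral_congr fun s hs => ?_
    rw [Set.uIcc_of_le (by norm_num)] at hs
    simp only [hF]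
    rw [preProj_add hρ_supp hη hη2 φ k (abs_le.2 hs)]
  have h3 : ∫ s in (-(1 / 2) : ℝ)..(1 / 2), F s = ∫ s in (-η)..η, F s := by
    rw [intervalIntegral.integral_of_le (by norm_num), intervalIntegral.integral_of_le (by linarith)]
    refine setIntegral_eq_of_subset_of_ae_sdiff_eq_zero measurableSet_Ioc.nullMeasurableSet
      (Set.Ioc_subset_Ioc (by linarith) hη2.le) ?_
    have hne : ∀ᵐ x : ℝ, x ≠ -η := by simp [ae_iff, measure_singleton]
    filter_upwards [hne] with s hs hsm
    simp only [hF]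
    rw [rho_eq_zero hρ_supp]
    · simp
    · rw [abs_div, abs_of_pos hη, lt_div_iff₀ hη, one_mul]
      by_contra h
      rw [not_lt, abs_le] at h
      exact hsm.2 ⟨lt_of_le_of_ne h.1 (Ne.symm hs), h.2⟩
  have h5 := intervalIntegral.smul_integral_comp_mul_left (a := (-1 : ℝ)) (b := 1) F η
  rw [h2, h3, show -η = η * -1 by ring, show ∫ s in (η * -1)..η, F s = ∫ s in (η * -1)..(η * 1), F s by
    rw [mul_one], ← h5, Complex.real_smul]
  congr 1
  refine intervalIntegral.integral_congr fun t _ => ?_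
  simp only [hF]
  rw [mul_div_cancel_left₀ t hη.ne']

theorem preProj_mul_sub_pseudoFun {N d : ℕ} {ρ : ℝ → ℝ} (hρ_supp : tsupport ρ = Set.Icc (-1) 1)
    {c c' η : ℝ} (hη : 0 < η) (hη2 : η < 1 / 2) (hsep : ∀ k : ℤ, 2 * η < |c - c' + k|)
    (φ : Fin N → ℝ → ℝ) (k : Fin N) (φ' : ℝ → ℝ) (x : ℝ) :
    preProj d ρ c η φ k x * (φ' x - pseudoFun d c' η φ' x) = 0 := by
  set s : ℝ := x - c - round (x - c) with hs
  have hs2 : |s| ≤ 1 / 2 := abs_sub_round (x - c)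
  by_cases h : |s| ≤ η
  · have : pseudoFun d c' η φ' x = φ' x := by
      rw [pseudoFun, if_neg]
      rw [not_le]
      have h1 := hsep (round (x - c) - round (x - c'))
      have h2 : x - c' - round (x - c') = (c - c' + ((round (x - c) - round (x - c') : ℤ) : ℝ)) + s := by
        rw [hs]; push_cast; ring
      rw [h2]
      set y := c - c' + ((round (x - c) - round (x - c') : ℤ) : ℝ)
      have h3 := abs_sub_abs_le_abs_sub y (-s)
      rw [abs_neg, sub_neg_eq_add] at h3
      linarith
    rw [this, sub_self, mul_zero]
  · have : rhoScaled ρ η (x - c) = 0 := by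
      have h1 := (rhoScaled_periodic ρ η).sub_int_mul_eq (x := x - c) (round (x - c))
      rw [mul_one] at h1
      rw [← h1, rhoScaled_of_abs_le hρ_supp hη hη2 hs2]
      apply rho_eq_zero hρ_supp
      rw [abs_div, abs_of_pos hη, lt_div_iff₀ hη, one_mul]
      exact not_le.1 h
    rw [preProj, this, zero_mul, zero_mul]


theorem pseudoFun_intervalIntegrable {d : ℕ} {c η : ℝ} (hη : 0 < η) (hη2 : η < 1 / 2) {φ : ℝ → ℝ}
    (hφ : Function.Periodic φ 1) (hφc : Continuous φ) (a b : ℝ) :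
    IntervalIntegrable (fun x => (pseudoFun d c η φ x : ℂ)) volume a b := by
  have hp : Function.Periodic (fun x => (pseudoFun d c η φ x : ℂ)) 1 := fun x => by
    simp only [pseudoFun_periodic hφ x]
  refine hp.intervalIntegrable one_ne_zero (t := c - η) ?_ a b
  refine IntervalIntegrable.trans (b := c + η) ?_ ?_
  · have h1 : IntervalIntegrable
        (fun x => ((((pseudoPoly d η (fun t => φ (c + t))).eval (x - c) : ℝ)) : ℂ))
        volume (c - η) (c + η) := Continuous.intervalIntegrable (by fun_prop) _ _
    refine h1.congr fun x hx => ?_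
    rw [Set.uIoc_of_le (by linarith)] at hx
    have := pseudoFun_of_le (d := d) (c := c) φ hη2 (s := x - c)
      (abs_le.2 ⟨by linarith [hx.1], by linarith [hx.2]⟩)
    rw [add_sub_cancel] at this
    simp only [this]
  · have h1 : IntervalIntegrable (fun x => (φ x : ℂ)) volume (c + η) (c - η + 1) :=
      Continuous.intervalIntegrable (by fun_prop) _ _
    refine h1.congr_ae ?_
    rw [Filter.EventuallyEq, ae_restrict_iff' measurableSet_uIoc]
    have hne : ∀ᵐ x : ℝ, x ≠ c - η + 1 := by simp [ae_iff, measure_singleton]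
    filter_upwards [hne] with x hx hxm
    rw [Set.uIoc_of_le (by linarith)] at hxm
    have := pseudoFun_of_lt (d := d) (c := c) (η := η) φ (s := x - c) (by linarith [hxm.1])
      (by linarith [lt_of_le_of_ne hxm.2 hx])
    rw [add_sub_cancel] at this
    rw [this]

/-- The coefficients of the pseudo wave function on the projectors solve a linear system. -/
theorem proj_coeff_system {N d : ℕ} {ρ : ℝ → ℝ} (hρ_cont : Continuous ρ)
    (hρ_supp : tsupport ρ = Set.Icc (-1) 1) {c η : ℝ} (hη : 0 < η) (hη2 : η < 1 / 2)
    {φ : Fin N → ℝ → ℝ} (hφ : ∀ i, Function.Periodic (φ i) 1) (hφc : ∀ i, Continuous (φ i))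
    (hB : IsUnit (gramB d ρ c η φ).det) {ψ ψt g : ℝ → ℂ} (hψt : MemL2Per ψt)
    (hg : ∀ k x, (preProj d ρ c η φ k x : ℂ) * g x = 0)
    (h : ∀ᵐ x, ψt x + atomOp d ρ c η φ ψt x + g x = ψ x) (k : Fin N) :
    ∑ i, (∫ t in (0 : ℝ)..1, (proj d ρ c η φ i t : ℂ) * ψt t) *
      (∫ t in (0 : ℝ)..1, (preProj d ρ c η φ k t : ℂ) * (φ i t : ℂ)) =
      ∫ t in (0 : ℝ)..1, (preProj d ρ c η φ k t : ℂ) * ψ t := by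
  have hint := fun k {f : ℝ → ℂ} (hf : Function.Periodic f 1)
    (hfi : ∀ a b, IntervalIntegrable f volume a b) =>
    preProj_mul_intervalIntegrable (d := d) (c := c) hρ_cont hρ_supp hη hη2 hφ k hf hfi 0 1
  have hφi : ∀ i a b, IntervalIntegrable (fun x => (φ i x : ℂ)) volume a b := fun i a b => by
    have := hφc i
    exact Continuous.intervalIntegrable (by fun_prop) _ _
  have hφp : ∀ i, Function.Periodic (fun x => (φ i x : ℂ)) 1 := fun i x => by simp only [hφ i x]
  have hφti := fun i => pseudoFun_intervalIntegrable (d := d) (c := c) hη hη2 (hφ i) (hφc i)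
  have hφtp : ∀ i, Function.Periodic (fun x => (pseudoFun d c η (φ i) x : ℂ)) 1 := fun i x => by
    simp only [pseudoFun_periodic (hφ i) x]
  set α : Fin N → ℂ := fun i => ∫ t in (0 : ℝ)..1, (proj d ρ c η φ i t : ℂ) * ψt t with hα
  set B := gramB d ρ c η φ with hBd
  set v : Fin N → ℂ := fun j => ∫ t in (0 : ℝ)..1, (preProj d ρ c η φ j t : ℂ) * ψt t with hv
  have hαv : ∀ i, α i = ∑ j, (B⁻¹ i j : ℂ) * v j := by
    intro i
    simp only [hα, hv, ← intervalIntegral.integral_const_mul]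
    rw [← intervalIntegral.integral_finsetSum fun j _ =>
      (hint j hψt.periodic hψt.intervalIntegrable).const_mul _]
    congr 1
    ext t
    rw [proj]
    push_cast
    rw [Finset.sum_mul]
    exact Finset.sum_congr rfl fun j _ => by ring
  have hBα : ∑ i, α i * (B k i : ℂ) = v k := by
    have h1 : B * B⁻¹ = 1 := Matrix.mul_nonsing_inv _ hB
    simp_rw [hαv, Finset.sum_mul]
    rw [Finset.sum_comm]
    have h2 : ∀ j, ∑ i, (B⁻¹ i j : ℂ) * v j * (B k i : ℂ) = (if k = j then 1 else 0) * v j := by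
      intro j
      have h3 := congrArg (fun x : ℝ => (x : ℂ)) (congrFun (congrFun h1 k) j)
      rw [Matrix.mul_apply, Matrix.one_apply] at h3
      push_cast at h3
      have h4 : ∑ i, (B⁻¹ i j : ℂ) * v j * (B k i : ℂ) =
          (∑ i, (B k i : ℂ) * (B⁻¹ i j : ℂ)) * v j := by
        rw [Finset.sum_mul]
        exact Finset.sum_congr rfl fun i _ => by ring
      rw [h4, h3]
      split_ifs <;> simp
    simp_rw [h2]
    simp
  have hBki : ∀ i, ∫ t in (0 : ℝ)..1, (preProj d ρ c η φ k t : ℂ) * (pseudoFun d c η (φ i) t : ℂ) =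
      (B k i : ℂ) := by
    intro i
    simp only [hBd, gramB, Matrix.of_apply]
    rw [← intervalIntegral.integral_ofReal]
    simp
  have e1 : ∫ t in (0 : ℝ)..1, (preProj d ρ c η φ k t : ℂ) * ψ t =
      ∫ t in (0 : ℝ)..1, ((preProj d ρ c η φ k t : ℂ) * ψt t + ∑ i,
        (α i * ((preProj d ρ c η φ k t : ℂ) * (φ i t : ℂ)) -
          α i * ((preProj d ρ c η φ k t : ℂ) * (pseudoFun d c η (φ i) t : ℂ)))) := by
    apply intervalIntegral.integral_congr_ae
    filter_upwards [h] with t ht _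
    rw [← ht, mul_add, hg k t, add_zero, mul_add, atomOp, Finset.mul_sum]
    congr 1
    refine Finset.sum_congr rfl fun i _ => ?_
    simp only [hα]
    push_cast
    ring
  rw [e1, intervalIntegral.integral_add (hint k hψt.periodic hψt.intervalIntegrable)
    (intervalIntegrable_fun_sum fun i _ => ((hint k (hφp i) (hφi i)).const_mul _).sub
      ((hint k (hφtp i) (hφti i)).const_mul _)),
    intervalIntegral.integral_finsetSum fun i _ => ((hint k (hφp i) (hφi i)).const_mul _).sub
      ((hint k (hφtp i) (hφti i)).const_mul _)]
  simp_rw [fun i => intervalIntegral.integral_sub ((hint k (hφp i) (hφi i)).const_mul (α i))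
      ((hint k (hφtp i) (hφti i)).const_mul (α i)), intervalIntegral.integral_const_mul, hBki]
  rw [Finset.sum_sub_distrib, hBα]
  simp only [hv]
  ring

/-- Contribution of one atom to the Fourier coefficients of the pseudo wave function. -/
theorem exists_atom_fourier_bound {N d : ℕ} (hN : 1 ≤ N) (hNd : N ≤ d) {ρ : ℝ → ℝ}
    (hρ_cont : Continuous ρ) (hρ_nonneg : ∀ t, 0 ≤ ρ t) (hρ_supp : tsupport ρ = Set.Icc (-1) 1)
    (hρ_even : ∀ t, ρ (-t) = ρ t)
    {Z c : ℝ} (hZ : 0 < Z) {φ : Fin N → ℝ → ℝ} (hφ : IsAtomicFamily Z c φ) {E : ℝ} {ψ : ℝ → ℂ}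
    (hψp : Function.Periodic ψ 1) (hψc : Continuous ψ) {η₀ : ℝ} (hη₀ : η₀ < 1 / 2)
    (hψ : ∀ s ∈ Set.Icc 0 η₀, ψ (c + s) + ψ (c - s) = 2 * ψ c * cuspSol Z E s)
    (hwp : ∀ η, 0 < η → η ≤ η₀ → WellPosed d ρ c η φ) :
    ∃ C, 0 ≤ C ∧ ∀ η, 0 < η → η ≤ η₀ → ∀ ψt g : ℝ → ℂ, MemL2Per ψt →
      (∀ k x, (preProj d ρ c η φ k x : ℂ) * g x = 0) →
      (∀ᵐ x, ψt x + atomOp d ρ c η φ ψt x + g x = ψ x) →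
      ∀ m : ℤ, 1 ≤ m → 1 / η ≤ (m : ℝ) →
        IntervalIntegrable (fun x => atomOp d ρ c η φ ψt x * mode m x) volume 0 1 ∧
        ‖∑ k ∈ Finset.range N, ((2 * Real.pi * m) ^ 2 : ℂ)⁻¹ ^ (k + 1) *
            ((E : ℂ) ^ k * ((Z : ℂ) * ψ c * mode m c)) -
          ∫ x in (0 : ℝ)..1, atomOp d ρ c η φ ψt x * mode m x‖ ≤
          C * (η ^ (2 * N) / (m : ℝ) ^ 2 + 1 / (η ^ (d - 1) * (m : ℝ) ^ (d + 1))) := by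
  have hd : 1 ≤ d := hN.trans hNd
  obtain ⟨ε, hε, hφe⟩ := hφ
  have hns := fun i => nonsmooth_eigenfunction hZ (hφe i).1 (hφe i).2
  have hφp : ∀ i, Function.Periodic (φ i) 1 := fun i x =>
    Complex.ofReal_injective ((hφe i).1.periodic x)
  have hφc : ∀ i, Continuous (φ i) := fun i =>
    Complex.continuous_re.comp (hφe i).1.continuous
  set U : Fin N → ℝ → ℝ := fun i s => φ i c * cuspSol Z (ε i) s with hU
  have hUs : ∀ i, ContDiff ℝ (⊤ : ℕ∞) (U i) := fun i =>
    contDiff_const.mul (contDiff_cuspSol Z (ε i))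
  have hUsym : ∀ i s, U i (1 - s) = U i s := fun i s => by simp only [hU, (hns i).2.2.2 s]
  have hq : ∀ i η, 0 < η → η ≤ η₀ →
      pseudoPoly d η (fun t => φ i (c + t)) = pseudoPoly d η (U i) := by
    intro i η hη hηη₀
    refine pseudoPoly_congr hd hη fun k _ => Filter.EventuallyEq.iteratedDeriv_eq k ?_
    filter_upwards [Ioo_mem_nhds hη (show η < 1 by linarith)] with t ht
    exact (hns i).2.2.1 t ⟨ht.1.le, ht.2.le⟩
  have hφU : ∀ i s, |s| ≤ 1 / 2 → φ i (c + s) = U i |s| := by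
    intro i s hs
    rcases le_total 0 s with h | h
    · rw [abs_of_nonneg h] at hs ⊢
      exact (hns i).2.2.1 s ⟨h, by linarith⟩
    · rw [abs_of_nonpos h] at hs ⊢
      have := (hns i).2.1 (-s) ⟨by linarith, hs⟩
      rw [sub_neg_eq_add] at this
      rw [this]
      exact (hns i).2.2.1 (-s) ⟨by linarith, by linarith⟩
  -- the matrix of the system
  have hA : ∀ η, 0 < η → η ≤ η₀ → ∀ k i,
      ∫ t in (0 : ℝ)..1, preProj d ρ c η φ k t * φ i t = η * ∫ t in (-1 : ℝ)..1,
        ρ t * (pseudoPoly d η (U k)).eval (η * t) * U i (η * |t|) := by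
    intro η hη hηη₀ k i
    have h1 := integral_preProj_mul (d := d) (c := c) hρ_supp hη (hηη₀.trans_lt hη₀) hφp k
      (f := fun x => (φ i x : ℂ)) (fun x => by simp only [hφp i x])
    rw [hq k η hη hηη₀] at h1
    apply Complex.ofReal_injective
    rw [Complex.ofReal_mul, ← intervalIntegral.integral_ofReal, ← intervalIntegral.integral_ofReal]
    push_cast at h1 ⊢
    rw [h1]
    congr 1
    refine intervalIntegral.integral_congr fun t ht => ?_
    rw [Set.uIcc_of_le (by norm_num)] at ht
    have ht1 : |t| ≤ 1 := abs_le.2 ht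
    have hηt : |η * t| = η * |t| := by rw [abs_mul, abs_of_pos hη]
    rw [hφU i (η * t) (by rw [hηt]; nlinarith), hηt]
  have hdet : ∀ η, 0 < η → η ≤ η₀ → (Matrix.of fun k i : Fin N => ∫ t in (-1 : ℝ)..1, ρ t *
      (pseudoPoly d η (fun s => φ k c * cuspSol Z (ε k) s)).eval (η * t) *
        (φ i c * cuspSol Z (ε i) (η * |t|))).det ≠ 0 := by
    intro η hη hηη₀ h0
    have hPM : projMatrix d ρ c η φ = (gramB d ρ c η φ)⁻¹ * (η • Matrix.of fun k i : Fin N =>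
        ∫ t in (-1 : ℝ)..1, ρ t * (pseudoPoly d η (U k)).eval (η * t) * U i (η * |t|)) := by
      ext k l
      rw [Matrix.mul_apply]
      simp only [projMatrix, Matrix.of_apply, Matrix.smul_apply, smul_eq_mul]
      simp_rw [← hA η hη hηη₀, ← intervalIntegral.integral_const_mul]
      rw [← intervalIntegral.integral_finsetSum]
      · congr 1
        ext t
        rw [proj, Finset.sum_mul]
        exact Finset.sum_congr rfl fun j _ => by ring
      · intro j _
        have h1 := preProj_mul_intervalIntegrable (d := d) (c := c) hρ_cont hρ_supp hη
          (hηη₀.trans_lt hη₀) hφp j (f := fun x => (φ l x : ℂ))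
          (fun x => by simp only [hφp l x])
          (fun a b => (Complex.continuous_ofReal.comp (hφc l)).intervalIntegrable a b) 0 1
        have h2 : IntervalIntegrable (fun t => preProj d ρ c η φ j t * φ l t) volume 0 1 := by
          have h3 : (fun t => preProj d ρ c η φ j t * φ l t) =
              fun t => ((preProj d ρ c η φ j t : ℂ) * (φ l t : ℂ)).re := by
            ext t; rw [← Complex.ofReal_mul, Complex.ofReal_re]
          rw [h3]
          exact ⟨h1.1.re, h1.2.re⟩
        exact h2.const_mul _
    have h1 := (hwp η hη hηη₀).2.ne_zero
    rw [hPM, Matrix.det_mul, Matrix.det_smul, h0] at h1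
    simp at h1
  obtain ⟨C₁, hC₁0, hC₁⟩ := exists_cusp_stability_bound hN hNd hρ_cont hρ_nonneg hρ_supp Z E
    (fun i => (hns i).1) hε (by linarith) hdet
  choose C₂ hC₂0 hC₂ using fun i => (hφe i).1.exists_fourier_bound
  choose C₃ hC₃0 hC₃ using fun i => exists_bound_fourier_pseudoFun hd hη₀ (hφp i) (hUs i)
    (hns i).2.2.1 (hUsym i)
  set z := ψ c with hz
  set D₁ : ℝ := N * (Z * (C₁ * ‖z‖)) with hD₁
  set D₂ : ℝ := ∑ i, C₁ * ‖z‖ * (|ε i| ^ N * C₂ i) with hD₂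
  set D₃ : ℝ := ∑ i, C₁ * ‖z‖ * C₃ i with hD₃
  have hD₁0 : 0 ≤ D₁ := by positivity
  have hD₂0 : 0 ≤ D₂ := Finset.sum_nonneg fun i _ => by have := hC₂0 i; positivity
  have hD₃0 : 0 ≤ D₃ := Finset.sum_nonneg fun i _ => by have := hC₃0 i; positivity
  refine ⟨D₁ + D₂ + D₃, by positivity, fun η hη hηη₀ ψt g hψt hg hae m hm hmη => ?_⟩
  have hη2 : η < 1 / 2 := hηη₀.trans_lt hη₀
  have hm0 : (0 : ℝ) < m := by exact_mod_cast hm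
  set α : Fin N → ℂ := fun i => ∫ t in (0 : ℝ)..1, (proj d ρ c η φ i t : ℂ) * ψt t with hα
  have hsys := proj_coeff_system hρ_cont hρ_supp hη hη2 hφp hφc (hwp η hη hηη₀).1 hψt hg hae
  have hAc : ∀ k i, ∫ t in (0 : ℝ)..1, (preProj d ρ c η φ k t : ℂ) * (φ i t : ℂ) =
      η * ((∫ t in (-1 : ℝ)..1,
        ρ t * (pseudoPoly d η (U k)).eval (η * t) * U i (η * |t|) : ℝ) : ℂ) := by
    intro k i
    have h1 := congrArg (fun x : ℝ => (x : ℂ)) (hA η hη hηη₀ k i)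
    simp only [Complex.ofReal_mul] at h1
    rw [← h1, ← intervalIntegral.integral_ofReal]
    simp
  have hrhs : ∀ k, ∫ t in (0 : ℝ)..1, (preProj d ρ c η φ k t : ℂ) * ψ t =
      η * (z * ((∫ t in (-1 : ℝ)..1, ρ t * (pseudoPoly d η (U k)).eval (η * t) *
          cuspSol Z E (η * |t|) : ℝ) : ℂ)) := by
    intro k
    rw [integral_preProj_mul hρ_supp hη hη2 hφp k hψp, hq k η hη hηη₀]
    congr 1
    set κ : ℝ → ℝ := fun t => ρ t * (pseudoPoly d η (U k)).eval (η * t) with hκ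
    have hκe : ∀ t, κ (-t) = κ t := fun t => by
      simp only [hκ]
      rw [hρ_even, mul_neg, (isPseudoPoly_pseudoPoly hd hη (U k)).even]
    have hκc : Continuous κ := by fun_prop
    have i1 : IntervalIntegrable (fun t : ℝ => (κ t : ℂ) * ψ (c + η * t)) volume (-1) 1 :=
      Continuous.intervalIntegrable (by fun_prop) _ _
    have i2 : IntervalIntegrable (fun t : ℝ => (κ t : ℂ) * ψ (c - η * t)) volume (-1) 1 :=
      Continuous.intervalIntegrable (by fun_prop) _ _
    have h1 : ∫ t in (-1 : ℝ)..1, (κ t : ℂ) * ψ (c + η * t) =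
        ∫ t in (-1 : ℝ)..1, (κ t : ℂ) * ψ (c - η * t) := by
      have h2 := intervalIntegral.integral_comp_neg (a := (-1 : ℝ)) (b := 1)
        (fun t : ℝ => (κ t : ℂ) * ψ (c + η * t))
      rw [neg_neg] at h2
      rw [← h2]
      refine intervalIntegral.integral_congr fun t _ => ?_
      simp only [hκe, mul_neg, ← sub_eq_add_neg]
    have h3 : (∫ t in (-1 : ℝ)..1, (κ t : ℂ) * ψ (c + η * t)) +
        (∫ t in (-1 : ℝ)..1, (κ t : ℂ) * ψ (c - η * t)) =
        2 * (z * ((∫ t in (-1 : ℝ)..1, κ t * cuspSol Z E (η * |t|) : ℝ) : ℂ)) := by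
      rw [← intervalIntegral.integral_add i1 i2, ← intervalIntegral.integral_ofReal,
        ← intervalIntegral.integral_const_mul, ← intervalIntegral.integral_const_mul]
      refine intervalIntegral.integral_congr fun t ht => ?_
      rw [Set.uIcc_of_le (by norm_num)] at ht
      have ht1 : |t| ≤ 1 := abs_le.2 ht
      have h4 := hψ (η * |t|) ⟨by positivity, by nlinarith⟩
      have h5 : ψ (c + η * |t|) + ψ (c - η * |t|) = ψ (c + η * t) + ψ (c - η * t) := by
        rcases abs_choice t with h | h
        · rw [h]
        · rw [h, mul_neg, sub_neg_eq_add, ← sub_eq_add_neg, add_comm]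
      rw [h5] at h4
      rw [← mul_add, h4]
      push_cast
      ring
    rw [← h1] at h3
    linear_combination h3 / 2
  obtain ⟨hαb, hγb⟩ := hC₁ η hη hηη₀ α z (fun k => by
    have h1 := hsys k
    rw [hrhs k] at h1
    simp_rw [hAc] at h1
    have hη' : (η : ℂ) ≠ 0 := by exact_mod_cast hη.ne'
    apply mul_left_cancel₀ hη'
    rw [← h1, Finset.mul_sum]
    exact Finset.sum_congr rfl fun i _ => by ring)
  set w : ℂ := ((2 * Real.pi * m) ^ 2 : ℂ)⁻¹ with hw
  have hwm : ‖w‖ ≤ 1 / (m : ℝ) ^ 2 := norm_inv_two_pi_mul_sq_le hm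
  have hmη2 : 1 / (m : ℝ) ^ 2 ≤ η ^ 2 := by
    rw [← one_div_pow]
    exact pow_le_pow_left₀ (by positivity) ((one_div_le hη hm0).1 hmη) 2
  have hwη : ∀ k : ℕ, ‖w‖ ^ k ≤ η ^ (2 * k) := fun k => by
    rw [pow_mul]
    exact pow_le_pow_left₀ (norm_nonneg _) (hwm.trans hmη2) k
  have hcm := continuous_mode m
  have hiφ : ∀ i, IntervalIntegrable (fun x => (φ i x : ℂ) * mode m x) volume 0 1 := fun i => by
    have := hφc i
    exact Continuous.intervalIntegrable (by fun_prop) _ _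
  have hiφt : ∀ i, IntervalIntegrable (fun x => (pseudoFun d c η (φ i) x : ℂ) * mode m x)
      volume 0 1 := fun i =>
    (pseudoFun_intervalIntegrable hη hη2 (hφp i) (hφc i) 0 1).mul_continuousOn hcm.continuousOn
  have hop : ∀ x, atomOp d ρ c η φ ψt x * mode m x = ∑ i, (α i * ((φ i x : ℂ) * mode m x) -
      α i * ((pseudoFun d c η (φ i) x : ℂ) * mode m x)) := by
    intro x
    rw [atomOp, Finset.sum_mul]
    refine Finset.sum_congr rfl fun i _ => ?_
    simp only [hα]
    push_cast
    ring
  simp_rw [hop]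
  refine ⟨intervalIntegrable_fun_sum fun i _ => ((hiφ i).const_mul _).sub ((hiφt i).const_mul _), ?_⟩
  rw [intervalIntegral.integral_finsetSum fun i _ =>
    ((hiφ i).const_mul _).sub ((hiφt i).const_mul _)]
  simp_rw [fun i => intervalIntegral.integral_sub ((hiφ i).const_mul (α i))
    ((hiφt i).const_mul (α i)), intervalIntegral.integral_const_mul]
  set Φ : Fin N → ℂ := fun i => ∫ x in (0 : ℝ)..1, (φ i x : ℂ) * mode m x with hΦ
  set Φt : Fin N → ℂ := fun i => ∫ x in (0 : ℝ)..1, (pseudoFun d c η (φ i) x : ℂ) * mode m x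
    with hΦt
  have hexp : ∀ i, Φ i = ∑ k ∈ Finset.range N, w ^ (k + 1) * ((ε i : ℂ) ^ k *
      ((Z : ℂ) * φ i c * mode m c)) + w ^ N * (ε i : ℂ) ^ N * Φ i := by
    intro i
    have := (hφe i).1.fourier_expansion hm N
    simp only [Finset.univ_unique, Fin.default_eq_zero, Finset.sum_singleton,
      Matrix.cons_val_zero] at this
    exact this
  have hkey : ∑ k ∈ Finset.range N, w ^ (k + 1) * ((E : ℂ) ^ k * ((Z : ℂ) * z * mode m c)) -
      ∑ i, (α i * Φ i - α i * Φt i) =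
      ∑ k ∈ Finset.range N, w * (Z * mode m c) *
        (w ^ k * (z * (E : ℂ) ^ k - ∑ i, α i * (φ i c * (ε i : ℂ) ^ k))) -
      ∑ i, α i * (w ^ N * (ε i : ℂ) ^ N * Φ i) + ∑ i, α i * Φt i := by
    have h1 : ∑ i, α i * Φ i = ∑ k ∈ Finset.range N, w * (Z * mode m c) *
        (w ^ k * (∑ i, α i * (φ i c * (ε i : ℂ) ^ k))) +
        ∑ i, α i * (w ^ N * (ε i : ℂ) ^ N * Φ i) := by
      conv_lhs => enter [2, i]; rw [hexp i, mul_add]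
      rw [Finset.sum_add_distrib]
      congr 1
      simp_rw [Finset.mul_sum]
      rw [Finset.sum_comm]
      exact Finset.sum_congr rfl fun k _ => Finset.sum_congr rfl fun i _ => by ring
    rw [Finset.sum_sub_distrib, h1]
    simp only [mul_sub, Finset.sum_sub_distrib]
    have h2 : ∑ k ∈ Finset.range N, w ^ (k + 1) * ((E : ℂ) ^ k * ((Z : ℂ) * z * mode m c)) =
        ∑ k ∈ Finset.range N, w * (Z * mode m c) * (w ^ k * (z * (E : ℂ) ^ k)) :=
      Finset.sum_congr rfl fun k _ => by ring
    rw [h2]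
    ring
  rw [hkey]
  have b1 : ‖∑ k ∈ Finset.range N, w * (Z * mode m c) *
      (w ^ k * (z * (E : ℂ) ^ k - ∑ i, α i * (φ i c * (ε i : ℂ) ^ k)))‖ ≤
      D₁ * (η ^ (2 * N) / (m : ℝ) ^ 2) := by
    refine (norm_sum_le _ _).trans ?_
    have : ∀ k ∈ Finset.range N, ‖w * (Z * mode m c) *
        (w ^ k * (z * (E : ℂ) ^ k - ∑ i, α i * (φ i c * (ε i : ℂ) ^ k)))‖ ≤
        (1 / (m : ℝ) ^ 2 * Z) * (C₁ * ‖z‖ * η ^ (2 * N)) := by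
      intro k hk
      rw [norm_mul, norm_mul, norm_mul, norm_mode, mul_one, Complex.norm_real,
        Real.norm_of_nonneg hZ.le, norm_mul, norm_pow]
      refine mul_le_mul (mul_le_mul_of_nonneg_right hwm hZ.le) ?_ (by positivity) (by positivity)
      refine le_trans ?_ (hγb k (Finset.mem_range.1 hk))
      rw [mul_comm]
      exact mul_le_mul_of_nonneg_left (hwη k) (norm_nonneg _)
    refine (Finset.sum_le_card_nsmul _ _ _ this).trans (le_of_eq ?_)
    rw [Finset.card_range, nsmul_eq_mul, hD₁]
    ring
  have b2 : ‖∑ i, α i * (w ^ N * (ε i : ℂ) ^ N * Φ i)‖ ≤ D₂ * (η ^ (2 * N) / (m : ℝ) ^ 2) := by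
    rw [hD₂, Finset.sum_mul]
    refine (norm_sum_le _ _).trans (Finset.sum_le_sum fun i _ => ?_)
    rw [norm_mul, norm_mul, norm_mul, norm_pow, norm_pow, Complex.norm_real, Real.norm_eq_abs]
    have h1 := hαb i
    have h2 := hwη N
    have h3 := hC₂ i m hm
    have h4 := hC₂0 i
    calc ‖α i‖ * (‖w‖ ^ N * |ε i| ^ N * ‖Φ i‖)
        ≤ (C₁ * ‖z‖) * (η ^ (2 * N) * |ε i| ^ N * (C₂ i / (m : ℝ) ^ 2)) := by
          gcongr
      _ = _ := by ring
  have b3 : ‖∑ i, α i * Φt i‖ ≤ D₃ * (1 / (η ^ (d - 1) * (m : ℝ) ^ (d + 1))) := by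
    rw [hD₃, Finset.sum_mul]
    refine (norm_sum_le _ _).trans (Finset.sum_le_sum fun i _ => ?_)
    rw [norm_mul]
    have h1 := hαb i
    have h3 := hC₃ i η hη hηη₀ m hm
    have h4 := hC₃0 i
    calc ‖α i‖ * ‖Φt i‖ ≤ (C₁ * ‖z‖) * (C₃ i / (η ^ (d - 1) * (m : ℝ) ^ (d + 1))) :=
          mul_le_mul h1 h3 (norm_nonneg _) (by positivity)
      _ = _ := by ring
  set x₁ := η ^ (2 * N) / (m : ℝ) ^ 2 with hx₁
  set x₂ := 1 / (η ^ (d - 1) * (m : ℝ) ^ (d + 1)) with hx₂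
  have hx₁0 : 0 ≤ x₁ := by positivity
  have hx₂0 : 0 ≤ x₂ := by positivity
  refine (norm_add_le _ _).trans ((add_le_add (norm_sub_le _ _) le_rfl).trans ?_)
  nlinarith [mul_nonneg hD₁0 hx₂0, mul_nonneg hD₂0 hx₂0, mul_nonneg hD₃0 hx₁0]

end VPAW

end

open VPAW in
theorem theorem3p3 (Z₀ Zₐ a : ℝ) (hZ₀ : 0 < Z₀) (hZₐ : 0 < Zₐ) (ha0 : 0 < a) (ha1 : a < 1)
    (N d : ℕ) (hN : 1 ≤ N) (hd : N ≤ d)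
    (ρ : ℝ → ℝ) (hρ_cont : Continuous ρ) (hρ_nonneg : ∀ t, 0 ≤ ρ t)
    (hρ_supp : tsupport ρ = Set.Icc (-1) 1) (hρ_even : ∀ t, ρ (-t) = ρ t)
    (φ₀ φₐ : Fin N → ℝ → ℝ)
    (hφ₀ : VPAW.IsAtomicFamily Z₀ 0 φ₀) (hφₐ : VPAW.IsAtomicFamily Zₐ a φₐ)
    (E : ℝ) (ψ : ℝ → ℂ) (hψ : VPAW.IsDiracEigenfunction ![Z₀, Zₐ] ![0, a] E ψ)
    (η₀ : ℝ) (hη₀ : 0 < η₀) (hη₀_lt : η₀ < min (a / 2) ((1 - a) / 2))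
    (hwp : ∀ η : ℝ, 0 < η → η ≤ η₀ →
      VPAW.WellPosed d ρ 0 η φ₀ ∧ VPAW.WellPosed d ρ a η φₐ) :
    ∃ C : ℝ, 0 < C ∧ ∀ η : ℝ, 0 < η → η ≤ η₀ →
      ∀ ψt : ℝ → ℂ, VPAW.IsPseudoWave d ρ a η φ₀ φₐ ψ ψt →
        ∀ m : ℤ, 1 / η ≤ (m : ℝ) →
          ‖fourierCoeffOn (zero_lt_one : (0 : ℝ) < 1) ψt m‖ ≤
            C * (η ^ (2 * N) / (m : ℝ) ^ 2 + 1 / (η ^ (d - 1) * (m : ℝ) ^ (d + 1))) := by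
  rw [lt_min_iff] at hη₀_lt
  obtain ⟨ha2, ha3⟩ := hη₀_lt
  have hη₀2 : η₀ < 1 / 2 := by linarith
  have hψp := hψ.periodic
  have hψc := hψ.continuous
  have hev₀ := (hψ.even_odd (b := a - 1) (r := η₀) 0 hη₀.le (by simp; linarith) (by simp; linarith)
    (fun i hi => by
      fin_cases i
      · simp at hi
      · exact ⟨-1, by simp; ring⟩)).1
  have hevₐ := (hψ.even_odd (b := 0) (r := η₀) 1 hη₀.le (by simp; linarith) (by simp; linarith)
    (fun i hi => by
      fin_cases i
      · exact ⟨0, by simp⟩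
      · simp at hi)).1
  simp only [Matrix.cons_val_zero, Matrix.cons_val_one] at hev₀ hevₐ
  obtain ⟨C₁, hC₁0, hC₁⟩ := exists_atom_fourier_bound hN hd hρ_cont hρ_nonneg hρ_supp hρ_even hZ₀ hφ₀ hψp
    hψc hη₀2 hev₀ (fun η h h' => (hwp η h h').1)
  obtain ⟨C₂, hC₂0, hC₂⟩ := exists_atom_fourier_bound hN hd hρ_cont hρ_nonneg hρ_supp hρ_even hZₐ hφₐ hψp
    hψc hη₀2 hevₐ (fun η h h' => (hwp η h h').2)
  obtain ⟨C₃, hC₃0, hC₃⟩ := hψ.exists_fourier_bound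
  refine ⟨C₁ + C₂ + |E| ^ N * C₃ + 1, by positivity, fun η hη hηη₀ ψt hψt m hmη => ?_⟩
  have hη2 : η < 1 / 2 := hηη₀.trans_lt hη₀2
  have hm0 : (0 : ℝ) < m := lt_of_lt_of_le (by positivity) hmη
  have hm : 1 ≤ m := by exact_mod_cast hm0
  obtain ⟨hL2, hae⟩ := hψt
  have hsep₀ : ∀ k : ℤ, 2 * η < |(0 : ℝ) - a + k| := by
    intro k
    rcases le_or_gt k 0 with h | h
    · have : (k : ℝ) ≤ 0 := by exact_mod_cast h
      exact lt_of_lt_of_le (by linarith) (neg_le_abs _)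
    · have : (1 : ℝ) ≤ k := by exact_mod_cast h
      exact lt_of_lt_of_le (by linarith) (le_abs_self _)
  have hsepₐ : ∀ k : ℤ, 2 * η < |a - 0 + k| := by
    intro k
    have := hsep₀ (-k)
    rw [← abs_neg] at this
    push_cast at this
    convert this using 2
    ring
  have hvan : ∀ {c c' : ℝ}, (∀ k : ℤ, 2 * η < |c - c' + k|) → ∀ (φ φ' : Fin N → ℝ → ℝ) (k) (x : ℝ),
      (preProj d ρ c η φ k x : ℂ) * atomOp d ρ c' η φ' ψt x = 0 := by
    intro c c' hsep φ φ' k x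
    rw [atomOp, Finset.mul_sum]
    refine Finset.sum_eq_zero fun i _ => ?_
    have := preProj_mul_sub_pseudoFun (d := d) hρ_supp hη hη2 hsep φ k (φ' i) x
    rw [← mul_assoc, ← Complex.ofReal_mul, this, Complex.ofReal_zero, zero_mul]
  obtain ⟨hi₁, hb₁⟩ := hC₁ η hη hηη₀ ψt _ hL2 (hvan hsep₀ φ₀ φₐ) hae m hm hmη
  obtain ⟨hi₂, hb₂⟩ := hC₂ η hη hηη₀ ψt (atomOp d ρ 0 η φ₀ ψt) hL2 (hvan hsepₐ φₐ φ₀)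
    (hae.mono fun x hx => by rw [← hx]; ring) m hm hmη
  have hiψ : IntervalIntegrable (fun x => ψ x * mode m x) volume 0 1 :=
    (hψc.mul (continuous_mode m)).intervalIntegrable _ _
  have hF : fourierCoeffOn (zero_lt_one : (0 : ℝ) < 1) ψt m = ∫ x in (0 : ℝ)..1, ψt x * mode m x := by
    rw [fourierCoeffOn_eq_integral]
    simp only [sub_zero, div_one, one_smul, smul_eq_mul]
    refine intervalIntegral.integral_congr fun x _ => ?_
    simp only [fourier_coe_apply, mode]
    rw [mul_comm]
    congr 2
    push_cast
    ring
  have hsplit : ∫ x in (0 : ℝ)..1, ψt x * mode m x = (∫ x in (0 : ℝ)..1, ψ x * mode m x) -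
      (∫ x in (0 : ℝ)..1, atomOp d ρ 0 η φ₀ ψt x * mode m x) -
      ∫ x in (0 : ℝ)..1, atomOp d ρ a η φₐ ψt x * mode m x := by
    rw [← intervalIntegral.integral_sub hiψ hi₁, ← intervalIntegral.integral_sub (hiψ.sub hi₁) hi₂]
    apply intervalIntegral.integral_congr_ae
    filter_upwards [hae] with x hx _
    rw [← hx]
    ring
  have hexp := hψ.fourier_expansion hm N
  simp only [Fin.sum_univ_two, Matrix.cons_val_zero, Matrix.cons_val_one] at hexp
  set w : ℂ := ((2 * Real.pi * m) ^ 2 : ℂ)⁻¹ with hw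
  set Ψ : ℂ := ∫ x in (0 : ℝ)..1, ψ x * mode m x with hΨ
  set x₁ := η ^ (2 * N) / (m : ℝ) ^ 2 with hx₁
  set x₂ := 1 / (η ^ (d - 1) * (m : ℝ) ^ (d + 1)) with hx₂
  have hx₁0 : 0 ≤ x₁ := by positivity
  have hx₂0 : 0 ≤ x₂ := by positivity
  have hrem : ‖w ^ N * (E : ℂ) ^ N * Ψ‖ ≤ |E| ^ N * C₃ * x₁ := by
    have hwη : ‖w‖ ^ N ≤ η ^ (2 * N) := by
      rw [pow_mul]
      refine pow_le_pow_left₀ (norm_nonneg _) ((norm_inv_two_pi_mul_sq_le hm).trans ?_) N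
      rw [← one_div_pow]
      exact pow_le_pow_left₀ (by positivity) ((one_div_le hη hm0).1 hmη) 2
    rw [norm_mul, norm_mul, norm_pow, norm_pow, Complex.norm_real, Real.norm_eq_abs]
    have := hC₃ m hm
    calc ‖w‖ ^ N * |E| ^ N * ‖Ψ‖ ≤ η ^ (2 * N) * |E| ^ N * (C₃ / (m : ℝ) ^ 2) := by gcongr
      _ = _ := by rw [hx₁]; ring
  rw [hF, hsplit, hexp]
  simp only [mul_add, Finset.sum_add_distrib]
  set S₁ := ∑ k ∈ Finset.range N, w ^ (k + 1) * ((E : ℂ) ^ k * ((Z₀ : ℂ) * ψ 0 * mode m 0))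
  set S₂ := ∑ k ∈ Finset.range N, w ^ (k + 1) * ((E : ℂ) ^ k * ((Zₐ : ℂ) * ψ a * mode m a))
  set T₁ := ∫ x in (0 : ℝ)..1, atomOp d ρ 0 η φ₀ ψt x * mode m x
  set T₂ := ∫ x in (0 : ℝ)..1, atomOp d ρ a η φₐ ψt x * mode m x
  have e : S₁ + S₂ + w ^ N * (E : ℂ) ^ N * Ψ - T₁ - T₂ =
      (S₁ - T₁) + (S₂ - T₂) + w ^ N * (E : ℂ) ^ N * Ψ := by ring
  rw [e]
  refine (norm_add_le _ _).trans ((add_le_add (norm_add_le _ _) le_rfl).trans ?_)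
  have : 0 ≤ |E| ^ N * C₃ * x₂ := by positivity
  nlinarith
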